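/- **Model.** A streaming phase on graphs with vertex set $\{1,\dots,n\}$ is a randomized machine whose entire memory is a bit string. In a pass it reads every edge of the input graph $G$ exactly once, in an order chosen by an adversary (who may choose a new order before each pass, knowing the current state). After each edge, before the first pass and at the end of each pass, the memory is replaced by a random new one that depends only on the old memory and, where an edge is read, on that edge; before each pass the memory decides whether the phase is over. The memory used by a phase is the largest number of bits held between these updates. A two-phase algorithm runs a preprocessing phase from empty memory and then a sampling phase from the memory left by the first phase; its output is a function of the final memory. A word has $\lfloor\log_2 n\rfloor+1$ bits. **Graphlets.** Let $g_1,\dots,g_{m_k}$ represent the isomorphism classes of connected graphs on $k$ vertices. Let $l_i$ be the number of induced subgraphs of $G$ isomorphic to $g_i$, and $L=\sum_i l_i$. If $L>0$, the $k$-graphlet distribution of $G$ is $\mu=(l_1/L,\dots,l_{m_k}/L)$. **Theorem.** There are an absolute constant $C\in\mathbb N$ and a two-phase streaming algorithm with parameters $n\ge 1$, $k\ge 3$, $c>0$, $\alpha,\delta\in(0,1)$ and a number $M\in\mathbb N$ of words with $M\ge C(n+k\,m_k)$, such that for every simple graph $G$ on $n$ vertices and every adversary the algorithm always terminates, returns a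 probability distribution $\hat p$ on $\{1,\dots,m_k\}$, and satisfies the following. 1. With probability at least $1-\frac1n$, the preprocessing phase uses at most $C(1+\frac1c)$ passes and at most $C\,n^{1+c}(\ln(n+2))^{C}$ bits of memory. 2. The sampling phase always uses at most $$C\Big(k+\frac{k^{Ck}}{\alpha^4M}\ln\frac2\delta\Big)$$ passes and at most $M$ words of memory. 3. If $G$ has at least one $k$-graphlet, then with probability at least $1-\delta$, $\max_i|\hat p_i-\mu_i|\le\alpha$. -/

import Mathlib

noncomputable section

namespace GraphletStream

/-! ### The `k`-graphlet distribution -/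

/-- Isomorphism of connected graphs on `k` labelled vertices. -/
instance graphletSetoid (k : ℕ) : Setoid {H : SimpleGraph (Fin k) // H.Connected} where
  r H H' := Nonempty (H.1 ≃g H'.1)
  iseqv :=
    { refl := fun _ => ⟨SimpleGraph.Iso.refl⟩
      symm := fun ⟨f⟩ => ⟨f.symm⟩
      trans := fun ⟨f⟩ ⟨g⟩ => ⟨f.trans g⟩ }

/-- The isomorphism classes of connected graphs on `k` vertices. -/
def GraphletClass (k : ℕ) : Type := Quotient (graphletSetoid k)

instance (k : ℕ) : Finite (GraphletClass k) :=
  inferInstanceAs (Finite (Quotient (graphletSetoid k)))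

instance (k : ℕ) : Fintype (GraphletClass k) := Fintype.ofFinite _

/-- The chosen representative of an isomorphism class. -/
def GraphletClass.rep {k : ℕ} (i : GraphletClass k) : SimpleGraph (Fin k) := (Quotient.out i).1

/-- The number of vertex sets of `G` that induce a subgraph isomorphic to the representative of
the class `i`. Such a set has exactly `k` elements and induces a connected subgraph. -/
def graphletCount {n k : ℕ} (G : SimpleGraph (Fin n)) (i : GraphletClass k) : ℕ :=
  {S : Finset (Fin n) | Nonempty (G.induce (S : Set (Fin n)) ≃g i.rep)}.ncard

/-- The total number of `k`-graphlets of `G`. -/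
def numGraphlets {n : ℕ} (k : ℕ) (G : SimpleGraph (Fin n)) : ℕ :=
  ∑ i : GraphletClass k, graphletCount G i

/-- The `k`-graphlet distribution of `G` (meaningful when `G` has at least one `k`-graphlet). -/
def graphletDist {n k : ℕ} (G : SimpleGraph (Fin n)) (i : GraphletClass k) : ℝ :=
  (graphletCount G i : ℝ) / (numGraphlets k G : ℝ)

/-! ### Multi-pass streaming algorithms on edge streams -/

/-- The list `l` presents every edge of `G` exactly once, in some order. -/
def IsEdgeStream {n : ℕ} (G : SimpleGraph (Fin n)) (l : List (Sym2 (Fin n))) : Prop :=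
  l.Nodup ∧ ∀ e, e ∈ l ↔ e ∈ G.edgeSet

/-- The whole memory of an algorithm, a string of bits. -/
abbrev Memory := List Bool

/-- One phase of a randomized multi-pass streaming algorithm on graphs with vertex set `Fin n`.
All that the algorithm remembers, including any clock or counter, is the content of its memory;
every transition uses fresh randomness. -/
structure Phase (n : ℕ) where
  /-- what is done before the first pass of the phase -/
  start : Memory → PMF Memory
  /-- decides, before every pass, whether the phase is over -/
  halt : Memory → Bool
  /-- the update of the memory when the next edge of the stream is read -/
  step : Memory → Sym2 (Fin n) → PMF Memory
  /-- what is done at the end of a pass -/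
  endPass : Memory → PMF Memory

/-- A phase in progress: the present memory, the number of completed passes of the phase, and the
largest number of bits held in memory so far during the phase. -/
structure Config where
  mem : Memory
  passes : ℕ
  peak : ℕ

/-- Replace the memory, keeping track of the peak. -/
def Config.store (s : Config) (m : Memory) : Config :=
  { s with mem := m, peak := max s.peak m.length }

namespace Phase

variable {n : ℕ}

/-- Read the edges of a list one after the other. -/
def scan (A : Phase n) : List (Sym2 (Fin n)) → Config → PMF Config
  | [], s => PMF.pure s
  | e :: es, s => ((A.step s.mem e).map s.store).bind (A.scan es)

/-- One pass over the edge list `l`. -/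
def pass (A : Phase n) (l : List (Sym2 (Fin n))) (s : Config) : PMF Config :=
  (A.scan l s).bind fun t =>
    (A.endPass t.mem).map fun m => { t.store m with passes := t.passes + 1 }

/-- Make passes until the phase halts, but at most `N` of them. The adversary chooses the order of
the edges before each pass, knowing the configuration. -/
def runFrom (A : Phase n) (order : Config → List (Sym2 (Fin n))) : ℕ → Config → PMF Config
  | 0, s => PMF.pure s
  | N + 1, s => if A.halt s.mem then PMF.pure s
      else (A.pass (order s) s).bind (A.runFrom order N)

/-- Run the phase from the memory content `m`, for at most `N` passes. -/
def run (A : Phase n) (order : Config → List (Sym2 (Fin n))) (N : ℕ) (m : Memory) : PMF Config :=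
  (A.start m).bind fun m' => A.runFrom order N ⟨m', 0, max m.length m'.length⟩

end Phase

/-- A two-phase streaming algorithm that estimates the `k`-graphlet distribution: its output is
read off the memory at the end of the second phase. -/
structure TwoPhaseAlg (n k : ℕ) where
  preprocessing : Phase n
  sampling : Phase n
  output : Memory → GraphletClass k → ℝ

/-- The joint law of the configurations at the end of the two phases. The memory is empty at
first, and the second phase starts with the memory that the first phase leaves. Each phase is cut
off after `N` passes, so this is the law of the complete execution if both phases have halted
by then. -/
def TwoPhaseAlg.run {n k : ℕ} (A : TwoPhaseAlg n k) (order₁ : Config → List (Sym2 (Fin n)))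
    (order₂ : Config → Config → List (Sym2 (Fin n))) (N : ℕ) : PMF (Config × Config) :=
  (A.preprocessing.run order₁ N []).bind fun s₁ =>
    (A.sampling.run (order₂ s₁) N s₁.mem).map fun s₂ => (s₁, s₂)

/-- The number of bits of a machine word: the binary length of `n`. -/
def wordSize (n : ℕ) : ℕ := Nat.log 2 n + 1

end GraphletStream

end

noncomputable section

namespace GraphletStream

section

open scoped ENNReal

/-! ### Expectations with respect to a `PMF` -/

/-! Preprocessing needs one pass: count degrees and maintain the partition into components. It
leaves `profile`: d(v) is the degree of v if the component of v has at least k vertices, and 0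
otherwise.

Sampling runs many independent trials. A trial picks a root v with probability d(v)^(k-1)/Z, where Z
is `rootWeight`, and then grows a set S by k-1 vertices, one per pass. With D the maximum of d on S,
it draws t below |S|·D and follows the t-th edge of the stream that leaves S for a vertex of degree
profile at most D; it fails if there is no such edge. Since admissible vertices never raise the
maximum, D stays d(v). A given growth history therefore has probability d(v)^(k-1)/Z · ∏ 1/(i·d(v))
= 1/(Z·(k-1)!), whatever the degrees. One more pass records the edges inside S, and S is accepted
with probability 1/`growthCount`, the inverse of its number of histories. So every k-graphlet is
returned with the same probability 1/(Z·(k-1)!) (`sum_growthCount_mul_growthStep`,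
`sum_root_mul_trialGain`).

Success is not too rare: a vertex with any k-1 of its neighbours is a graphlet, so d(v)^(k-1) is at
most k^(2k) times the number of graphlets through v (`profile_pow_le`). Summing over v gives
Z·(k-1)! ≤ k^(4k)·L, and k^O(k)·log(1/δ)/α² trials suffice up to the union bound over classes.

Concentration is an exponential moment argument. The weight of the counters, times the conditional
expectation of the weights still to come, is a martingale from pass to pass
(`expect_pass_sampPotential`). The law of a pass does not depend on the order of its edges, so an
adaptive adversary gains nothing. Markov's inequality and a union bound over classes and signs
finish the estimate.

About M/(64k²) trials run in parallel, each round costing k passes. Two extreme ranges are settled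
by exact counting: for M ≥ 4n² one pass stores the graph, and for log(2/δ)/α⁴ ≥ n^(k+2) the budget
allows one pass per k-set. In the remaining range the counters fit into O(k) words each. -/

/-- The expectation of an extended nonnegative function. -/
def expect {X : Type*} (p : PMF X) (f : X → ℝ≥0∞) : ℝ≥0∞ := ∑' x, p x * f x

section expect

variable {X Y : Type*}

theorem expect_pure (x : X) (f : X → ℝ≥0∞) : expect (PMF.pure x) f = f x := by
  classical
  rw [expect, tsum_eq_single x]
  · simp
  · intro y hy; simp [PMF.pure_apply, hy]

theorem expect_bind (p : PMF X) (q : X → PMF Y) (f : Y → ℝ≥0∞) :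
    expect (p.bind q) f = expect p fun x => expect (q x) f := by
  simp only [expect, PMF.bind_apply, ← ENNReal.tsum_mul_right, ← ENNReal.tsum_mul_left]
  rw [ENNReal.tsum_comm]
  simp only [mul_assoc]

theorem expect_map (p : PMF X) (g : X → Y) (f : Y → ℝ≥0∞) :
    expect (p.map g) f = expect p fun x => f (g x) := by
  rw [PMF.map, expect_bind]
  simp [expect_pure]

theorem expect_mono (p : PMF X) {f g : X → ℝ≥0∞} (h : ∀ x ∈ p.support, f x ≤ g x) :
    expect p f ≤ expect p g := by
  refine ENNReal.tsum_le_tsum fun x => ?_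
  by_cases hx : x ∈ p.support
  · exact mul_le_mul_right (h x hx) _
  · simp [(PMF.apply_eq_zero_iff p x).2 hx]

theorem expect_congr (p : PMF X) {f g : X → ℝ≥0∞} (h : ∀ x ∈ p.support, f x = g x) :
    expect p f = expect p g :=
  le_antisymm (expect_mono p fun x hx => (h x hx).le) (expect_mono p fun x hx => (h x hx).ge)

theorem expect_const (p : PMF X) (a : ℝ≥0∞) : expect p (fun _ => a) = a := by
  rw [expect, ENNReal.tsum_mul_right, p.tsum_coe, one_mul]

theorem expect_const_mul (p : PMF X) (a : ℝ≥0∞) (f : X → ℝ≥0∞) :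
    expect p (fun x => a * f x) = a * expect p f := by
  simp only [expect, ← ENNReal.tsum_mul_left]
  exact tsum_congr fun x => by ring

theorem expect_mul_const (p : PMF X) (a : ℝ≥0∞) (f : X → ℝ≥0∞) :
    expect p (fun x => f x * a) = expect p f * a := by
  simp only [mul_comm _ a, expect_const_mul]

theorem expect_fintype [Fintype X] (p : PMF X) (f : X → ℝ≥0∞) :
    expect p f = ∑ x, p x * f x := tsum_fintype _

/-- Markov's inequality. -/
theorem toOuterMeasure_le_expect (p : PMF X) (s : Set X) (f : X → ℝ≥0∞)
    (h : ∀ x ∈ p.support, x ∈ s → 1 ≤ f x) : p.toOuterMeasure s ≤ expect p f := by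
  rw [PMF.toOuterMeasure_apply]
  refine ENNReal.tsum_le_tsum fun x => ?_
  by_cases hs : x ∈ s
  · rw [Set.indicator_of_mem hs]
    by_cases hx : x ∈ p.support
    · exact le_mul_of_one_le_right' (h x hx hs)
    · simp [(PMF.apply_eq_zero_iff p x).2 hx]
  · simp [hs]

theorem toOuterMeasure_eq_one (p : PMF X) {s : Set X} (h : p.support ⊆ s) :
    p.toOuterMeasure s = 1 := (PMF.toOuterMeasure_apply_eq_one_iff p s).2 h

theorem one_sub_le_toOuterMeasure (p : PMF X) {s t : Set X} {ε : ℝ≥0∞}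
    (hst : ∀ x ∈ p.support, x ∉ s → x ∈ t) (ht : p.toOuterMeasure t ≤ ε) :
    1 - ε ≤ p.toOuterMeasure s := by
  have h1 : p.toOuterMeasure (s ∪ t) = 1 := toOuterMeasure_eq_one p fun x hx => by
    by_cases hs : x ∈ s
    · exact Or.inl hs
    · exact Or.inr (hst x hx hs)
  rw [tsub_le_iff_right, ← h1]
  exact (MeasureTheory.measure_union_le s t).trans (by gcongr)

theorem expect_toOuterMeasure_bind (p : PMF X) (q : X → PMF Y) (s : Set Y) :
    (p.bind q).toOuterMeasure s = expect p fun x => (q x).toOuterMeasure s := by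
  rw [PMF.toOuterMeasure_bind_apply]; rfl

theorem le_expect (p : PMF X) {f : X → ℝ≥0∞} {a : ℝ≥0∞} (h : ∀ x ∈ p.support, a ≤ f x) :
    a ≤ expect p f := (expect_const p a).symm.le.trans (expect_mono p h)

end expect

/-! ### Independent draws -/

/-- Draw independently one value for every entry of a list. -/
def drawList {X Y : Type*} (f : X → PMF Y) : List X → PMF (List Y)
  | [] => PMF.pure []
  | x :: xs => (f x).bind fun y => (drawList f xs).map (y :: ·)

/-- Independence: the expectation of a product factors. This is the only form in which the
independence of parallel trials enters the concentration argument. -/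
theorem expect_drawList {X Y : Type*} (f : X → PMF Y) (h : Y → ℝ≥0∞) (xs : List X) :
    expect (drawList f xs) (fun ys => (ys.map h).prod) =
      (xs.map fun x => expect (f x) h).prod := by
  induction xs with
  | nil => simp [drawList, expect_pure]
  | cons x xs ih =>
    simp only [drawList, expect_bind, expect_map, List.map_cons, List.prod_cons,
      expect_const_mul, ih, expect_mul_const]

theorem forall₂_of_mem_support_drawList {X Y : Type*} (f : X → PMF Y) (xs : List X) :
    ∀ ys ∈ (drawList f xs).support, List.Forall₂ (fun x y => y ∈ (f x).support) xs ys := by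
  induction xs with
  | nil => simp [drawList]
  | cons x xs ih =>
    intro ys hys
    simp only [drawList, PMF.mem_support_bind_iff, PMF.mem_support_map_iff] at hys
    obtain ⟨y, hy, zs, hzs, rfl⟩ := hys
    exact .cons hy (ih zs hzs)

theorem length_of_mem_support_drawList {X Y : Type*} {f : X → PMF Y} {xs : List X} {ys : List Y}
    (h : ys ∈ (drawList f xs).support) : ys.length = xs.length :=
  (forall₂_of_mem_support_drawList f xs ys h).length_eq.symm

theorem exists_of_mem_support_drawList {X Y : Type*} {f : X → PMF Y} {xs : List X} {ys : List Y}
    (h : ys ∈ (drawList f xs).support) : ∀ y ∈ ys, ∃ x ∈ xs, y ∈ (f x).support := by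
  have := forall₂_of_mem_support_drawList f xs ys h
  clear h
  induction this with
  | nil => simp
  | cons h _ ih =>
    intro y hy
    rcases List.mem_cons.1 hy with rfl | hy
    · exact ⟨_, List.mem_cons_self, h⟩
    · obtain ⟨x, hx, h'⟩ := ih y hy
      exact ⟨x, List.mem_cons_of_mem _ hx, h'⟩

/-! ### Sets of states that fit into a number of bits -/

/-- The elements of `A` can be told apart by `L` bits. -/
def Fits {X : Type*} (A : Set X) (L : ℕ) : Prop := ∃ f : X → Fin L → Bool, Set.InjOn f A

namespace Fits

variable {X Y : Type*}

/-- The bits may be indexed by any finite type with at most `L` elements, so each closure property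
below can take an index type that mirrors the shape of the state. -/
theorem of_index {β : Type*} [Fintype β] {A : Set X} {L : ℕ} (hL : Fintype.card β ≤ L)
    (f : X → β → Bool) (hf : Set.InjOn f A) : Fits A L := by
  classical
  obtain ⟨e⟩ : Nonempty (β ↪ Fin L) := Function.Embedding.nonempty_of_card_le (by simpa using hL)
  refine ⟨fun x => Function.extend e (f x) fun _ => false, fun x hx y hy hxy => hf hx hy ?_⟩
  funext b
  simpa [e.injective.extend_apply] using congrFun hxy (e b)

theorem mono {A B : Set X} {L L' : ℕ} (h : Fits B L) (hAB : A ⊆ B) (hL : L ≤ L') : Fits A L' := by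
  obtain ⟨f, hf⟩ := h
  exact of_index (by simpa using hL) f (hf.mono hAB)

theorem comap {A : Set X} {B : Set Y} {L : ℕ} (h : Fits B L) (g : X → Y)
    (hAB : ∀ x ∈ A, g x ∈ B) (hg : Set.InjOn g A) : Fits A L := by
  obtain ⟨f, hf⟩ := h
  exact ⟨f ∘ g, hf.comp hg hAB⟩

theorem prod {A : Set X} {B : Set Y} {L L' : ℕ} (h : Fits A L) (h' : Fits B L') :
    Fits (A ×ˢ B) (L + L') := by
  obtain ⟨f, hf⟩ := h
  obtain ⟨g, hg⟩ := h'
  refine of_index (β := Fin L ⊕ Fin L') (by simp) (fun p => Sum.elim (f p.1) (g p.2)) ?_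
  rintro ⟨a, b⟩ ⟨ha, hb⟩ ⟨c, d⟩ ⟨hc, hd⟩ h
  have h1 : f a = f c := funext fun i => congrFun h (Sum.inl i)
  have h2 : g b = g d := funext fun i => congrFun h (Sum.inr i)
  exact Prod.ext (hf ha hc h1) (hg hb hd h2)

theorem sum {A : Set X} {B : Set Y} {L L' : ℕ} (h : Fits A L) (h' : Fits B L') :
    Fits {s : X ⊕ Y | Sum.elim (· ∈ A) (· ∈ B) s} (L + L' + 1) := by
  obtain ⟨f, hf⟩ := h
  obtain ⟨g, hg⟩ := h'
  refine of_index (β := Option (Fin L ⊕ Fin L')) (by simp) (fun s i => match s, i with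
    | .inl _, none => true
    | .inr _, none => false
    | .inl x, some (.inl i) => f x i
    | .inr y, some (.inr i) => g y i
    | _, _ => false) ?_
  rintro (a | a) ha (b | b) hb h
  · exact congrArg _ (hf ha hb (funext fun i => congrFun h (some (.inl i))))
  · exact absurd (congrFun h none) (by simp)
  · exact absurd (congrFun h none) (by simp)
  · exact congrArg _ (hg ha hb (funext fun i => congrFun h (some (.inr i))))

theorem pi {ι : Type*} [Fintype ι] {A : Set X} {L : ℕ} (h : Fits A L) :
    Fits {f : ι → X | ∀ i, f i ∈ A} (Fintype.card ι * L) := by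
  obtain ⟨f, hf⟩ := h
  refine of_index (β := ι × Fin L) (by simp) (fun x p => f (x p.1) p.2) fun x hx y hy hxy => ?_
  funext i
  exact hf (hx i) (hy i) (funext fun j => congrFun hxy (i, j))

theorem list {A : Set X} {L : ℕ} (b : ℕ) (h : Fits A L) :
    Fits {l : List X | l.length = b ∧ ∀ x ∈ l, x ∈ A} (b * L) := by
  obtain ⟨f, hf⟩ := h
  refine of_index (β := Fin b × Fin L) (by simp)
    (fun l p => if h : p.1.1 < l.length then f l[p.1.1] p.2 else false) ?_
  rintro l ⟨hl, hlA⟩ l' ⟨hl', hlA'⟩ h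
  refine List.ext_getElem (hl.trans hl'.symm) fun i h1 h2 => ?_
  refine hf (hlA _ (List.getElem_mem _)) (hlA' _ (List.getElem_mem _)) (funext fun j => ?_)
  simpa [h1, h2] using congrFun h (⟨i, hl ▸ h1⟩, j)

theorem nat (L : ℕ) : Fits {m : ℕ | m < 2 ^ L} L := by
  refine ⟨fun m i => m.testBit i, fun a ha b hb h => Nat.eq_of_testBit_eq fun i => ?_⟩
  by_cases hi : i < L
  · exact congrFun h ⟨i, hi⟩
  · have hp : 2 ^ L ≤ 2 ^ i := Nat.pow_le_pow_right (by norm_num) (not_lt.1 hi)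
    rw [Nat.testBit_eq_false_of_lt (lt_of_lt_of_le ha hp),
      Nat.testBit_eq_false_of_lt (lt_of_lt_of_le hb hp)]

/-- A fitting set of states can be coded by bit strings of a fixed length. -/
theorem exists_coding [Nonempty X] {A : Set X} {L : ℕ} (h : Fits A L) :
    ∃ (enc : X → Memory) (dec : Memory → X),
      (∀ x ∈ A, dec (enc x) = x) ∧ ∀ x, (enc x).length = L := by
  obtain ⟨f, hf⟩ := h
  have hinj : Set.InjOn (fun x => List.ofFn (f x)) A := fun x hx y hy h =>
    hf hx hy (List.ofFn_injective h)
  exact ⟨fun x => List.ofFn (f x), Function.invFunOn (fun x => List.ofFn (f x)) A,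
    fun x hx => hinj.leftInvOn_invFunOn hx, fun x => by simp⟩

end Fits

/-! ### Streaming machines with abstract states -/

/-- A streaming machine whose state is an element of an arbitrary type and that knows the number
of passes it still has to make. -/
structure Machine (n : ℕ) (σ : Type) where
  step : σ → Sym2 (Fin n) → PMF σ
  endPass : σ → PMF σ
  left : σ → ℕ

namespace Machine

variable {n : ℕ} {σ : Type}

/-- Read a list of edges. -/
def scan (A : Machine n σ) : List (Sym2 (Fin n)) → σ → PMF σ
  | [], x => PMF.pure x
  | e :: es, x => (A.step x e).bind (A.scan es)

/-- A complete pass over a list of edges. -/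
def pass (A : Machine n σ) (l : List (Sym2 (Fin n))) (x : σ) : PMF σ :=
  (A.scan l x).bind A.endPass

/-- The phase that runs a machine on coded states. -/
def toPhase (A : Machine n σ) (enc : σ → Memory) (dec : Memory → σ) (start : Memory → PMF σ) :
    Phase n where
  start m := (start m).map enc
  halt m := A.left (dec m) == 0
  step m e := (A.step (dec m) e).map enc
  endPass m := (A.endPass (dec m)).map enc

/-- A set of states that no transition leaves. -/
def Closed (A : Machine n σ) (ok : Set σ) : Prop :=
  (∀ x ∈ ok, ∀ e, (A.step x e).support ⊆ ok) ∧ ∀ x ∈ ok, (A.endPass x).support ⊆ ok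

theorem Closed.scan_subset {A : Machine n σ} {ok : Set σ} (h : A.Closed ok)
    (l : List (Sym2 (Fin n))) : ∀ x ∈ ok, (A.scan l x).support ⊆ ok := by
  induction l with
  | nil => intro x hx; simpa [scan] using hx
  | cons e es ih =>
    intro x hx y hy
    simp only [scan, PMF.mem_support_bind_iff] at hy
    obtain ⟨z, hz, hy⟩ := hy
    exact ih z (h.1 x hx e hz) hy

theorem Closed.pass_subset {A : Machine n σ} {ok : Set σ} (h : A.Closed ok)
    (l : List (Sym2 (Fin n))) (x : σ) (hx : x ∈ ok) : (A.pass l x).support ⊆ ok := by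
  intro y hy
  simp only [pass, PMF.mem_support_bind_iff] at hy
  obtain ⟨z, hz, hy⟩ := hy
  exact h.2 z (h.scan_subset l x hx hz) hy

theorem scan_of_deterministic (A : Machine n σ) {upd : σ → Sym2 (Fin n) → σ}
    (h : ∀ x e, A.step x e = PMF.pure (upd x e)) (l : List (Sym2 (Fin n))) (x : σ) :
    A.scan l x = PMF.pure (l.foldl upd x) := by
  induction l generalizing x with
  | nil => rfl
  | cons e es ih => simp [scan, h, PMF.pure_bind, ih]

/-! ### Transfer from abstract states to bit strings -/

section coded

variable {A : Machine n σ} {enc : σ → Memory} {dec : Memory → σ} {start : Memory → PMF σ}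
  {ok : Set σ} {L : ℕ}

/-- Decoding inverts encoding on `ok`, which no transition leaves, so the phase shadows the abstract
machine. All codes have length `L`, which bounds the peak. -/
theorem scan_support (hdec : ∀ x ∈ ok, dec (enc x) = x) (hlen : ∀ x, (enc x).length = L)
    (hcl : A.Closed ok) (l : List (Sym2 (Fin n))) :
    ∀ (s : Config) (x : σ), x ∈ ok → s.mem = enc x →
      ∀ t ∈ ((A.toPhase enc dec start).scan l s).support,
        ∃ y ∈ ok, y ∈ (A.scan l x).support ∧ t.mem = enc y ∧ t.passes = s.passes ∧
          t.peak ≤ max s.peak L := by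
  induction l with
  | nil =>
    intro s x hx hs t ht
    simp only [Phase.scan, PMF.support_pure, Set.mem_singleton_iff] at ht
    subst ht
    exact ⟨x, hx, by simp [scan], hs, rfl, le_max_left _ _⟩
  | cons e es ih =>
    intro s x hx hs t ht
    simp only [Phase.scan, PMF.mem_support_bind_iff, PMF.mem_support_map_iff, toPhase,
      hs, hdec x hx] at ht
    obtain ⟨s', ⟨m, ⟨y, hy, rfl⟩, rfl⟩, ht⟩ := ht
    obtain ⟨z, hz, hz', h1, h2, h3⟩ := ih _ y (hcl.1 x hx e hy) rfl t ht
    refine ⟨z, hz, ?_, h1, h2, h3.trans ?_⟩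
    · simp only [scan, PMF.mem_support_bind_iff]
      exact ⟨y, hy, hz'⟩
    · simp [Config.store, hlen]

theorem expect_scan (hdec : ∀ x ∈ ok, dec (enc x) = x)
    (hcl : A.Closed ok) (f : Memory → ℝ≥0∞) (l : List (Sym2 (Fin n))) :
    ∀ (s : Config) (x : σ), x ∈ ok → s.mem = enc x →
      expect ((A.toPhase enc dec start).scan l s) (fun t => f t.mem) =
        expect (A.scan l x) fun y => f (enc y) := by
  induction l with
  | nil => intro s x hx hs; simp [Phase.scan, scan, expect_pure, hs]
  | cons e es ih =>
    intro s x hx hs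
    simp only [Phase.scan, scan, expect_bind, expect_map, toPhase, hs, hdec x hx]
    refine expect_congr _ fun y hy => ?_
    exact ih (s.store (enc y)) y (hcl.1 x hx e hy) rfl

theorem pass_support (hdec : ∀ x ∈ ok, dec (enc x) = x) (hlen : ∀ x, (enc x).length = L)
    (hcl : A.Closed ok) (l : List (Sym2 (Fin n))) (s : Config) (x : σ) (hx : x ∈ ok)
    (hs : s.mem = enc x) (t : Config) (ht : t ∈ ((A.toPhase enc dec start).pass l s).support) :
    ∃ y ∈ ok, y ∈ (A.pass l x).support ∧ t.mem = enc y ∧ t.passes = s.passes + 1 ∧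
      t.peak ≤ max s.peak L := by
  simp only [Phase.pass, PMF.mem_support_bind_iff, PMF.mem_support_map_iff] at ht
  obtain ⟨t', ht', m, hm, rfl⟩ := ht
  obtain ⟨y, hy, hy', h1, h2, h3⟩ := scan_support hdec hlen hcl l s x hx hs t' ht'
  simp only [toPhase, PMF.mem_support_map_iff, h1, hdec y hy] at hm
  obtain ⟨z, hz, rfl⟩ := hm
  refine ⟨z, hcl.2 y hy hz, ?_, rfl, by simp [h2], ?_⟩
  · simp only [pass, PMF.mem_support_bind_iff]; exact ⟨y, hy', hz⟩
  · simp only [Config.store, hlen]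
    exact max_le h3 (le_max_right _ _)

theorem expect_pass (hdec : ∀ x ∈ ok, dec (enc x) = x)
    (hcl : A.Closed ok) (f : Memory → ℝ≥0∞) (l : List (Sym2 (Fin n))) (s : Config) (x : σ)
    (hx : x ∈ ok) (hs : s.mem = enc x) :
    expect ((A.toPhase enc dec start).pass l s) (fun t => f t.mem) =
      expect (A.pass l x) fun y => f (enc y) := by
  simp only [Phase.pass, pass, expect_bind, expect_map]
  refine (expect_scan hdec hcl (fun m => expect ((A.toPhase enc dec start).endPass m) f) l s x hx
    hs).trans (expect_congr _ fun y hy => ?_)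
  have hyok : y ∈ ok := hcl.scan_subset l x hx hy
  simp [toPhase, hdec y hyok, expect_map]

variable {G : SimpleGraph (Fin n)} {order : Config → List (Sym2 (Fin n))}

/-- `left` drops by exactly one in each pass, so it predicts the number of passes and any cutoff `N`
of at least that size is never felt. `P` is required only between passes, whereas `ok` survives
every update. -/
theorem runFrom_support (hdec : ∀ x ∈ ok, dec (enc x) = x) (hlen : ∀ x, (enc x).length = L)
    (hcl : A.Closed ok) (horder : ∀ s, IsEdgeStream G (order s)) {P : σ → Prop}
    (hP : ∀ x ∈ ok, P x → A.left x ≠ 0 → ∀ l, IsEdgeStream G l →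
      ∀ y ∈ (A.pass l x).support, P y ∧ A.left y + 1 = A.left x) (N : ℕ) :
    ∀ (s : Config) (x : σ), x ∈ ok → P x → s.mem = enc x → A.left x ≤ N →
      ∀ t ∈ ((A.toPhase enc dec start).runFrom order N s).support,
        ∃ y ∈ ok, P y ∧ A.left y = 0 ∧ t.mem = enc y ∧ t.passes = s.passes + A.left x ∧
          t.peak ≤ max s.peak L := by
  induction N with
  | zero =>
    intro s x hx hPx hs hN t ht
    simp only [Phase.runFrom, PMF.support_pure, Set.mem_singleton_iff] at ht
    subst ht
    have h0 : A.left x = 0 := Nat.le_zero.1 hN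
    exact ⟨x, hx, hPx, h0, hs, by simp [h0], le_max_left _ _⟩
  | succ N ih =>
    intro s x hx hPx hs hN t ht
    by_cases h0 : A.left x = 0
    · have hh : (A.toPhase enc dec start).halt s.mem = true := by
        simp [toPhase, hs, hdec x hx, h0]
      simp only [Phase.runFrom, hh, if_true, PMF.support_pure, Set.mem_singleton_iff] at ht
      subst ht
      exact ⟨x, hx, hPx, h0, hs, by simp [h0], le_max_left _ _⟩
    · have hh : ¬ (A.toPhase enc dec start).halt s.mem = true := by
        simp [toPhase, hs, hdec x hx, h0]
      simp only [Phase.runFrom, if_neg hh, PMF.mem_support_bind_iff] at ht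
      obtain ⟨s', hs', ht⟩ := ht
      obtain ⟨y, hy, hy', h1, h2, h3⟩ := pass_support hdec hlen hcl _ s x hx hs s' hs'
      obtain ⟨hPy, hly⟩ := hP x hx hPx h0 _ (horder s) y hy'
      obtain ⟨z, hz, hPz, hlz, h4, h5, h6⟩ := ih s' y hy hPy h1 (by omega) t ht
      exact ⟨z, hz, hPz, hlz, h4, by omega, h6.trans (max_le h3 (le_max_right _ _))⟩

/-- Supermartingale argument: the one-pass inequality is assumed for every edge order, hence it
holds for the order the adversary picks from the current configuration. -/
theorem expect_runFrom_le (hdec : ∀ x ∈ ok, dec (enc x) = x) (hlen : ∀ x, (enc x).length = L)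
    (hcl : A.Closed ok) (horder : ∀ s, IsEdgeStream G (order s)) {P : σ → Prop}
    (hP : ∀ x ∈ ok, P x → A.left x ≠ 0 → ∀ l, IsEdgeStream G l →
      ∀ y ∈ (A.pass l x).support, P y ∧ A.left y + 1 = A.left x) {Ψ : σ → ℝ≥0∞}
    (hΨ : ∀ x ∈ ok, P x → A.left x ≠ 0 → ∀ l, IsEdgeStream G l → expect (A.pass l x) Ψ ≤ Ψ x)
    (N : ℕ) :
    ∀ (s : Config) (x : σ), x ∈ ok → P x → s.mem = enc x →
      expect ((A.toPhase enc dec start).runFrom order N s) (fun t => Ψ (dec t.mem)) ≤ Ψ x := by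
  induction N with
  | zero => intro s x hx hPx hs; simp [Phase.runFrom, expect_pure, hs, hdec x hx]
  | succ N ih =>
    intro s x hx hPx hs
    by_cases h0 : A.left x = 0
    · have hh : (A.toPhase enc dec start).halt s.mem = true := by
        simp [toPhase, hs, hdec x hx, h0]
      simp only [Phase.runFrom, hh, if_true, expect_pure]
      rw [hs, hdec x hx]
    · have hh : ¬ (A.toPhase enc dec start).halt s.mem = true := by
        simp [toPhase, hs, hdec x hx, h0]
      simp only [Phase.runFrom, if_neg hh, expect_bind]
      calc _ ≤ expect ((A.toPhase enc dec start).pass (order s) s) fun t => Ψ (dec t.mem) := by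
            refine expect_mono _ fun s' hs' => ?_
            obtain ⟨y, hy, hy', h1, -, -⟩ := pass_support hdec hlen hcl _ s x hx hs s' hs'
            obtain ⟨hPy, -⟩ := hP x hx hPx h0 _ (horder s) y hy'
            rw [h1, hdec y hy]
            exact ih s' y hy hPy h1
        _ = expect (A.pass (order s) x) fun y => Ψ (dec (enc y)) :=
            expect_pass hdec hcl (fun m => Ψ (dec m)) _ s x hx hs
        _ = expect (A.pass (order s) x) Ψ := by
            refine expect_congr _ fun y hy => ?_
            rw [hdec y (hcl.pass_subset _ x hx hy)]
        _ ≤ Ψ x := hΨ x hx hPx h0 _ (horder s)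

end coded

end Machine

end

open scoped ENNReal Classical Finset

/-! ### Graphlets and their classes -/

section graphlets

variable {n k : ℕ}

/-- The vertex sets of the `k`-graphlets of `G`. -/
def graphlets (G : SimpleGraph (Fin n)) (k : ℕ) : Finset (Finset (Fin n)) :=
  {S | S.card = k ∧ (G.induce (S : Set (Fin n))).Connected}

theorem mem_graphlets {G : SimpleGraph (Fin n)} {S : Finset (Fin n)} :
    S ∈ graphlets G k ↔ S.card = k ∧ (G.induce (S : Set (Fin n))).Connected := by
  simp [graphlets]

/-- The class of the subgraph induced by a set of vertices, if it is a `k`-graphlet. -/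
def classOf (k : ℕ) (G : SimpleGraph (Fin n)) (S : Finset (Fin n)) : Option (GraphletClass k) :=
  if h : ∃ i : GraphletClass k, Nonempty (G.induce (S : Set (Fin n)) ≃g i.rep) then some h.choose
  else none

theorem GraphletClass.eq_of_iso {i j : GraphletClass k} (h : Nonempty (i.rep ≃g j.rep)) :
    i = j := by
  have : Quotient.mk (graphletSetoid k) (Quotient.out i) =
      Quotient.mk (graphletSetoid k) (Quotient.out j) := Quotient.sound h
  exact (Quotient.out_eq (s := graphletSetoid k) i).symm.trans
    (this.trans (Quotient.out_eq (s := graphletSetoid k) j))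

theorem classOf_eq_some_iff {G : SimpleGraph (Fin n)} {S : Finset (Fin n)} {i : GraphletClass k} :
    classOf k G S = some i ↔ Nonempty (G.induce (S : Set (Fin n)) ≃g i.rep) := by
  unfold classOf
  split_ifs with h
  · rw [Option.some_inj]
    constructor
    · rintro rfl; exact h.choose_spec
    · rintro ⟨f⟩
      obtain ⟨g⟩ := h.choose_spec
      exact GraphletClass.eq_of_iso ⟨g.symm.trans f⟩
  · simp only [false_iff]
    exact fun h' => h ⟨i, h'⟩

/-- Makes the class computable from the recorded edges inside the set alone. -/
theorem classOf_congr {G H : SimpleGraph (Fin n)} {S : Finset (Fin n)}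
    (h : ∀ a ∈ S, ∀ b ∈ S, G.Adj a b ↔ H.Adj a b) : classOf k G S = classOf k H S := by
  have : G.induce (S : Set (Fin n)) = H.induce (S : Set (Fin n)) := by
    ext a b; exact h a a.2 b b.2
  unfold classOf
  rw [this]

theorem exists_classOf_iff {G : SimpleGraph (Fin n)} {S : Finset (Fin n)} :
    (∃ i, classOf k G S = some i) ↔ S ∈ graphlets G k := by
  simp only [classOf_eq_some_iff, mem_graphlets]
  constructor
  · rintro ⟨i, ⟨f⟩⟩
    refine ⟨?_, f.connected_iff.2 (Quotient.out i).2⟩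
    simpa using Fintype.card_congr f.toEquiv
  · rintro ⟨hc, hG⟩
    let e : (S : Set (Fin n)) ≃ Fin k := Fintype.equivFinOfCardEq (by simpa using hc)
    let H : SimpleGraph (Fin k) := (G.induce (S : Set (Fin n))).map e.toEmbedding
    let f : G.induce (S : Set (Fin n)) ≃g H := SimpleGraph.Iso.map e _
    let i : GraphletClass k := Quotient.mk (graphletSetoid k) ⟨H, f.connected_iff.1 hG⟩
    obtain ⟨g⟩ : Nonempty (H ≃g i.rep) :=
      Setoid.symm (Quotient.mk_out (s := graphletSetoid k) ⟨H, f.connected_iff.1 hG⟩)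
    exact ⟨i, ⟨f.trans g⟩⟩

theorem graphletCount_eq (G : SimpleGraph (Fin n)) (i : GraphletClass k) :
    graphletCount G i = #{S ∈ graphlets G k | classOf k G S = some i} := by
  rw [graphletCount, ← Set.ncard_coe_finset]
  congr 1
  ext S
  simp only [Set.mem_ofPred_eq, Finset.coe_filter, ← classOf_eq_some_iff]
  exact ⟨fun h => ⟨exists_classOf_iff.1 ⟨i, h⟩, h⟩, fun h => h.2⟩

/-- Every graphlet has exactly one class, so a sum over graphlets can be grouped by class. -/
theorem sum_graphlets (G : SimpleGraph (Fin n)) (f : Option (GraphletClass k) → ℝ) :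
    ∑ S ∈ graphlets G k, f (classOf k G S) = ∑ i, graphletCount G i * f (some i) := by
  have h : ∀ S ∈ graphlets G k, f (classOf k G S) =
      ∑ i, if classOf k G S = some i then f (some i) else 0 := by
    intro S hS
    obtain ⟨i, hi⟩ := exists_classOf_iff.2 hS
    simp [hi]
  rw [Finset.sum_congr rfl h, Finset.sum_comm]
  refine Finset.sum_congr rfl fun i _ => ?_
  rw [← Finset.sum_filter, Finset.sum_const, graphletCount_eq, nsmul_eq_mul]

theorem numGraphlets_eq (G : SimpleGraph (Fin n)) : numGraphlets k G = #(graphlets G k) := by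
  have := sum_graphlets (k := k) G fun _ => 1
  simp only [Finset.sum_const, nsmul_eq_mul, mul_one] at this
  unfold numGraphlets
  exact_mod_cast this.symm

theorem card_graphletClass_le (k : ℕ) : Fintype.card (GraphletClass k) ≤ 2 ^ (k * k) := by
  have h1 : Fintype.card (GraphletClass k) ≤
      Fintype.card {H : SimpleGraph (Fin k) // H.Connected} :=
    Fintype.card_le_of_surjective (Quotient.mk (graphletSetoid k)) Quotient.mk_surjective
  have h2 : Fintype.card {H : SimpleGraph (Fin k) // H.Connected} ≤
      Fintype.card (Fin k → Fin k → Prop) :=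
    Fintype.card_le_of_injective (fun H => H.1.Adj) fun H H' h =>
      Subtype.ext (SimpleGraph.ext h)
  refine h1.trans (h2.trans (le_of_eq ?_))
  simp [pow_mul]

/-- All vertices up to `j` are joined to all other vertices. -/
def splitGraph (k j : ℕ) : SimpleGraph (Fin k) where
  Adj a b := a ≠ b ∧ (a.1 ≤ j ∨ b.1 ≤ j)
  symm := ⟨fun _ _ h => ⟨h.1.symm, h.2.symm⟩⟩
  loopless := ⟨fun _ h => h.1 rfl⟩

theorem splitGraph_connected {k : ℕ} (hk : 0 < k) (j : ℕ) : (splitGraph k j).Connected := by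
  have : Nonempty (Fin k) := ⟨⟨0, hk⟩⟩
  refine (SimpleGraph.connected_iff_exists_forall_reachable _).2 ⟨⟨0, hk⟩, fun w => ?_⟩
  by_cases h : (⟨0, hk⟩ : Fin k) = w
  · exact h ▸ SimpleGraph.Reachable.refl _
  · exact SimpleGraph.Adj.reachable ⟨h, Or.inl (Nat.zero_le _)⟩

theorem splitGraph_lt {k i j : ℕ} (hij : i < j) (hj : j + 1 < k) :
    splitGraph k i < splitGraph k j := by
  refine lt_of_le_of_ne (fun a b h => ⟨h.1, h.2.imp (by omega) (by omega)⟩) fun h => ?_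
  have h1 : (splitGraph k j).Adj ⟨j, by omega⟩ ⟨j + 1, hj⟩ := ⟨by simp, Or.inl le_rfl⟩
  rw [← h] at h1
  rcases h1.2 with h2 | h2 <;> simp only at h2 <;> omega

/-- The split graphs for j = 0, …, k-2 are connected and have strictly increasing edge numbers, so
they are pairwise non-isomorphic. The bound lets the k·m_k words granted pay for terms of size k².
-/
theorem le_card_graphletClass (k : ℕ) : k - 1 ≤ Fintype.card (GraphletClass k) := by
  rcases Nat.eq_zero_or_pos k with rfl | hk
  · simp
  let f : Fin (k - 1) → GraphletClass k := fun j =>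
    Quotient.mk (graphletSetoid k) ⟨splitGraph k j, splitGraph_connected hk j⟩
  have key : ∀ i j : Fin (k - 1), i < j → f i ≠ f j := by
    intro i j hij h
    obtain ⟨e⟩ : Nonempty (splitGraph k i ≃g splitGraph k j) := Quotient.exact h
    have h1 := e.card_edgeFinset_eq
    have h2 := Finset.card_lt_card (SimpleGraph.edgeFinset_ssubset_edgeFinset.2
      (splitGraph_lt (k := k) hij (by have := j.2; omega)))
    convert h2.ne h1
  have hf : Function.Injective f := by
    intro i j h
    rcases lt_trichotomy i j with h' | h' | h'
    · exact absurd h (key i j h')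
    · exact h'
    · exact absurd h.symm (key j i h')
  simpa using Fintype.card_le_of_injective f hf

end graphlets

/-! ### The degree profile -/

section profile

variable {n k : ℕ} {G : SimpleGraph (Fin n)}

/-- The component of `v` has at least `k` vertices. -/
def Alive (G : SimpleGraph (Fin n)) (k : ℕ) (v : Fin n) : Prop := k ≤ #{u | G.Reachable v u}

/-- The degrees of the vertices in components with at least `k` vertices. -/
def profile (G : SimpleGraph (Fin n)) (k : ℕ) (v : Fin n) : ℕ :=
  if Alive G k v then G.degree v else 0

theorem exists_crossing {V : Type*} {G : SimpleGraph V} {T : Set V} {v u : V} (hv : v ∈ T)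
    (hu : u ∉ T) (h : G.Reachable v u) : ∃ a ∈ T, ∃ b ∉ T, G.Adj a b := by
  obtain ⟨p⟩ := h
  obtain ⟨d, -, h1, h2⟩ := p.exists_boundary_dart T hv hu
  exact ⟨_, h1, _, h2, d.adj⟩

theorem Alive.of_reachable {v w : Fin n} (h : Alive G k v) (hvw : G.Reachable v w) :
    Alive G k w := by
  refine le_trans h (Finset.card_le_card fun u hu => ?_)
  simp only [Finset.mem_filter, Finset.mem_univ, true_and] at hu ⊢
  exact hvw.symm.trans hu

theorem induce_insert_connected {T : Finset (Fin n)} {a b : Fin n}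
    (hT : (G.induce (T : Set (Fin n))).Connected) (ha : a ∈ T) (hab : G.Adj a b) :
    (G.induce ((insert b T : Finset (Fin n)) : Set (Fin n))).Connected := by
  have hb : (G.induce ({b} : Set (Fin n))).Preconnected := by
    intro x y
    have : x = y := Subsingleton.elim _ _
    exact this ▸ SimpleGraph.Reachable.refl _
  have := SimpleGraph.connected_induce_union (G := G) hT.preconnected hb
    (Finset.mem_coe.2 ha) (Set.mem_singleton b) hab
  rw [Finset.coe_insert, Set.insert_eq, Set.union_comm]
  exact this

theorem induce_singleton_connected (v : Fin n) :
    (G.induce (({v} : Finset (Fin n)) : Set (Fin n))).Connected := by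
  rw [Finset.coe_singleton]
  have : Nonempty ({v} : Set (Fin n)) := ⟨⟨v, rfl⟩⟩
  exact ⟨fun x y => by rw [Subsingleton.elim x y]⟩

theorem reachable_of_mem_graphlet {S : Finset (Fin n)} (hS : S ∈ graphlets G k) {v w : Fin n}
    (hv : v ∈ S) (hw : w ∈ S) : G.Reachable v w :=
  ((mem_graphlets.1 hS).2.preconnected ⟨v, hv⟩ ⟨w, hw⟩).map
    (SimpleGraph.Embedding.induce (S : Set (Fin n))).toHom

theorem alive_of_mem_graphlet {S : Finset (Fin n)} (hS : S ∈ graphlets G k) {v : Fin n}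
    (hv : v ∈ S) : Alive G k v := by
  rw [Alive, ← (mem_graphlets.1 hS).1]
  refine Finset.card_le_card fun w hw => ?_
  simpa using reachable_of_mem_graphlet hS hv hw

theorem Alive.exists_not_mem {v : Fin n} (h : Alive G k v) {T : Finset (Fin n)}
    (hT : T.card < k) : ∃ u ∉ T, G.Reachable v u := by
  obtain ⟨u, hu, hu'⟩ := Finset.exists_mem_notMem_of_card_lt_card (lt_of_lt_of_le hT h)
  exact ⟨u, hu', by simpa using hu⟩

/-- As long as the connected set around `v` has fewer than `k` vertices, its component is not
exhausted and some edge leaves the set; its outer end can be added. -/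
theorem Alive.exists_graphlet {v : Fin n} (h : Alive G k v) (hk : 1 ≤ k) :
    ∃ S ∈ graphlets G k, v ∈ S := by
  have key : ∀ i, i + 1 ≤ k → ∃ T : Finset (Fin n), T.card = i + 1 ∧ v ∈ T ∧
      (G.induce (T : Set (Fin n))).Connected := by
    intro i
    induction i with
    | zero => exact fun _ => ⟨{v}, by simp, by simp, induce_singleton_connected v⟩
    | succ i ih =>
      intro hi
      obtain ⟨T, hT, hv, hc⟩ := ih (by omega)
      obtain ⟨u, hu, hvu⟩ := h.exists_not_mem (T := T) (by omega)
      obtain ⟨a, ha, b, hb, hab⟩ := exists_crossing (T := (T : Set (Fin n))) hv hu hvu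
      exact ⟨insert b T, by rw [Finset.card_insert_of_notMem hb, hT], by simp [hv],
        induce_insert_connected hc ha hab⟩
  obtain ⟨T, hT, hv, hc⟩ := key (k - 1) (by omega)
  exact ⟨T, mem_graphlets.2 ⟨by omega, hc⟩, hv⟩

theorem Alive.degree_pos {v : Fin n} (h : Alive G k v) (hk : 2 ≤ k) : 0 < G.degree v := by
  obtain ⟨u, hu, hvu⟩ := h.exists_not_mem (T := {v}) (by rw [Finset.card_singleton]; omega)
  obtain ⟨a, ha, b, hb, hab⟩ :=
    exists_crossing (T := (({v} : Finset (Fin n)) : Set (Fin n))) (by simp) hu hvu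
  simp only [Finset.coe_singleton, Set.mem_singleton_iff] at ha
  subst ha
  exact (G.degree_pos_iff_exists_adj a).2 ⟨b, hab⟩

theorem Alive.profile_eq {v : Fin n} (h : Alive G k v) : profile G k v = G.degree v := if_pos h

theorem alive_of_profile_pos {v : Fin n} (h : 0 < profile G k v) : Alive G k v := by
  by_contra h'
  simp [profile, h'] at h

theorem profile_le (G : SimpleGraph (Fin n)) (k : ℕ) (v : Fin n) : profile G k v ≤ n := by
  unfold profile
  split_ifs
  · exact (G.degree_lt_card_verts v).le.trans (by simp)
  · exact Nat.zero_le _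

theorem star_mem_graphlets {v : Fin n} {A : Finset (Fin n)} (hA : A ⊆ G.neighborFinset v)
    (hk : A.card + 1 = k) : insert v A ∈ graphlets G k := by
  have hv : v ∉ A := fun h => by simpa using hA h
  refine mem_graphlets.2 ⟨by rw [Finset.card_insert_of_notMem hv, hk], ?_⟩
  clear hk hv
  induction A using Finset.induction_on with
  | empty => exact induce_singleton_connected v
  | insert b A hb ih =>
    rw [Finset.insert_comm]
    refine induce_insert_connected (a := v) (ih fun x hx => hA (by simp [hx])) (by simp) ?_
    simpa using hA (Finset.mem_insert_self b A)

/-- Each of the `r` factors of the descending factorial of `d` is at least d+1-r, which is at least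
d/r. -/
theorem pow_le_mul_choose {d r : ℕ} (h : r ≤ d) : d ^ r ≤ r ^ r * r.factorial * d.choose r := by
  have h1 : (d + 1 - r) ^ r ≤ r.factorial * d.choose r := by
    rw [← Nat.descFactorial_eq_factorial_mul_choose]
    exact Nat.pow_sub_le_descFactorial d r
  have h2 : r = 0 ∨ d ≤ r * (d + 1 - r) := by
    rcases Nat.eq_zero_or_pos r with h0 | h0
    · exact Or.inl h0
    · right
      obtain ⟨e, rfl⟩ := Nat.exists_eq_add_of_le h
      rw [show r + e + 1 - r = e + 1 by omega]
      nlinarith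
  rcases h2 with rfl | h2
  · simp
  calc d ^ r ≤ (r * (d + 1 - r)) ^ r := Nat.pow_le_pow_left h2 r
    _ = r ^ r * (d + 1 - r) ^ r := Nat.mul_pow _ _ _
    _ ≤ r ^ r * (r.factorial * d.choose r) := Nat.mul_le_mul_left _ h1
    _ = _ := by ring

/-- Stars centred at `v` give C(d, k-1) distinct graphlets through `v`. If the degree is below k-1
there is no star, but a vertex in a large component still lies in one graphlet, and the constant
absorbs the power. Small components must get profile 0 for this reason. -/
theorem profile_pow_le (hk : 2 ≤ k) (v : Fin n) :
    profile G k v ^ (k - 1) ≤ k ^ (2 * k) * #{S ∈ graphlets G k | v ∈ S} := by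
  by_cases ha : Alive G k v
  swap
  · simp [profile, ha, show k - 1 ≠ 0 by omega]
  rw [ha.profile_eq]
  by_cases hd : k - 1 ≤ G.degree v
  · have h1 : (G.degree v).choose (k - 1) ≤ #{S ∈ graphlets G k | v ∈ S} := by
      rw [← SimpleGraph.card_neighborFinset_eq_degree, ← Finset.card_powersetCard]
      refine Finset.card_le_card_of_injOn (fun A => insert v A) ?_ ?_
      · intro A hA
        rw [Finset.mem_coe, Finset.mem_powersetCard] at hA
        rw [Finset.mem_coe, Finset.mem_filter]
        exact ⟨star_mem_graphlets hA.1 (by omega), Finset.mem_insert_self _ _⟩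
      · intro A hA B hB hAB
        rw [Finset.mem_coe, Finset.mem_powersetCard] at hA hB
        have hvA : v ∉ A := fun h => by simpa using hA.1 h
        have hvB : v ∉ B := fun h => by simpa using hB.1 h
        have := congrArg (fun s => s.erase v) hAB
        simpa [Finset.erase_insert hvA, Finset.erase_insert hvB] using this
    calc _ ≤ (k - 1) ^ (k - 1) * (k - 1).factorial * (G.degree v).choose (k - 1) :=
          pow_le_mul_choose hd
      _ ≤ k ^ (2 * k) * (G.degree v).choose (k - 1) := by
          refine Nat.mul_le_mul_right _ ?_
          rw [two_mul, pow_add]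
          refine Nat.mul_le_mul ?_ ?_
          · exact (Nat.pow_le_pow_left (Nat.sub_le _ _) _).trans
              (Nat.pow_le_pow_right (by omega) (Nat.sub_le _ _))
          · exact (Nat.factorial_le_pow _).trans ((Nat.pow_le_pow_left (Nat.sub_le _ _) _).trans
              (Nat.pow_le_pow_right (by omega) (Nat.sub_le _ _)))
      _ ≤ _ := Nat.mul_le_mul_left _ h1
  · obtain ⟨S, hS, hvS⟩ := ha.exists_graphlet (by omega)
    have h1 : 1 ≤ #{S ∈ graphlets G k | v ∈ S} := Finset.card_pos.2 ⟨S, by simp [hS, hvS]⟩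
    calc G.degree v ^ (k - 1) ≤ k ^ (k - 1) := Nat.pow_le_pow_left (by omega) _
      _ ≤ k ^ (2 * k) := Nat.pow_le_pow_right (by omega) (by omega)
      _ ≤ _ := Nat.le_mul_of_pos_right _ h1

/-- The total weight of the roots. -/
def rootWeight (d : Fin n → ℕ) (k : ℕ) : ℕ := ∑ v, d v ^ (k - 1)

/-- Sum `profile_pow_le` over the vertices; each graphlet is counted once for each of its `k`
vertices. -/
theorem rootWeight_profile_le (hk : 2 ≤ k) :
    rootWeight (profile G k) k ≤ k ^ (2 * k) * (k * #(graphlets G k)) := by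
  calc _ ≤ ∑ v, k ^ (2 * k) * #{S ∈ graphlets G k | v ∈ S} :=
        Finset.sum_le_sum fun v _ => profile_pow_le hk v
    _ = k ^ (2 * k) * ∑ S ∈ graphlets G k, S.card := by
        rw [← Finset.mul_sum]
        congr 1
        simp only [Finset.card_filter]
        rw [Finset.sum_comm]
        simp
    _ = _ := by
        rw [Finset.sum_congr rfl fun S hS => (mem_graphlets.1 hS).1, Finset.sum_const, smul_eq_mul,
          mul_comm k]

theorem rootWeight_profile_pos (hk : 2 ≤ k) (h : (graphlets G k).Nonempty) :
    0 < rootWeight (profile G k) k := by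
  obtain ⟨S, hS⟩ := h
  obtain ⟨v, hv⟩ : S.Nonempty := Finset.card_pos.1 (by rw [(mem_graphlets.1 hS).1]; omega)
  have ha := alive_of_mem_graphlet hS hv
  refine Finset.sum_pos' (fun _ _ => Nat.zero_le _) ⟨v, Finset.mem_univ _, ?_⟩
  rw [ha.profile_eq]
  exact pow_pos (ha.degree_pos hk) _

end profile

/-! ### Growing a set of vertices edge by edge -/

section growth

variable {n k : ℕ}

/-- The number of neighbours of `u` in `S`. -/
def linkCount (G : SimpleGraph (Fin n)) (S : Finset (Fin n)) (u : Fin n) : ℕ := #{a ∈ S | G.Adj a u}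

/-- The number of ways to obtain `S` from a single vertex with `d > 0` by adding `i` times the
outer end of an edge that leaves the present set, where `d` never exceeds the maximum of `d` on
this set. -/
def growthCount (G : SimpleGraph (Fin n)) (d : Fin n → ℕ) : ℕ → Finset (Fin n) → ℕ
  | 0, S => if ∃ v, S = {v} ∧ 0 < d v then 1 else 0
  | i + 1, S => ∑ u ∈ S, if d u ≤ (S.erase u).sup d then
      growthCount G d i (S.erase u) * linkCount G (S.erase u) u else 0

/-- Only edges inside the set matter, so the acceptance probability can be computed from the
recorded edges. -/
theorem growthCount_congr {G H : SimpleGraph (Fin n)} {d : Fin n → ℕ} (i : ℕ) :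
    ∀ {S : Finset (Fin n)}, (∀ a ∈ S, ∀ b ∈ S, G.Adj a b ↔ H.Adj a b) →
      growthCount G d i S = growthCount H d i S := by
  induction i with
  | zero => intro S _; rfl
  | succ i ih =>
    intro S h
    refine Finset.sum_congr rfl fun u hu => ?_
    rw [ih fun a ha b hb => h a (Finset.mem_of_mem_erase ha) b (Finset.mem_of_mem_erase hb)]
    have : linkCount G (S.erase u) u = linkCount H (S.erase u) u := by
      unfold linkCount
      congr 1
      exact Finset.filter_congr fun a ha => h a (Finset.mem_of_mem_erase ha) u hu
    rw [this]

theorem growthCount_ne_zero {G : SimpleGraph (Fin n)} {d : Fin n → ℕ} {i : ℕ} :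
    ∀ {S : Finset (Fin n)}, growthCount G d i S ≠ 0 → S.card = i + 1 ∧ 0 < S.sup d := by
  induction i with
  | zero =>
    intro S h
    simp only [growthCount, ne_eq, ite_eq_right_iff, one_ne_zero, imp_false, not_not] at h
    obtain ⟨v, rfl, hv⟩ := h
    simp [hv]
  | succ i ih =>
    intro S h
    obtain ⟨u, hu, hu'⟩ := Finset.exists_ne_zero_of_sum_ne_zero h
    simp only [ne_eq, ite_eq_right_iff, mul_eq_zero, not_forall, not_or] at hu'
    obtain ⟨-, h1, -⟩ := hu'
    obtain ⟨h2, h3⟩ := ih h1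
    refine ⟨?_, h3.trans_le (Finset.sup_mono (Finset.erase_subset _ _))⟩
    rw [Finset.card_erase_of_mem hu] at h2
    have := Finset.card_pos.2 ⟨u, hu⟩
    omega

/-- Start from a vertex where `d` is maximal on `S`: every other vertex of `S` is then admissible,
and connectedness always supplies an edge to a new one. -/
theorem growthCount_pos {G : SimpleGraph (Fin n)} {d : Fin n → ℕ} {i : ℕ} {S : Finset (Fin n)}
    (hS : S ∈ graphlets G (i + 1)) (hd : ∀ v ∈ S, 0 < d v) : 0 < growthCount G d i S := by
  obtain ⟨hcard, hconn⟩ := mem_graphlets.1 hS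
  obtain ⟨v, hv, hmax⟩ := Finset.exists_max_image S d (Finset.card_pos.1 (by omega))
  have key : ∀ j ≤ i, ∃ T ⊆ S, v ∈ T ∧ 0 < growthCount G d j T := by
    intro j
    induction j with
    | zero =>
      intro _
      refine ⟨{v}, by simpa using hv, by simp, ?_⟩
      have : ∃ w, ({v} : Finset (Fin n)) = {w} ∧ 0 < d w := ⟨v, rfl, hd v hv⟩
      simp only [growthCount, if_pos this, zero_lt_one]
    | succ j ih =>
      intro hj
      obtain ⟨T, hTS, hvT, hT⟩ := ih (by omega)
      obtain ⟨hTc, -⟩ := growthCount_ne_zero hT.ne'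
      obtain ⟨w, hwS, hwT⟩ := Finset.exists_mem_notMem_of_card_lt_card (s := T) (t := S) (by omega)
      obtain ⟨a, ha, b, hb, hab⟩ := exists_crossing (T := {x : (S : Set (Fin n)) | x.1 ∈ T})
        (v := ⟨v, hv⟩) (u := ⟨w, hwS⟩) hvT hwT (hconn.preconnected _ _)
      have hbT : b.1 ∉ T := hb
      refine ⟨insert b.1 T, Finset.insert_subset b.2 hTS, by simp [hvT], ?_⟩
      refine Finset.sum_pos' (fun _ _ => Nat.zero_le _) ⟨b.1, Finset.mem_insert_self _ _, ?_⟩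
      rw [Finset.erase_insert hbT, if_pos ((hmax b.1 b.2).trans (Finset.le_sup hvT))]
      exact mul_pos hT (Finset.card_pos.2 ⟨a.1, Finset.mem_filter.2 ⟨ha, hab⟩⟩)
  obtain ⟨T, hTS, -, hT⟩ := key i le_rfl
  obtain ⟨hTc, -⟩ := growthCount_ne_zero hT.ne'
  rwa [← Finset.eq_of_subset_of_card_le hTS (by omega)]

/-- The average of `g` after one growth step, where a step that fails counts as zero. -/
def growthStep (G : SimpleGraph (Fin n)) (d : Fin n → ℕ) (g : Finset (Fin n) → ℝ)
    (S : Finset (Fin n)) : ℝ :=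
  (∑ u, if u ∉ S ∧ d u ≤ S.sup d then linkCount G S u * g (insert u S) else 0) /
    (S.card * S.sup d : ℕ)

/-- Double counting of the pairs (S, u) with u ∉ S against the pairs (S ∪ {u}, u). The denominator
|S|·sup of a step, with |S| = i+1, turns i! into (i+1)! and consumes one power of the supremum;
admissibility of `u` keeps the supremum itself unchanged. This is the cancellation that makes all
growth histories equally likely. -/
theorem sum_growthCount_mul_growthStep (G : SimpleGraph (Fin n)) (d : Fin n → ℕ)
    (g : Finset (Fin n) → ℝ) (i m : ℕ) :
    ∑ S, growthCount G d i S * ((S.sup d : ℕ) : ℝ) ^ (m + 1) * growthStep G d g S / i.factorial =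
      ∑ S, growthCount G d (i + 1) S * ((S.sup d : ℕ) : ℝ) ^ m * g S / (i + 1).factorial := by
  -- The common contribution of adding `u` to `S`, to which both sides are reduced.
  let F : Finset (Fin n) → Fin n → ℝ := fun S u =>
    if d u ≤ S.sup d then growthCount G d i S * ((S.sup d : ℕ) : ℝ) ^ m * (linkCount G S u *
      g (insert u S)) / (i + 1).factorial else 0
  have hL : ∀ S, growthCount G d i S * ((S.sup d : ℕ) : ℝ) ^ (m + 1) * growthStep G d g S / i.factorial =
      ∑ u, if u ∉ S then F S u else 0 := by
    intro S
    -- Only where the count is nonzero are the size i+1 and a positive supremum available to cancel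
    -- the denominator.
    by_cases h0 : growthCount G d i S = 0
    · simp [h0, F]
    obtain ⟨hc, hs⟩ := growthCount_ne_zero h0
    have hs' : ((S.sup d : ℕ) : ℝ) ≠ 0 := by exact_mod_cast hs.ne'
    have hF : ∀ u, (if u ∉ S then F S u else 0) =
        growthCount G d i S * ((S.sup d : ℕ) : ℝ) ^ m / (i + 1).factorial *
          (if u ∉ S ∧ d u ≤ S.sup d then linkCount G S u * g (insert u S) else 0) := by
      intro u
      by_cases h1 : u ∈ S <;> by_cases h2 : d u ≤ S.sup d <;> simp [F, h1, h2]
      ring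
    rw [Finset.sum_congr rfl fun u _ => hF u, ← Finset.mul_sum, growthStep, hc,
      Nat.factorial_succ]
    push_cast
    have h1 : (i.factorial : ℝ) ≠ 0 := by exact_mod_cast i.factorial_ne_zero
    have h2 : (i : ℝ) + 1 ≠ 0 := by positivity
    field_simp
    ring
  have hR : ∀ S, growthCount G d (i + 1) S * ((S.sup d : ℕ) : ℝ) ^ m * g S / (i + 1).factorial =
      ∑ u, if u ∈ S then F (S.erase u) u else 0 := by
    intro S
    rw [← Finset.sum_filter, Finset.filter_mem_eq_inter, Finset.univ_inter, growthCount]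
    push_cast
    rw [Finset.sum_mul, Finset.sum_mul, Finset.sum_div]
    refine Finset.sum_congr rfl fun u hu => ?_
    simp only [F]
    split_ifs with h
    · have hsup : S.sup d = (S.erase u).sup d := by
        conv_lhs => rw [← Finset.insert_erase hu, Finset.sup_insert]
        exact sup_eq_right.2 h
      rw [hsup, Finset.insert_erase hu]
      ring
    · simp
  rw [Finset.sum_congr rfl fun S _ => hL S, Finset.sum_congr rfl fun S _ => hR S,
    Finset.sum_comm]
  conv_rhs => rw [Finset.sum_comm]
  refine Finset.sum_congr rfl fun u _ => ?_
  rw [← Finset.sum_filter (fun S => u ∉ S) (fun S => F S u),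
    ← Finset.sum_filter (fun S : Finset (Fin n) => u ∈ S) (fun S => F (S.erase u) u)]
  refine Finset.sum_nbij' (fun S => insert u S) (fun S => S.erase u) ?_ ?_ ?_ ?_ ?_
  · intro S hS; simp
  · intro S hS; simp
  · intro S hS; exact Finset.erase_insert (by simpa using hS)
  · intro S hS; exact Finset.insert_erase (by simpa using hS)
  · intro S hS; rw [Finset.erase_insert (by simpa using hS)]

theorem sum_growthCount_mul_iterate (G : SimpleGraph (Fin n)) (d : Fin n → ℕ)
    (g : Finset (Fin n) → ℝ) (j : ℕ) : ∀ i : ℕ,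
    ∑ S, growthCount G d i S * ((S.sup d : ℕ) : ℝ) ^ j * ((growthStep G d)^[j] g) S / i.factorial =
      ∑ S, growthCount G d (i + j) S * g S / (i + j).factorial := by
  induction j with
  | zero => intro i; simp
  | succ j ih =>
    intro i
    simp only [Function.iterate_succ_apply']
    rw [sum_growthCount_mul_growthStep, ih (i + 1)]
    simp only [Nat.succ_add, Nat.add_succ, Nat.add_zero]

/-- The root weight d(v)^j is used up by the `j` growth steps. Singletons are the only sets with
histories of length 0. A vertex with d(v) = 0 has no such history, and its weight on the left
vanishes because j ≠ 0. -/
theorem sum_root_mul_iterate (G : SimpleGraph (Fin n)) (d : Fin n → ℕ)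
    (g : Finset (Fin n) → ℝ) {j : ℕ} (hj : j ≠ 0) :
    ∑ v, (d v : ℝ) ^ j * ((growthStep G d)^[j] g) {v} =
      ∑ S, growthCount G d j S * g S / j.factorial := by
  have h := sum_growthCount_mul_iterate G d g j 0
  rw [zero_add] at h
  rw [← h]
  have h1 : ∀ S : Finset (Fin n), (growthCount G d 0 S * ((S.sup d : ℕ) : ℝ) ^ j *
      ((growthStep G d)^[j] g) S / (Nat.factorial 0 : ℝ)) =
      ∑ v, if S = {v} then (d v : ℝ) ^ j * ((growthStep G d)^[j] g) {v} else 0 := by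
    intro S
    by_cases hS : ∃ v, S = {v}
    · obtain ⟨v, rfl⟩ := hS
      simp only [Finset.singleton_inj, Finset.sum_ite_eq, Finset.mem_univ, if_true,
        Finset.sup_singleton, Nat.factorial_zero, Nat.cast_one, div_one]
      by_cases hv : 0 < d v
      · simp [growthCount, hv]
      · simp [Nat.eq_zero_of_not_pos hv, hj]
    · push Not at hS
      simp [growthCount, hS]
  rw [Finset.sum_congr rfl fun S _ => h1 S, Finset.sum_comm]
  simp

end growth

/-! ### Preprocessing: degrees and components in one pass -/

section preprocessing

variable {n k : ℕ}

theorem lt_two_pow_wordSize {m : ℕ} (h : m ≤ n) : m < 2 ^ wordSize n :=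
  h.trans_lt (Nat.lt_pow_succ_log_self (by norm_num) n)

theorem wordSize_pos (n : ℕ) : 0 < wordSize n := Nat.succ_pos _

theorem Fits.le (n : ℕ) : Fits {m : ℕ | m ≤ n} (wordSize n) :=
  (Fits.nat (wordSize n)).mono (fun _ h => lt_two_pow_wordSize h) le_rfl

theorem Fits.fun_le (n : ℕ) : Fits {d : Fin n → ℕ | ∀ v, d v ≤ n} (n * wordSize n) := by
  simpa using (Fits.le n).pi (ι := Fin n)

/-- A partition is determined by the map sending each vertex to the chosen representative of its
class, one word per vertex. -/
theorem Fits.setoid (n : ℕ) : Fits (Set.univ : Set (Setoid (Fin n))) (n * wordSize n) := by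
  refine (Fits.fun_le n).comap (fun r v => (Quotient.out (Quotient.mk r v)).1)
    (fun r _ v => (Fin.is_lt _).le) fun r _ r' _ h => ?_
  have key : ∀ (r : Setoid (Fin n)) (a b : Fin n), r a b ↔
      (Quotient.out (Quotient.mk r a)).1 = (Quotient.out (Quotient.mk r b)).1 := by
    intro r a b
    rw [← Fin.ext_iff, Quotient.out_inj]
    exact (Quotient.eq (r := r)).symm
  refine Setoid.ext fun a b => ?_
  have ha := congrFun h a
  have hb := congrFun h b
  simp only at ha hb
  rw [key r, key r', ha, hb]

/-- The state of the preprocessing: degrees and components of the edges read so far, and in the end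
the degree profile. -/
abbrev PreState (n : ℕ) : Type := ((Fin n → ℕ) × Setoid (Fin n)) ⊕ (Fin n → ℕ)

/-- The equivalence relation generated by one edge. -/
def edgeSetoid (e : Sym2 (Fin n)) : Setoid (Fin n) := Relation.EqvGen.setoid fun a b => s(a, b) = e

/-- Count an edge at its ends. -/
def countEdge (c : Fin n → ℕ) (e : Sym2 (Fin n)) (v : Fin n) : ℕ :=
  if v ∈ e then min (c v + 1) n else c v

/-- Take an edge into account. -/
def PreState.read : PreState n → Sym2 (Fin n) → PreState n
  | .inl (c, r), e => .inl (countEdge c e, r ⊔ edgeSetoid e)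
  | .inr d, _ => .inr d

/-- Compute the profile at the end of the pass. -/
def PreState.finish (k : ℕ) : PreState n → PreState n
  | .inl (c, r) => .inr fun v => if k ≤ #{u | r v u} then c v else 0
  | .inr d => .inr d

/-- The preprocessing machine. -/
def preMachine (n k : ℕ) : Machine n (PreState n) where
  step x e := PMF.pure (x.read e)
  endPass x := PMF.pure (x.finish k)
  left := Sum.elim (fun _ => 1) fun _ => 0

/-- All counters are at most `n`. -/
def preStates (n : ℕ) : Set (PreState n) :=
  {s | Sum.elim (· ∈ {d : Fin n → ℕ | ∀ v, d v ≤ n} ×ˢ Set.univ)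
    (· ∈ {d : Fin n → ℕ | ∀ v, d v ≤ n}) s}

theorem preStates_fits (n : ℕ) : Fits (preStates n) (3 * (n * wordSize n) + 1) :=
  (((Fits.fun_le n).prod (Fits.setoid n)).sum (Fits.fun_le n)).mono subset_rfl (by omega)

theorem preMachine_closed (n k : ℕ) : (preMachine n k).Closed (preStates n) := by
  refine ⟨?_, ?_⟩
  · rintro (⟨c, r⟩ | d) hx e y hy <;>
      simp only [preMachine, PreState.read, PMF.support_pure, Set.mem_singleton_iff] at hy <;>
      subst hy
    · refine ⟨fun v => ?_, Set.mem_univ _⟩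
      have := hx.1 v
      simp only [countEdge]
      split_ifs
      · exact min_le_right _ _
      · exact this
    · exact hx
  · rintro (⟨c, r⟩ | d) hx y hy <;>
      simp only [preMachine, PreState.finish, PMF.support_pure, Set.mem_singleton_iff] at hy <;>
      subst hy
    · intro v
      have := hx.1 v
      simp only
      split_ifs
      · exact this
      · exact Nat.zero_le _
    · exact hx

theorem foldl_read (l : List (Sym2 (Fin n))) (c : Fin n → ℕ) (r : Setoid (Fin n)) :
    l.foldl PreState.read (.inl (c, r)) =
      .inl (l.foldl countEdge c, l.foldl (fun r e => r ⊔ edgeSetoid e) r) := by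
  induction l generalizing c r with
  | nil => rfl
  | cons e es ih => exact ih _ _

/-- The cap at `n` in `countEdge` keeps the state set closed under arbitrary inputs; it is never
active when the true final count is at most `n`. -/
theorem foldl_countEdge (l : List (Sym2 (Fin n))) (c : Fin n → ℕ) (v : Fin n)
    (h : c v + l.countP (v ∈ ·) ≤ n) : l.foldl countEdge c v = c v + l.countP (v ∈ ·) := by
  induction l generalizing c with
  | nil => simp
  | cons e es ih =>
    rw [List.countP_cons] at h ⊢
    have h1 : countEdge c e v = c v + if decide (v ∈ e) = true then 1 else 0 := by
      by_cases hv : v ∈ e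
      · simp only [hv, decide_true, if_true] at h
        simp only [countEdge, hv, decide_true, if_true]
        exact min_eq_left (by omega)
      · simp [countEdge, hv]
    rw [List.foldl_cons, ih _ (by omega), h1]
    omega

theorem IsEdgeStream.countP_eq {G : SimpleGraph (Fin n)} {l : List (Sym2 (Fin n))}
    (h : IsEdgeStream G l) (v : Fin n) : l.countP (v ∈ ·) = G.degree v := by
  rw [List.countP_eq_length_filter, ← List.toFinset_card_of_nodup (h.1.filter _),
    ← G.card_incidenceFinset_eq_degree]
  congr 1
  ext e
  simp [SimpleGraph.mem_incidenceFinset, SimpleGraph.incidenceSet, h.2]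

/-- The fold is the least equivalence relation containing all edges of the stream, hence
reachability. -/
theorem foldl_edgeSetoid_iff {G : SimpleGraph (Fin n)} {l : List (Sym2 (Fin n))}
    (h : IsEdgeStream G l) (a b : Fin n) :
    (l.foldl (fun r e => r ⊔ edgeSetoid e) ⊥) a b ↔ G.Reachable a b := by
  -- `h1` and `h2` say that the fold is a least upper bound, independently of the order of the
  -- edges.
  have h1 : ∀ (l : List (Sym2 (Fin n))) (r s : Setoid (Fin n)), r ≤ s →
      (∀ e ∈ l, edgeSetoid e ≤ s) → l.foldl (fun r e => r ⊔ edgeSetoid e) r ≤ s := by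
    intro l
    induction l with
    | nil => exact fun r s hr _ => hr
    | cons e es ih =>
      exact fun r s hr hl => ih _ s (sup_le hr (hl e (by simp))) fun f hf => hl f (by simp [hf])
  have h2 : ∀ (l : List (Sym2 (Fin n))) (r : Setoid (Fin n)),
      r ≤ l.foldl (fun r e => r ⊔ edgeSetoid e) r ∧
        ∀ e ∈ l, edgeSetoid e ≤ l.foldl (fun r e => r ⊔ edgeSetoid e) r := by
    intro l
    induction l with
    | nil => exact fun r => ⟨le_rfl, by simp⟩
    | cons e es ih =>
      intro r
      obtain ⟨h3, h4⟩ := ih (r ⊔ edgeSetoid e)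
      refine ⟨le_sup_left.trans h3, fun f hf => ?_⟩
      rcases List.mem_cons.1 hf with rfl | hf
      · exact le_sup_right.trans h3
      · exact h4 f hf
  constructor
  · refine fun hab => h1 l ⊥ G.reachableSetoid bot_le (fun e he => ?_) hab
    refine Setoid.eqvGen_le fun x y hxy => ?_
    have : s(x, y) ∈ G.edgeSet := hxy ▸ (h.2 e).1 he
    exact SimpleGraph.Adj.reachable this
  · rintro ⟨p⟩
    induction p with
    | nil => exact Setoid.refl' _ _
    | cons hadj _ ih =>
      exact Setoid.trans' _ ((h2 l ⊥).2 _ ((h.2 _).2 hadj) (Relation.EqvGen.rel _ _ rfl)) ih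

theorem preMachine_pass {G : SimpleGraph (Fin n)} {l : List (Sym2 (Fin n))}
    (h : IsEdgeStream G l) :
    (preMachine n k).pass l (.inl (0, ⊥)) = PMF.pure (.inr (profile G k)) := by
  rw [Machine.pass, (preMachine n k).scan_of_deterministic (upd := PreState.read) fun _ _ => rfl,
    PMF.pure_bind, foldl_read]
  have h1 : ∀ v, l.foldl countEdge 0 v = G.degree v := by
    intro v
    have hd : l.countP (v ∈ ·) ≤ n := by
      rw [h.countP_eq]; exact (G.degree_lt_card_verts v).le.trans (by simp)
    rw [foldl_countEdge l 0 v (by simpa using hd), h.countP_eq]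
    simp
  change PMF.pure _ = _
  refine congrArg _ (congrArg Sum.inr (funext fun v => ?_))
  have h2 : #{u | (l.foldl (fun r e => r ⊔ edgeSetoid e) ⊥) v u} = #{u | G.Reachable v u} := by
    congr 1
    ext u
    simp only [Finset.mem_filter, Finset.mem_univ, true_and, foldl_edgeSetoid_iff h]
  by_cases ha : Alive G k v
  · rw [profile, if_pos ha, if_pos (h2 ▸ ha), h1]
  · rw [profile, if_neg ha, if_neg (h2 ▸ ha)]

/-- The phase is deterministic and the memory it leaves is a function of the graph alone. The
sampling phase may therefore be analysed from the fixed memory `write (profile G k)`. -/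
theorem exists_preprocessing (n k : ℕ) :
    ∃ (A : Phase n) (write : (Fin n → ℕ) → Memory) (read : Memory → Fin n → ℕ),
      (∀ d, (∀ v, d v ≤ n) → read (write d) = d) ∧
      (∀ d, (write d).length = 3 * (n * wordSize n) + 1) ∧
      ∀ (G : SimpleGraph (Fin n)) (order : Config → List (Sym2 (Fin n))),
        (∀ s, IsEdgeStream G (order s)) → ∀ N, 1 ≤ N → ∀ t ∈ (A.run order N []).support,
          A.halt t.mem = true ∧ t.mem = write (profile G k) ∧ t.passes = 1 ∧
            t.peak ≤ 3 * (n * wordSize n) + 1 := by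
  obtain ⟨enc, dec, hdec, hlen⟩ := (preStates_fits n).exists_coding
  refine ⟨(preMachine n k).toPhase enc dec fun _ => PMF.pure (.inl (0, ⊥)), fun d => enc (.inr d),
    fun m => Sum.elim (fun _ => 0) id (dec m), fun d hd => ?_, fun d => hlen _, ?_⟩
  · have h : (.inr d : PreState n) ∈ preStates n := hd
    change Sum.elim (fun _ => 0) id (dec (enc (.inr d))) = d
    rw [hdec _ h]; rfl
  intro G order horder N hN t ht
  simp only [Phase.run, PMF.mem_support_bind_iff] at ht
  obtain ⟨m, hm, ht⟩ := ht
  have hm' : m = enc (.inl (0, ⊥)) := by simpa [Machine.toPhase, PMF.pure_map] using hm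
  subst hm'
  have hok : (.inl (0, ⊥) : PreState n) ∈ preStates n := ⟨fun v => Nat.zero_le _, Set.mem_univ _⟩
  obtain ⟨y, hy, hPy, hly, h1, h2, h3⟩ := Machine.runFrom_support (G := G)
    (P := fun x => x = .inl (0, ⊥) ∨ x = .inr (profile G k)) hdec hlen (preMachine_closed n k)
    horder (by
      rintro x - (rfl | rfl) hl l hls y hy
      · rw [preMachine_pass hls] at hy
        simp only [PMF.support_pure, Set.mem_singleton_iff] at hy
        subst hy
        exact ⟨Or.inr rfl, rfl⟩
      · exact absurd rfl hl) N ⟨enc (.inl (0, ⊥)), 0, _⟩ (.inl (0, ⊥)) hok (Or.inl rfl) rfl hN t ht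
  have hy' : y = .inr (profile G k) := by
    rcases hPy with rfl | rfl
    · exact absurd hly one_ne_zero
    · rfl
  subst hy'
  refine ⟨?_, h1, h2, h3.trans ?_⟩
  · simp [Machine.toPhase, h1, hdec _ hy, hly]
  · simp [hlen]

end preprocessing

section exactCounting

variable {n k : ℕ}

/-! ### The output -/

/-- The empirical distribution of a vector of counters. -/
def estimate [Nonempty (GraphletClass k)] (c : GraphletClass k → ℕ) (i : GraphletClass k) : ℝ :=
  -- Without a single accepted sample any distribution will do; a point mass keeps the output in the
  -- simplex.
  if ∑ j, c j = 0 then (Pi.single (Classical.arbitrary _) 1 : GraphletClass k → ℝ) i else c i / (∑ j, c j : ℕ)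

theorem estimate_mem_stdSimplex [Nonempty (GraphletClass k)] (c : GraphletClass k → ℕ) :
    estimate c ∈ stdSimplex ℝ (GraphletClass k) := by
  by_cases h : ∑ j, c j = 0
  · have : estimate c = Pi.single (Classical.arbitrary _) 1 := by funext i; simp [estimate, h]
    rw [this]
    exact single_mem_stdSimplex ℝ _
  · have : estimate c = fun i => (c i : ℝ) / (∑ j, c j : ℕ) := by funext i; simp [estimate, h]
    rw [this]
    refine ⟨fun i => by positivity, ?_⟩
    rw [← Finset.sum_div, Nat.cast_sum, div_self]
    exact_mod_cast h

theorem estimate_graphletCount [Nonempty (GraphletClass k)] {G : SimpleGraph (Fin n)}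
    (h : 0 < numGraphlets k G) : estimate (graphletCount G) = graphletDist (k := k) G := by
  funext i
  have h' : ∑ j : GraphletClass k, graphletCount G j ≠ 0 := h.ne'
  simp only [estimate, if_neg h', graphletDist, numGraphlets]

theorem nonempty_graphletClass (hk : 0 < k) : Nonempty (GraphletClass k) :=
  ⟨Quotient.mk (graphletSetoid k) ⟨splitGraph k 0, splitGraph_connected hk 0⟩⟩

/-- There is a sampling phase that, started with the degree profile in memory, makes at most `B`
passes, uses at most `M` words and returns an `α`-approximation of the graphlet distribution with
probability at least `1 - δ`. -/
def HasSampler (n k M : ℕ) (α δ B : ℝ) (write : (Fin n → ℕ) → Memory) : Prop :=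
  ∃ (A : Phase n) (out : Memory → GraphletClass k → ℝ) (N₀ : ℕ), ∀ N, N₀ ≤ N →
    ∀ (G : SimpleGraph (Fin n)) (order : Config → List (Sym2 (Fin n))),
      (∀ s, IsEdgeStream G (order s)) →
      (∀ t ∈ (A.run order N (write (profile G k))).support,
        A.halt t.mem = true ∧ out t.mem ∈ stdSimplex ℝ (GraphletClass k) ∧ (t.passes : ℝ) ≤ B ∧
          t.peak ≤ M * wordSize n) ∧
      (0 < numGraphlets k G →
        ENNReal.ofReal (1 - δ) ≤ (A.run order N (write (profile G k))).toOuterMeasure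
          {t | ∀ i : GraphletClass k, |out t.mem i - graphletDist G i| ≤ α})

/-! ### Recording induced subgraphs -/

/-- List the vertices in increasing order, one word per slot, and store the edges as a κ×κ bit
matrix indexed by positions in this list. The edges thus cost κ² bits instead of κ² words. -/
theorem Fits.inducedEdges (n κ : ℕ) :
    Fits {p : Finset (Fin n) × Finset (Sym2 (Fin n)) | p.1.card ≤ κ ∧ p.2 ⊆ p.1.sym2}
      (κ * wordSize n + κ * κ) := by
  let x : Finset (Fin n) → ℕ → Option (Fin n) := fun S j => S.sort[j]?
  have h1 : Fits {f : Fin κ → ℕ | ∀ j, f j ≤ n} (κ * wordSize n) := by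
    simpa using (Fits.le n).pi (ι := Fin κ)
  have h2 : Fits (Set.univ : Set (Fin κ × Fin κ → Bool)) (κ * κ) :=
    Fits.of_index (β := Fin κ × Fin κ) (by simp) id (fun _ _ _ _ h => h)
  refine (h1.prod h2).comap (fun p => (fun j => (x p.1 j).elim n Fin.val,
    fun q => decide (∃ a b, x p.1 q.1 = some a ∧ x p.1 q.2 = some b ∧ s(a, b) ∈ p.2))) ?_ ?_
  · rintro ⟨S, E⟩ -
    refine ⟨fun j => ?_, Set.mem_univ _⟩
    simp only
    cases x S j with
    | none => exact le_rfl
    | some a => exact a.2.le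
  · rintro ⟨S, E⟩ ⟨hS, hE⟩ ⟨S', E'⟩ ⟨hS', hE'⟩ h
    simp only at hS hE hS' hE'
    have helim : Function.Injective fun o : Option (Fin n) => o.elim n Fin.val := by
      rintro (_ | a) (_ | b) hab
      · rfl
      · exact absurd hab.symm b.2.ne
      · exact absurd hab a.2.ne
      · exact congrArg some (Fin.ext hab)
    have hSS : S = S' := by
      have : S.sort = S'.sort := by
        refine List.ext_getElem? fun j => ?_
        by_cases hj : j < κ
        · exact helim (congrFun (congrArg Prod.fst h) ⟨j, hj⟩)
        · rw [List.getElem?_eq_none (by rw [Finset.length_sort]; omega),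
            List.getElem?_eq_none (by rw [Finset.length_sort]; omega)]
      rw [← S.sort_toFinset (· ≤ ·), ← S'.sort_toFinset (· ≤ ·), this]
    subst hSS
    have key : ∀ F F' : Finset (Sym2 (Fin n)), F ⊆ S.sym2 →
        (∀ i j : Fin κ, (∃ a b, x S i = some a ∧ x S j = some b ∧ s(a, b) ∈ F) →
          ∃ a b, x S i = some a ∧ x S j = some b ∧ s(a, b) ∈ F') → F ⊆ F' := by
      intro F F' hF hFF e he
      induction e with | _ a b => ?_
      have hab := Finset.mk_mem_sym2_iff.1 (hF he)
      have hidx : ∀ c ∈ S, ∃ i : Fin κ, x S i = some c := by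
        intro c hc
        obtain ⟨i, hi, hic⟩ := List.getElem_of_mem ((Finset.mem_sort (· ≤ ·)).2 hc)
        rw [Finset.length_sort] at hi
        exact ⟨⟨i, by omega⟩, by simp [x, hic, hi]⟩
      obtain ⟨i, hi⟩ := hidx a hab.1
      obtain ⟨j, hj⟩ := hidx b hab.2
      obtain ⟨a', b', h1, h2, h3⟩ := hFF i j ⟨a, b, hi, hj, he⟩
      rw [hi] at h1
      rw [hj] at h2
      cases h1
      cases h2
      exact h3
    have hiff : ∀ i j : Fin κ, (∃ a b, x S i = some a ∧ x S j = some b ∧ s(a, b) ∈ E) ↔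
        ∃ a b, x S i = some a ∧ x S j = some b ∧ s(a, b) ∈ E' := by
      intro i j
      have := congrFun (congrArg Prod.snd h) (i, j)
      simpa only [decide_eq_decide] using this
    exact Prod.ext rfl (Finset.Subset.antisymm (key E E' hE fun i j => (hiff i j).1)
      (key E' E hE' fun i j => (hiff i j).2))

/-- Record an edge if its ends belong to the watched set. -/
def recordEdge (W : Finset (Fin n)) (E : Finset (Sym2 (Fin n))) (e : Sym2 (Fin n)) :
    Finset (Sym2 (Fin n)) := if e ∈ W.sym2 then insert e E else E

theorem recordEdge_subset {W : Finset (Fin n)} {E : Finset (Sym2 (Fin n))} (h : E ⊆ W.sym2)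
    (e : Sym2 (Fin n)) : recordEdge W E e ⊆ W.sym2 := by
  unfold recordEdge
  split_ifs with he
  · exact Finset.insert_subset he h
  · exact h

theorem mem_foldl_recordEdge (W : Finset (Fin n)) (l : List (Sym2 (Fin n)))
    (E : Finset (Sym2 (Fin n))) (e : Sym2 (Fin n)) :
    e ∈ l.foldl (recordEdge W) E ↔ e ∈ E ∨ e ∈ l ∧ e ∈ W.sym2 := by
  induction l generalizing E with
  | nil => simp
  | cons f l ih =>
    rw [List.foldl_cons, ih, recordEdge]
    split_ifs with hf
    · simp only [Finset.mem_insert, List.mem_cons]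
      constructor
      · rintro ((rfl | h) | h) <;> tauto
      · rintro (h | ⟨rfl | h, h'⟩) <;> tauto
    · simp only [List.mem_cons]
      constructor
      · rintro (h | h) <;> tauto
      · rintro (h | ⟨rfl | h, h'⟩) <;> tauto

theorem adj_recorded_iff {G : SimpleGraph (Fin n)} {l : List (Sym2 (Fin n))}
    (hl : IsEdgeStream G l) {W : Finset (Fin n)} {a b : Fin n} (ha : a ∈ W) (hb : b ∈ W) :
    (SimpleGraph.fromEdgeSet ((l.foldl (recordEdge W) ∅ : Finset _) : Set (Sym2 (Fin n)))).Adj a b ↔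
      G.Adj a b := by
  rw [SimpleGraph.fromEdgeSet_adj, Finset.mem_coe, mem_foldl_recordEdge, hl.2,
    Finset.mk_mem_sym2_iff, SimpleGraph.mem_edgeSet]
  simp only [Finset.notMem_empty, false_or, ha, hb, and_true]
  exact ⟨fun h => h.1, fun h => ⟨h, h.ne⟩⟩

/-! ### Exact counting with few watched sets -/

/-- Passes left, counters of the classes, and the watched set with its edges read so far. -/
abbrev ExactState (n k : ℕ) : Type :=
  ℕ × (GraphletClass k → ℕ) × (Finset (Fin n) × Finset (Sym2 (Fin n)))

variable (k) in
/-- The `k`-sets contained in one of the first `j` watched sets. -/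
def covered (ws : ℕ → Finset (Fin n)) (j : ℕ) : Finset (Finset (Fin n)) :=
  {S | S.card = k ∧ ∃ i < j, S ⊆ ws i}

theorem covered_mono (ws : ℕ → Finset (Fin n)) (j : ℕ) : covered k ws j ⊆ covered k ws (j + 1) := by
  intro S hS
  simp only [covered, Finset.mem_filter, Finset.mem_univ, true_and] at hS ⊢
  obtain ⟨h, i, hi, h'⟩ := hS
  exact ⟨h, i, by omega, h'⟩

/-- The state before the pass with `r` passes left, without recorded edges. -/
def exactState (ws : ℕ → Finset (Fin n)) (Q : ℕ) (r : ℕ) (c : GraphletClass k → ℕ) :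
    ExactState n k := (r, c, (ws (Q - r), ∅))

/-- The machine that counts the graphlets in the watched sets `ws 0, …, ws (Q - 1)`, one set in each
pass. -/
def exactMachine (k : ℕ) (ws : ℕ → Finset (Fin n)) (Q : ℕ) : Machine n (ExactState n k) where
  step x e := PMF.pure (x.1, x.2.1, (x.2.2.1, recordEdge x.2.2.1 x.2.2.2 e))
  -- Only the k-sets first covered by the present watched set are counted, so overlaps between
  -- watched sets do no harm. Which sets were covered before is known from the pass number and needs
  -- no memory.
  endPass x := PMF.pure (if x.1 = 0 then x else exactState ws Q (x.1 - 1) fun i =>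
    x.2.1 i + #{S ∈ covered k ws (Q - x.1 + 1) \ covered k ws (Q - x.1) |
      classOf k (SimpleGraph.fromEdgeSet (x.2.2.2 : Set (Sym2 (Fin n)))) S = some i})
  left x := x.1

/-- The states of bounded size. -/
def exactStates (k κ : ℕ) (ws : ℕ → Finset (Fin n)) (Q : ℕ) : Set (ExactState n k) :=
  {x | x.1 ≤ Q ∧ (∀ i, x.2.1 i ≤ #(covered k ws (Q - x.1))) ∧
    x.2.2 ∈ {p : Finset (Fin n) × Finset (Sym2 (Fin n)) | p.1.card ≤ κ ∧ p.2 ⊆ p.1.sym2}}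

theorem pow_lt_two_pow (n : ℕ) (hk : 0 < k) : n ^ k < 2 ^ (k * wordSize n) := by
  rw [mul_comm, pow_mul]
  exact Nat.pow_lt_pow_left (lt_two_pow_wordSize le_rfl) hk.ne'

theorem card_covered_le (ws : ℕ → Finset (Fin n)) (j : ℕ) : #(covered k ws j) ≤ n ^ k := by
  calc #(covered k ws j) ≤ #(Finset.powersetCard k (Finset.univ : Finset (Fin n))) := by
        refine Finset.card_le_card fun S hS => ?_
        simp only [covered, Finset.mem_filter, Finset.mem_univ, true_and] at hS
        simp [hS.1]
    _ ≤ n ^ k := by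
        rw [Finset.card_powersetCard, Finset.card_univ, Fintype.card_fin]
        exact Nat.choose_le_pow _ _

theorem exactStates_fits (hk : 0 < k) (κ : ℕ) (ws : ℕ → Finset (Fin n)) {Q : ℕ}
    (hQ : Q ≤ n ^ k) : Fits (exactStates k κ ws Q) (k * wordSize n +
      (Fintype.card (GraphletClass k) * (k * wordSize n) + (κ * wordSize n + κ * κ))) := by
  refine ((Fits.nat (k * wordSize n)).prod ((Fits.pi (ι := GraphletClass k)
    (Fits.nat (k * wordSize n))).prod (Fits.inducedEdges n κ))).mono ?_ le_rfl
  rintro ⟨r, c, p⟩ ⟨h1, h2, h3⟩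
  exact ⟨(h1.trans hQ).trans_lt (pow_lt_two_pow n hk),
    fun i => ((h2 i).trans (card_covered_le ws _)).trans_lt (pow_lt_two_pow n hk), h3⟩

theorem exactMachine_closed {κ : ℕ} {ws : ℕ → Finset (Fin n)} (hκ : ∀ j, (ws j).card ≤ κ) (Q : ℕ) :
    (exactMachine k ws Q).Closed (exactStates k κ ws Q) := by
  refine ⟨?_, ?_⟩
  · rintro ⟨r, c, W, E⟩ ⟨h1, h2, h3, h4⟩ e y hy
    simp only [exactMachine, PMF.support_pure, Set.mem_singleton_iff] at hy
    subst hy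
    exact ⟨h1, h2, h3, recordEdge_subset h4 e⟩
  · rintro ⟨r, c, W, E⟩ ⟨h1, h2, h3, h4⟩ y hy
    simp only [exactMachine, PMF.support_pure, Set.mem_singleton_iff] at hy
    subst hy
    split_ifs with h0
    · exact ⟨h1, h2, h3, h4⟩
    · simp only at h1 h2
      refine ⟨by simp only [exactState]; omega, fun i => ?_, hκ _, by simp [exactState]⟩
      simp only [exactState]
      rw [show Q - (r - 1) = Q - r + 1 by omega]
      calc _ ≤ #(covered k ws (Q - r)) + #(covered k ws (Q - r + 1) \ covered k ws (Q - r)) :=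
            add_le_add (h2 i) (Finset.card_filter_le _ _)
        _ = _ := by rw [add_comm, Finset.card_sdiff_add_card_eq_card (covered_mono ws _)]

/-- The counters after the first `j` watched sets. -/
def partialCount (G : SimpleGraph (Fin n)) (ws : ℕ → Finset (Fin n)) (j : ℕ)
    (i : GraphletClass k) : ℕ := #{S ∈ covered k ws j | classOf k G S = some i}

theorem exactMachine_pass {G : SimpleGraph (Fin n)} {l : List (Sym2 (Fin n))}
    (hl : IsEdgeStream G l) {ws : ℕ → Finset (Fin n)} {Q r : ℕ} (hr : r < Q) :
    (exactMachine k ws Q).pass l (exactState ws Q (r + 1) (partialCount G ws (Q - (r + 1)))) =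
      PMF.pure (exactState ws Q r (partialCount G ws (Q - r))) := by
  have hfold : ∀ (l : List (Sym2 (Fin n))) (x : ExactState n k),
      l.foldl (fun x e => (x.1, x.2.1, (x.2.2.1, recordEdge x.2.2.1 x.2.2.2 e))) x =
        (x.1, x.2.1, (x.2.2.1, l.foldl (recordEdge x.2.2.1) x.2.2.2)) := by
    intro l
    induction l with
    | nil => intro x; rfl
    | cons e es ih => intro x; rw [List.foldl_cons, ih]; rfl
  rw [Machine.pass, Machine.scan_of_deterministic _
    (upd := fun x e => (x.1, x.2.1, (x.2.2.1, recordEdge x.2.2.1 x.2.2.2 e))) (fun _ _ => rfl),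
    PMF.pure_bind, hfold]
  obtain ⟨j, rfl⟩ : ∃ j, Q = j + (r + 1) := ⟨Q - (r + 1), by omega⟩
  simp only [exactMachine, exactState, Nat.add_sub_cancel, Nat.succ_ne_zero, if_false]
  rw [show j + (r + 1) - r = j + 1 by omega]
  refine congrArg _ (Prod.ext rfl (Prod.ext (funext fun i => ?_) rfl))
  simp only [partialCount]
  have hcongr : ∀ S ∈ covered k ws (j + 1) \ covered k ws j,
      classOf k (SimpleGraph.fromEdgeSet
        ((l.foldl (recordEdge (ws j)) ∅ : Finset _) : Set (Sym2 (Fin n)))) S = some i ↔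
      classOf k G S = some i := by
    intro S hS
    have hSW : S ⊆ ws j := by
      simp only [covered, Finset.mem_sdiff, Finset.mem_filter, Finset.mem_univ, true_and, not_and,
        not_exists] at hS
      obtain ⟨⟨h1, i, hi, h2⟩, h3⟩ := hS
      rcases Nat.lt_succ_iff_lt_or_eq.1 hi with h4 | rfl
      · exact absurd h2 (h3 h1 i h4)
      · exact h2
    rw [classOf_congr fun a ha b hb => adj_recorded_iff hl (hSW ha) (hSW hb)]
  rw [Finset.filter_congr hcongr, ← Finset.card_union_of_disjoint, ← Finset.filter_union,
    Finset.union_sdiff_of_subset (covered_mono ws j)]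
  exact Finset.disjoint_filter_filter Finset.disjoint_sdiff

theorem partialCount_eq (G : SimpleGraph (Fin n)) {ws : ℕ → Finset (Fin n)} {Q : ℕ}
    (hcov : ∀ S : Finset (Fin n), S.card = k → ∃ j < Q, S ⊆ ws j) :
    partialCount G ws Q = graphletCount (k := k) G := by
  funext i
  rw [graphletCount_eq, partialCount]
  congr 1
  ext S
  simp only [Finset.mem_filter, covered, Finset.mem_univ, true_and, and_congr_left_iff]
  intro h
  have hS := (mem_graphlets.1 (exists_classOf_iff.1 ⟨i, h⟩)).1
  exact ⟨fun _ => exists_classOf_iff.1 ⟨i, h⟩, fun _ => ⟨hS, hcov S hS⟩⟩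

/-- Deterministic and exact: if every k-set lies in some watched set, the final counters are the
graphlet counts. It is applied with the whole vertex set as the single watched set, and with all
k-sets. -/
theorem hasSampler_of_cover {M κ Q : ℕ} {α δ B : ℝ} (hk : 0 < k) (hα : 0 ≤ α) (hδ : 0 ≤ δ)
    (ws : ℕ → Finset (Fin n)) (hκ : ∀ j, (ws j).card ≤ κ) (hQ : Q ≤ n ^ k)
    (hcov : ∀ S : Finset (Fin n), S.card = k → ∃ j < Q, S ⊆ ws j) (hB : (Q : ℝ) ≤ B)
    (hM : k * wordSize n + (Fintype.card (GraphletClass k) * (k * wordSize n) +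
      (κ * wordSize n + κ * κ)) ≤ M * wordSize n)
    (write : (Fin n → ℕ) → Memory) (hwrite : ∀ d, (write d).length ≤ M * wordSize n) :
    HasSampler n k M α δ B write := by
  have := nonempty_graphletClass hk
  obtain ⟨enc, dec, hdec, hlen⟩ := (exactStates_fits hk κ ws hQ).exists_coding
  refine ⟨(exactMachine k ws Q).toPhase enc dec fun _ => PMF.pure (exactState ws Q Q 0),
    fun m => estimate (dec m).2.1, Q, fun N hN G order horder => ?_⟩
  have key : ∀ t ∈ (((exactMachine k ws Q).toPhase enc dec fun _ =>
      PMF.pure (exactState ws Q Q 0)).run order N (write (profile G k))).support,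
      ∃ y ∈ exactStates k κ ws Q, y = exactState ws Q 0 (graphletCount G) ∧ t.mem = enc y ∧
        t.passes = Q ∧ t.peak ≤ M * wordSize n := by
    intro t ht
    simp only [Phase.run, PMF.mem_support_bind_iff] at ht
    obtain ⟨m, hm, ht⟩ := ht
    have hm' : m = enc (exactState ws Q Q 0) := by simpa [Machine.toPhase, PMF.pure_map] using hm
    subst hm'
    have h0 : (exactState ws Q Q 0 : ExactState n k) ∈ exactStates k κ ws Q :=
      ⟨le_rfl, fun i => Nat.zero_le _, hκ _, by simp [exactState]⟩
    obtain ⟨y, hy, hPy, hly, h1, h2, h3⟩ := Machine.runFrom_support (G := G)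
      (P := fun x => ∃ r ≤ Q, x = exactState ws Q r (partialCount G ws (Q - r))) hdec hlen
      (exactMachine_closed hκ Q) horder (by
        rintro x - ⟨r, hr, rfl⟩ hl l hls y hy
        obtain ⟨r, rfl⟩ := Nat.exists_eq_succ_of_ne_zero hl
        rw [Nat.succ_eq_add_one, exactMachine_pass hls hr] at hy
        simp only [PMF.support_pure, Set.mem_singleton_iff] at hy
        subst hy
        exact ⟨⟨r, by omega, rfl⟩, rfl⟩)
      N ⟨enc (exactState ws Q Q 0), 0, _⟩ _ h0
      ⟨Q, le_rfl, by rw [Nat.sub_self]; congr 1; funext i; simp [partialCount, covered]⟩ rfl hN t ht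
    obtain ⟨r, hr, rfl⟩ := hPy
    have hr0 : r = 0 := hly
    subst hr0
    refine ⟨_, hy, by rw [Nat.sub_zero, partialCount_eq G hcov], h1,
      by simpa [exactMachine, exactState] using h2, h3.trans ?_⟩
    simp only [hlen]
    exact max_le (max_le (hwrite _) hM) hM
  refine ⟨fun t ht => ?_, fun hG => ?_⟩
  · obtain ⟨y, hy, rfl, h1, h2, h3⟩ := key t ht
    refine ⟨?_, estimate_mem_stdSimplex _, by rw [h2]; exact hB, h3⟩
    simp only [Machine.toPhase, h1, hdec _ hy]
    rfl
  · rw [toOuterMeasure_eq_one]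
    · exact ENNReal.ofReal_le_one.2 (by linarith)
    · intro t ht i
      obtain ⟨y, hy, rfl, h1, -, -⟩ := key t ht
      simp only [h1, hdec _ hy]
      simp only [exactState]
      rw [estimate_graphletCount hG, sub_self, abs_zero]
      exact hα

end exactCounting

/-! ### The random choices of the sampling phase -/

section choices

/-- A uniformly random natural number below `r` (zero if `r = 0`). -/
def uniformBelow (r : ℕ) : PMF ℕ :=
  if h : r = 0 then PMF.pure 0 else PMF.uniformOfFinset (Finset.range r) (by simpa using h)

theorem lt_of_mem_support_uniformBelow {r t : ℕ} (hr : 0 < r)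
    (ht : t ∈ (uniformBelow r).support) : t < r := by
  simpa [uniformBelow, hr.ne'] using ht

theorem expect_uniformBelow {r : ℕ} (hr : 0 < r) {φ : ℕ → ℝ} (hφ : ∀ t < r, 0 ≤ φ t) :
    expect (uniformBelow r) (fun t => ENNReal.ofReal (φ t)) =
      ENNReal.ofReal ((∑ t ∈ Finset.range r, φ t) / r) := by
  rw [expect, tsum_eq_sum (s := Finset.range r)]
  · rw [ENNReal.ofReal_div_of_pos (by exact_mod_cast hr),
      ENNReal.ofReal_sum_of_nonneg fun t ht => hφ t (Finset.mem_range.1 ht), ENNReal.ofReal_natCast,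
      ENNReal.div_eq_inv_mul, Finset.mul_sum]
    refine Finset.sum_congr rfl fun t ht => ?_
    simp only [uniformBelow, hr.ne', dite_false]
    rw [PMF.uniformOfFinset_apply_of_mem _ ht, Finset.card_range]
  · intro t ht
    simp only [uniformBelow, hr.ne', dite_false]
    rw [PMF.uniformOfFinset_apply_of_notMem _ ht, zero_mul]

variable {n k : ℕ}

/-- A random root, chosen with probability proportional to `d v ^ (k - 1)`. -/
def rootLaw (d : Fin n → ℕ) (k : ℕ) : PMF (Finset (Fin n)) :=
  -- For the degree profile, weight zero means that there are no k-graphlets; the empty set stands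
  -- for a failed trial.
  if h : rootWeight d k = 0 then PMF.pure ∅
  else (PMF.normalize (fun v => ((d v ^ (k - 1) : ℕ) : ℝ≥0∞))
    (by rw [tsum_fintype, ← Nat.cast_sum]; exact_mod_cast h)
    (by rw [tsum_fintype, ← Nat.cast_sum]; exact ENNReal.natCast_ne_top _)).map fun v => {v}

theorem mem_support_rootLaw {d : Fin n → ℕ} (hk : 2 ≤ k) {S : Finset (Fin n)}
    (hS : S ∈ (rootLaw d k).support) : S = ∅ ∨ ∃ v, S = {v} ∧ 0 < d v := by
  unfold rootLaw at hS
  split_ifs at hS with h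
  · left; simpa using hS
  · right
    rw [PMF.mem_support_map_iff] at hS
    obtain ⟨v, hv, rfl⟩ := hS
    rw [PMF.mem_support_normalize_iff] at hv
    refine ⟨v, rfl, Nat.pos_of_ne_zero fun h0 => hv ?_⟩
    simp [h0, show k - 1 ≠ 0 by omega]

theorem expect_rootLaw {d : Fin n → ℕ} (h : 0 < rootWeight d k) {φ : Finset (Fin n) → ℝ}
    (hφ : ∀ v, 0 < d v ^ (k - 1) → 0 ≤ φ {v}) :
    expect (rootLaw d k) (fun S => ENNReal.ofReal (φ S)) =
      ENNReal.ofReal ((∑ v, (d v : ℝ) ^ (k - 1) * φ {v}) / rootWeight d k) := by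
  simp only [rootLaw, h.ne', dite_false]
  rw [expect_map, expect_fintype]
  simp only [PMF.normalize_apply]
  have hterm : ∀ v, 0 ≤ (d v : ℝ) ^ (k - 1) * φ {v} := by
    intro v
    rcases Nat.eq_zero_or_pos (d v ^ (k - 1)) with h0 | h0
    · have : (d v : ℝ) ^ (k - 1) = 0 := by exact_mod_cast h0
      rw [this, zero_mul]
    · exact mul_nonneg (by positivity) (hφ v h0)
  rw [ENNReal.ofReal_div_of_pos (by exact_mod_cast h), ENNReal.ofReal_sum_of_nonneg fun v _ => hterm v,
    ENNReal.ofReal_natCast, ENNReal.div_eq_inv_mul, Finset.mul_sum]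
  refine Finset.sum_congr rfl fun v _ => ?_
  rw [ENNReal.ofReal_mul (by positivity), ← Nat.cast_pow, ENNReal.ofReal_natCast, tsum_fintype,
    ← Nat.cast_sum, rootWeight]
  ring

end choices

/-! ### A single trial -/

section trial

variable {n k : ℕ}

/-- The state of a trial: the present set of vertices, the recorded edges, the number of outgoing
edges still to be skipped (if it has been drawn), and the vertex to be added (if it is known). -/
abbrev Trial (n : ℕ) : Type :=
  (Finset (Fin n) × Finset (Sym2 (Fin n))) × (Option ℕ × Option (Fin n))

/-- A trial between two passes. -/
def freshTrial (S : Finset (Fin n)) : Trial n := ((S, ∅), (none, none))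

/-- The outer end of an edge that leaves `S` for a vertex of admissible degree. -/
def outerEnd (d : Fin n → ℕ) (S : Finset (Fin n)) (e : Sym2 (Fin n)) : Option (Fin n) :=
  if h : ∃ v, (∃ a ∈ S, e = s(a, v)) ∧ v ∉ S ∧ d v ≤ S.sup d then some h.choose else none

theorem outerEnd_eq_some_iff {d : Fin n → ℕ} {S : Finset (Fin n)} {e : Sym2 (Fin n)} {v : Fin n} :
    outerEnd d S e = some v ↔ (∃ a ∈ S, e = s(a, v)) ∧ v ∉ S ∧ d v ≤ S.sup d := by
  unfold outerEnd
  split_ifs with h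
  · rw [Option.some_inj]
    constructor
    · rintro rfl; exact h.choose_spec
    · rintro ⟨⟨a, ha, rfl⟩, hv, -⟩
      obtain ⟨⟨b, hb, hab⟩, hw, -⟩ := h.choose_spec
      rcases Sym2.eq_iff.1 hab with ⟨-, h2⟩ | ⟨h1, -⟩
      · exact h2.symm
      · exact absurd (h1 ▸ ha) hw
  · simp only [false_iff]
    exact fun h' => h ⟨v, h'⟩

/-- Skip edges until the one drawn is found. -/
def advance (d : Fin n → ℕ) (S : Finset (Fin n)) :
    Option ℕ × Option (Fin n) → Sym2 (Fin n) → Option ℕ × Option (Fin n)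
  | (none, u), _ => (none, u)
  | (some 0, u), e => (outerEnd d S e).elim (some 0, u) fun v => (none, some v)
  | (some (t + 1), u), e => (outerEnd d S e).elim (some (t + 1), u) fun _ => (some t, u)

/-- A trial reads an edge: a complete set records its edges, a smaller one looks for the edge
to grow along, whose number is drawn when the first edge of the pass is read. -/
def trialStep (d : Fin n → ℕ) (k : ℕ) (x : Trial n) (e : Sym2 (Fin n)) : PMF (Trial n) :=
  if x.1.1.card = k then PMF.pure ((x.1.1, recordEdge x.1.1 x.1.2 e), x.2)
  -- The pair `(none, none)` means that nothing has been drawn in this pass. It cannot recur after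
  -- the draw, since `(none, some v)` records success.
  else if x.2 = (none, none) ∧ 0 < x.1.1.card * x.1.1.sup d then
    (uniformBelow (x.1.1.card * x.1.1.sup d)).map fun t =>
      (x.1, advance d x.1.1 (some t, none) e)
  else PMF.pure (x.1, advance d x.1.1 x.2 e)

/-- A trial reads a list of edges. -/
def trialScan (d : Fin n → ℕ) (k : ℕ) : List (Sym2 (Fin n)) → Trial n → PMF (Trial n)
  | [], x => PMF.pure x
  | e :: es, x => (trialStep d k x e).bind (trialScan d k es)

/-- The set of a trial at the end of a growth pass; it is empty if the trial has failed. -/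
def grown (k : ℕ) (x : Trial n) : Finset (Fin n) :=
  if x.1.1.card < k then x.2.2.elim ∅ fun v => insert v x.1.1 else ∅

/-- The result of a trial at the end of the recording pass: the class of a graphlet is accepted with
a probability inverse to the number of ways in which it can grow. -/
def trialOutcome (d : Fin n → ℕ) (k : ℕ) (x : Trial n) : PMF (Option (GraphletClass k)) :=
  (uniformBelow (growthCount (SimpleGraph.fromEdgeSet (x.1.2 : Set (Sym2 (Fin n)))) d (k - 1)
    x.1.1)).map fun t =>
      if t = 0 then classOf k (SimpleGraph.fromEdgeSet (x.1.2 : Set (Sym2 (Fin n)))) x.1.1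
      else none

theorem foldl_advance_none (d : Fin n → ℕ) (S : Finset (Fin n)) (l : List (Sym2 (Fin n)))
    (u : Option (Fin n)) : l.foldl (advance d S) (none, u) = (none, u) := by
  induction l with
  | nil => rfl
  | cons e es ih => exact ih

theorem foldl_advance_snd (d : Fin n → ℕ) (S : Finset (Fin n)) (l : List (Sym2 (Fin n))) :
    ∀ t, (l.foldl (advance d S) (some t, none)).2 = (l.filterMap (outerEnd d S))[t]? := by
  induction l with
  | nil => intro t; simp
  | cons e es ih =>
    intro t
    rw [List.foldl_cons, List.filterMap_cons]
    cases h : outerEnd d S e with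
    | none =>
      have : advance d S (some t, none) e = (some t, none) := by cases t <;> simp [advance, h]
      rw [this, ih]
    | some v =>
      cases t with
      | zero => simp [advance, h, foldl_advance_none]
      | succ t => simp [advance, h, ih]

theorem advance_isSome {d : Fin n → ℕ} {S : Finset (Fin n)} {t : ℕ} {u : Option (Fin n)}
    (e : Sym2 (Fin n)) : advance d S (some t, u) e ≠ (none, none) := by
  cases t <;> cases h : outerEnd d S e <;> simp [advance, h]

theorem trialScan_of_drawn {d : Fin n → ℕ} {S : Finset (Fin n)} (hS : S.card ≠ k)
    (E : Finset (Sym2 (Fin n))) (l : List (Sym2 (Fin n))) :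
    ∀ w : Option ℕ × Option (Fin n), w ≠ (none, none) →
      trialScan d k l ((S, E), w) = PMF.pure ((S, E), l.foldl (advance d S) w) := by
  induction l with
  | nil => intro w _; rfl
  | cons e es ih =>
    intro w hw
    simp only [trialScan, trialStep, if_neg hS, hw, false_and, if_false, PMF.pure_bind]
    refine ih _ ?_
    obtain ⟨_ | t, u⟩ := w
    · exact hw
    · exact advance_isSome e

/-- The law of the set of a trial after a growth pass. -/
def growLaw (d : Fin n → ℕ) (l : List (Sym2 (Fin n))) (S : Finset (Fin n)) :
    PMF (Finset (Fin n)) :=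
  if 0 < S.card * S.sup d then (uniformBelow (S.card * S.sup d)).map fun t =>
    ((l.filterMap (outerEnd d S))[t]?).elim ∅ fun v => insert v S
  else PMF.pure ∅

/-- Drawing `t` at the first edge is the same as drawing it before the pass; if the stream is empty,
the trial fails either way. -/
theorem trialScan_map_grown {d : Fin n → ℕ} {S : Finset (Fin n)} (hS : S.card < k)
    (l : List (Sym2 (Fin n))) :
    (trialScan d k l (freshTrial S)).map (grown k) = growLaw d l S := by
  unfold growLaw
  split_ifs with h
  · cases l with
    | nil =>
      simp only [trialScan, PMF.pure_map, freshTrial, grown, hS, if_true, List.filterMap_nil,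
        List.getElem?_nil, Option.elim_none]
      exact (PMF.map_const _ _).symm
    | cons e es =>
      simp only [trialScan, trialStep, freshTrial, if_neg hS.ne, h, and_self, if_true,
        PMF.bind_map]
      have : ((fun t => trialScan d k es ((S, ∅), advance d S (some t, none) e)) : ℕ → PMF (Trial n))
          = fun t => PMF.pure ((S, ∅), (e :: es).foldl (advance d S) (some t, none)) :=
        funext fun t => trialScan_of_drawn hS.ne ∅ es _ (advance_isSome e)
      change PMF.map (grown k) (PMF.bind _ fun t =>
        trialScan d k es ((S, ∅), advance d S (some t, none) e)) = _
      rw [this, PMF.map_bind]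
      simp only [PMF.pure_map]
      rw [PMF.map]
      congr 1
      funext t
      simp only [grown, hS, if_true, Function.comp, foldl_advance_snd]
  · have : trialScan d k l (freshTrial S) = PMF.pure (freshTrial S) := by
      induction l with
      | nil => rfl
      | cons e es ih =>
        simp only [trialScan, trialStep, freshTrial, if_neg hS.ne, h, and_false, if_false, advance,
          PMF.pure_bind]
        exact ih
    rw [this, PMF.pure_map]
    simp [grown, freshTrial, hS]

theorem trialScan_of_complete {d : Fin n → ℕ} {S : Finset (Fin n)} (hS : S.card = k)
    (w : Option ℕ × Option (Fin n)) (l : List (Sym2 (Fin n))) : ∀ E : Finset (Sym2 (Fin n)),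
      trialScan d k l ((S, E), w) = PMF.pure ((S, l.foldl (recordEdge S) E), w) := by
  induction l with
  | nil => intro E; rfl
  | cons e es ih =>
    intro E
    simp only [trialScan, trialStep, if_pos hS, PMF.pure_bind, List.foldl_cons]
    exact ih _

theorem trialScan_empty (d : Fin n → ℕ) (hk : 0 < k) (l : List (Sym2 (Fin n))) :
    trialScan d k l (freshTrial ∅) = PMF.pure (freshTrial ∅) := by
  induction l with
  | nil => rfl
  | cons e es ih =>
    simp only [trialScan, trialStep, freshTrial, Finset.card_empty, hk.ne, if_false, zero_mul,
      lt_irrefl, and_false, advance, PMF.pure_bind]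
    exact ih

variable {G : SimpleGraph (Fin n)} {l : List (Sym2 (Fin n))}

/-- Each edge occurs once in the stream, so `u` occurs once for every admissible edge from `S` to
`u`. Multiplicities do not depend on the order, which is why the adversary has no influence on the
law of a growth step. -/
theorem count_filterMap_outerEnd (hl : IsEdgeStream G l) (d : Fin n → ℕ) (S : Finset (Fin n))
    (u : Fin n) : (l.filterMap (outerEnd d S)).count u =
      if u ∉ S ∧ d u ≤ S.sup d then linkCount G S u else 0 := by
  rw [List.count_filterMap, List.countP_eq_length_filter,
    ← List.toFinset_card_of_nodup (hl.1.filter _)]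
  split_ifs with h
  · rw [linkCount]
    symm
    refine Finset.card_bij (fun a _ => s(a, u)) ?_ ?_ ?_
    · intro a ha
      rw [Finset.mem_filter] at ha
      simp only [List.mem_toFinset, List.mem_filter, beq_iff_eq, hl.2, outerEnd_eq_some_iff]
      exact ⟨ha.2, ⟨a, ha.1, rfl⟩, h⟩
    · intro a ha b hb hab
      rw [Finset.mem_filter] at ha
      rcases Sym2.eq_iff.1 hab with ⟨h1, -⟩ | ⟨h1, -⟩
      · exact h1
      · exact absurd (h1 ▸ ha.1) h.1
    · intro e he
      simp only [List.mem_toFinset, List.mem_filter, beq_iff_eq, hl.2, outerEnd_eq_some_iff] at he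
      obtain ⟨he, ⟨a, ha, rfl⟩, -⟩ := he
      exact ⟨a, Finset.mem_filter.2 ⟨ha, he⟩, rfl⟩
  · rw [Finset.card_eq_zero, Finset.eq_empty_iff_forall_notMem]
    intro e he
    simp only [List.mem_toFinset, List.mem_filter, beq_iff_eq, outerEnd_eq_some_iff] at he
    exact h he.2.2

theorem sum_map_filterMap_outerEnd (hl : IsEdgeStream G l) (d : Fin n → ℕ) (S : Finset (Fin n))
    (φ : Fin n → ℝ) : ((l.filterMap (outerEnd d S)).map φ).sum =
      ∑ u, if u ∉ S ∧ d u ≤ S.sup d then linkCount G S u * φ u else 0 := by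
  rw [Finset.sum_list_map_count]
  rw [Finset.sum_subset (Finset.subset_univ _)]
  · refine Finset.sum_congr rfl fun u _ => ?_
    rw [nsmul_eq_mul]
    have := count_filterMap_outerEnd hl d S u
    rw [show List.count u _ = _ from this]
    split_ifs <;> simp
  · intro u _ hu
    rw [List.mem_toFinset, ← List.count_eq_zero] at hu
    rw [hu, zero_smul]

/-- The edges leaving `S` number at most the sum of the degrees in `S`. Thus the range |S|·sup of
the draw is large enough to give every admissible edge its own number. -/
theorem sum_linkCount_le {d : Fin n → ℕ} {S : Finset (Fin n)}
    (hS : ∀ a ∈ S, G.degree a ≤ S.sup d) :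
    ∑ u, (if u ∉ S ∧ d u ≤ S.sup d then linkCount G S u else 0) ≤ S.card * S.sup d := by
  calc _ ≤ ∑ u, linkCount G S u := Finset.sum_le_sum fun u _ => by split_ifs <;> simp
    _ = ∑ a ∈ S, G.degree a := by
        simp only [linkCount, Finset.card_filter]
        rw [Finset.sum_comm]
        refine Finset.sum_congr rfl fun a _ => ?_
        rw [← Finset.card_filter, ← G.card_neighborFinset_eq_degree]
        congr 1
        ext u
        simp
    _ ≤ _ := by
        rw [← smul_eq_mul]
        exact Finset.sum_le_card_nsmul _ _ _ hS

theorem length_filterMap_outerEnd_le (hl : IsEdgeStream G l) {d : Fin n → ℕ}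
    {S : Finset (Fin n)} (hS : ∀ a ∈ S, G.degree a ≤ S.sup d) :
    (l.filterMap (outerEnd d S)).length ≤ S.card * S.sup d := by
  refine le_trans (le_of_eq ?_) (sum_linkCount_le (d := d) hS)
  have := sum_map_filterMap_outerEnd hl d S fun _ => 1
  simp only [List.map_const', List.sum_replicate, nsmul_eq_mul, mul_one] at this
  exact_mod_cast this

/-- A growth step is a subprobability average with the missing mass counted as 0, so it preserves
the lower bound -1. This keeps 1 + g nonnegative, and `ENNReal.ofReal` then loses nothing. -/
theorem neg_one_le_growthStep {d : Fin n → ℕ} {S : Finset (Fin n)}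
    (hS : ∀ a ∈ S, G.degree a ≤ S.sup d) {g : Finset (Fin n) → ℝ}
    (hg : ∀ u, (∃ a ∈ S, G.Adj a u) → -1 ≤ g (insert u S)) : -1 ≤ growthStep G d g S := by
  unfold growthStep
  rcases Nat.eq_zero_or_pos (S.card * S.sup d) with h0 | h0
  · rw [h0]; simp
  have h0' : (0 : ℝ) < (S.card * S.sup d : ℕ) := by exact_mod_cast h0
  rw [le_div_iff₀ h0', neg_one_mul]
  have h1 : ((∑ u, (if u ∉ S ∧ d u ≤ S.sup d then linkCount G S u else 0) : ℕ) : ℝ) ≤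
      (S.card * S.sup d : ℕ) := by exact_mod_cast sum_linkCount_le (d := d) hS
  refine le_trans (neg_le_neg h1) ?_
  rw [Nat.cast_sum, ← Finset.sum_neg_distrib]
  refine Finset.sum_le_sum fun u _ => ?_
  split_ifs with h
  · rcases Nat.eq_zero_or_pos (linkCount G S u) with h2 | h2
    · simp [h2]
    · obtain ⟨a, ha⟩ := Finset.card_pos.1 h2
      rw [Finset.mem_filter] at ha
      have h3 := hg u ⟨a, ha⟩
      have h4 : (0 : ℝ) ≤ linkCount G S u := by positivity
      nlinarith
  · simp

theorem expect_growLaw (hl : IsEdgeStream G l) {d : Fin n → ℕ} {S : Finset (Fin n)}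
    (hS : ∀ a ∈ S, G.degree a ≤ S.sup d) {g : Finset (Fin n) → ℝ} (hg0 : g ∅ = 0)
    (hg : ∀ u, (∃ a ∈ S, G.Adj a u) → -1 ≤ g (insert u S)) :
    expect (growLaw d l S) (fun T => ENNReal.ofReal (1 + g T)) =
      ENNReal.ofReal (1 + growthStep G d g S) := by
  unfold growLaw
  split_ifs with h
  · set r := S.card * S.sup d with hr
    set out := l.filterMap (outerEnd d S) with hc
    have hlen : out.length ≤ r := length_filterMap_outerEnd_le hl hS
    let ψ : Option (Fin n) → ℝ := fun o => g (o.elim ∅ fun v => insert v S)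
    have hψ : ∀ t : ℕ, 0 ≤ 1 + ψ (out[t]?) := by
      intro t
      cases ht : out[t]? with
      | none => simp [ψ, hg0]
      | some v =>
        have hv : v ∈ out := List.mem_of_getElem? ht
        rw [hc, List.mem_filterMap] at hv
        obtain ⟨e, he, hev⟩ := hv
        obtain ⟨⟨a, ha, rfl⟩, -⟩ := outerEnd_eq_some_iff.1 hev
        have := hg v ⟨a, ha, (hl.2 _).1 he⟩
        simp only [ψ, Option.elim_some]
        linarith
    rw [expect_map]
    refine (expect_uniformBelow h (φ := fun t => 1 + ψ (out[t]?)) fun t _ => hψ t).trans ?_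
    congr 1
    -- Draws beyond the last outgoing edge give the failed trial, on which `g` vanishes.
    have h1 : ∑ t ∈ Finset.range r, ψ (out[t]?) = (out.map fun v => g (insert v S)).sum := by
      obtain ⟨m, hm⟩ := Nat.exists_eq_add_of_le hlen
      rw [hm, Finset.sum_range_add, Finset.sum_eq_zero (s := Finset.range m), add_zero]
      · rw [Finset.sum_range, ← List.sum_ofFn]
        congr 1
        refine List.ext_getElem (by simp) fun i h1 h2 => ?_
        simp [ψ]
      · intro i _
        rw [List.getElem?_eq_none (by omega)]
        simp [ψ, hg0]
    have hr' : (r : ℝ) ≠ 0 := by exact_mod_cast h.ne'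
    rw [Finset.sum_add_distrib, h1, Finset.sum_const, Finset.card_range, nsmul_eq_mul, mul_one,
      add_div, div_self hr', hc, sum_map_filterMap_outerEnd hl, growthStep]
  · rw [expect_pure, hg0]
    have : S.card * S.sup d = 0 := Nat.eq_zero_of_not_pos h
    simp [growthStep, this]

theorem mem_support_growLaw (hl : IsEdgeStream G l) {d : Fin n → ℕ} {S T : Finset (Fin n)}
    (hT : T ∈ (growLaw d l S).support) :
    T = ∅ ∨ ∃ v ∉ S, (∃ a ∈ S, G.Adj a v) ∧ T = insert v S := by
  unfold growLaw at hT
  split_ifs at hT with h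
  · rw [PMF.mem_support_map_iff] at hT
    obtain ⟨t, -, rfl⟩ := hT
    cases ht : (l.filterMap (outerEnd d S))[t]? with
    | none => exact Or.inl rfl
    | some v =>
      obtain ⟨e, he, hev⟩ := List.mem_filterMap.1 (List.mem_of_getElem? ht)
      obtain ⟨⟨a, ha, rfl⟩, hv, -⟩ := outerEnd_eq_some_iff.1 hev
      exact Or.inr ⟨v, hv, ⟨a, ha, (hl.2 _).1 he⟩, rfl⟩
  · left; simpa using hT

/-- The relative change of the weight `y` of the outcome of a trial whose set is `S` before the
recording pass. -/
def outcomeGain (G : SimpleGraph (Fin n)) (d : Fin n → ℕ) (k : ℕ)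
    (y : Option (GraphletClass k) → ℝ) (S : Finset (Fin n)) : ℝ :=
  if S ∈ graphlets G k then (y (classOf k G S) - 1) / growthCount G d (k - 1) S else 0

theorem empty_notMem_graphlets (hk : 0 < k) : ∅ ∉ graphlets G k := by
  simp [mem_graphlets, hk.ne]

theorem neg_one_le_outcomeGain {d : Fin n → ℕ} {y : Option (GraphletClass k) → ℝ}
    (hy : ∀ o, 0 ≤ y o) (S : Finset (Fin n)) : -1 ≤ outcomeGain G d k y S := by
  unfold outcomeGain
  split_ifs with h
  · rcases Nat.eq_zero_or_pos (growthCount G d (k - 1) S) with h0 | h0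
    · simp [h0]
    · have h1 : (1 : ℝ) ≤ growthCount G d (k - 1) S := by exact_mod_cast h0
      rw [le_div_iff₀ (by linarith)]
      linarith [hy (classOf k G S)]
  · norm_num

/-- Acceptance with probability 1/N averages y and N-1 ones to 1 + (y-1)/N. A failed trial or a
disconnected set yields `none`, of weight 1, whatever is drawn. -/
theorem expect_trialOutcome (hk : 0 < k) (hl : IsEdgeStream G l)
    {y : Option (GraphletClass k) → ℝ} (hy : ∀ o, 0 ≤ y o) (hy1 : y none = 1) {S : Finset (Fin n)}
    {d : Fin n → ℕ} (hd : ∀ v, Alive G k v → 0 < d v) (hS : S = ∅ ∨ S.card = k) :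
    expect ((trialScan d k l (freshTrial S)).bind (trialOutcome d k))
      (fun o => ENNReal.ofReal (y o)) = ENNReal.ofReal (1 + outcomeGain G d k y S) := by
  rcases hS with rfl | hS
  · rw [trialScan_empty d hk, PMF.pure_bind, outcomeGain, if_neg (empty_notMem_graphlets hk)]
    have h1 : classOf k (SimpleGraph.fromEdgeSet
        (((freshTrial ∅ : Trial n).1.2 : Finset _) : Set (Sym2 (Fin n)))) ∅ = none := by
      by_contra h
      obtain ⟨i, hi⟩ := Option.ne_none_iff_exists'.1 h
      exact empty_notMem_graphlets hk (exists_classOf_iff.1 ⟨i, hi⟩)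
    have h2 : (freshTrial ∅ : Trial n).1.1 = ∅ := rfl
    rw [trialOutcome, h2, h1, expect_map]
    simp only [ite_self, hy1, expect_const, add_zero]
  · rw [freshTrial, trialScan_of_complete hS, PMF.pure_bind, trialOutcome]
    have hadj : ∀ a ∈ S, ∀ b ∈ S, (SimpleGraph.fromEdgeSet
        ((l.foldl (recordEdge S) ∅ : Finset _) : Set (Sym2 (Fin n)))).Adj a b ↔ G.Adj a b :=
      fun a ha b hb => adj_recorded_iff hl ha hb
    simp only
    rw [classOf_congr hadj, growthCount_congr (k - 1) hadj, expect_map]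
    by_cases hg : S ∈ graphlets G k
    · have hN : 0 < growthCount G d (k - 1) S := by
        refine growthCount_pos ?_ fun v hv => hd v (alive_of_mem_graphlet hg hv)
        rwa [Nat.sub_add_cancel hk]
      rw [expect_uniformBelow hN (φ := fun t => y (if t = 0 then classOf k G S else none))
        fun t _ => hy _, outcomeGain, if_pos hg]
      congr 1
      obtain ⟨N, hN'⟩ := Nat.exists_eq_succ_of_ne_zero hN.ne'
      rw [hN', Finset.sum_range_succ']
      simp only [Nat.succ_ne_zero, if_false, if_true, hy1, Finset.sum_const, Finset.card_range,
        nsmul_eq_mul, mul_one]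
      have : ((N.succ : ℕ) : ℝ) ≠ 0 := by positivity
      field_simp
      push_cast
      ring
    · have : classOf k G S = none := by
        by_contra h
        exact hg (exists_classOf_iff.1 (Option.ne_none_iff_exists'.1 h))
      simp only [this, ite_self, hy1, expect_const, outcomeGain, if_neg hg, add_zero]

end trial

/-! ### Composition of independent draws -/

section drawList

variable {X Y Z : Type*}

/-- Advancing all trials stage by stage has the same law as running each trial through both stages
separately, because independent draws commute. -/
theorem drawList_bind (f : X → PMF Y) (g : Y → PMF Z) (xs : List X) :
    (drawList f xs).bind (drawList g) = drawList (fun x => (f x).bind g) xs := by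
  induction xs with
  | nil => simp [drawList]
  | cons x xs ih =>
    simp only [drawList, PMF.bind_bind, PMF.bind_map, Function.comp_def, ← ih, PMF.map_bind]
    refine congrArg _ (funext fun y => ?_)
    rw [PMF.bind_comm]

theorem drawList_map (f : X → PMF Y) (g : Y → Z) (xs : List X) :
    (drawList f xs).map (List.map g) = drawList (fun x => (f x).map g) xs := by
  induction xs with
  | nil => simp [drawList, PMF.pure_map]
  | cons x xs ih =>
    simp only [drawList, PMF.bind_map, Function.comp_def, ← ih, PMF.map_bind, PMF.map_comp,
      List.map_cons]

theorem drawList_comp (f : Y → PMF Z) (h : X → Y) (xs : List X) :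
    drawList f (xs.map h) = drawList (fun x => f (h x)) xs := by
  induction xs with
  | nil => rfl
  | cons x xs ih => simp only [List.map_cons, drawList, ih]

theorem drawList_congr {f g : X → PMF Y} {xs : List X} (h : ∀ x ∈ xs, f x = g x) :
    drawList f xs = drawList g xs := by
  induction xs with
  | nil => rfl
  | cons x xs ih =>
    simp only [drawList, h x (by simp), ih fun z hz => h z (by simp [hz])]

end drawList

/-! ### Many trials in parallel -/

section machine

variable {n k : ℕ}

/-- The state of the sampling phase: the degree profile, the counters of the classes, the number of
rounds left, the number of growth passes left in the present round, and the trials. -/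
structure SampState (n k : ℕ) where
  deg : Fin n → ℕ
  cnt : GraphletClass k → ℕ
  rounds : ℕ
  stage : ℕ
  trials : List (Trial n)

/-- The roots of `b` new trials. -/
def rootsLaw (d : Fin n → ℕ) (k b : ℕ) : PMF (List (Finset (Fin n))) :=
  drawList (fun _ : Unit => rootLaw d k) (List.replicate b ())

/-- The state between two passes. -/
def sampState (d : Fin n → ℕ) (c : GraphletClass k → ℕ) (r j : ℕ) (Ss : List (Finset (Fin n))) :
    SampState n k := ⟨d, c, r, j, Ss.map freshTrial⟩

/-- Count the outcomes of a round. -/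
def addOutcomes (c : GraphletClass k → ℕ) (os : List (Option (GraphletClass k)))
    (i : GraphletClass k) : ℕ := c i + os.count (some i)

/-- The machine that runs `b` trials in parallel in each round. -/
def sampMachine (n k b : ℕ) : Machine n (SampState n k) where
  step x e := (drawList (fun τ => trialStep x.deg k τ e) x.trials).map fun ts =>
    { x with trials := ts }
  endPass x :=
    if x.rounds = 0 then PMF.pure x
    else if x.stage = 0 then
      (drawList (trialOutcome x.deg k) x.trials).bind fun os =>
        (rootsLaw x.deg k b).map (sampState x.deg (addOutcomes x.cnt os) (x.rounds - 1) (k - 1))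
    else PMF.pure (sampState x.deg x.cnt x.rounds (x.stage - 1) (x.trials.map (grown k)))
  -- A round consists of k-1 growth passes and one recording pass. The roots drawn after the last
  -- round are never used.
  left x := if x.rounds = 0 then 0 else (x.rounds - 1) * k + x.stage + 1

theorem sampMachine_scan (b : ℕ) (l : List (Sym2 (Fin n))) (x : SampState n k) :
    (sampMachine n k b).scan l x =
      (drawList (trialScan x.deg k l) x.trials).map fun ts => { x with trials := ts } := by
  induction l generalizing x with
  | nil =>
    have : ∀ ts : List (Trial n), drawList (trialScan x.deg k []) ts = PMF.pure ts := by
      intro ts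
      induction ts with
      | nil => rfl
      | cons t ts ih =>
        simp only [drawList, ih, PMF.pure_map]
        simp [trialScan, PMF.pure_bind]
    rw [this, PMF.pure_map]
    rfl
  | cons e es ih =>
    have h1 : trialScan x.deg k (e :: es) =
        fun τ => (trialStep x.deg k τ e).bind (trialScan x.deg k es) := rfl
    rw [h1, ← drawList_bind, PMF.map_bind, Machine.scan]
    change PMF.bind (PMF.map _ _) _ = _
    rw [PMF.bind_map]
    refine congrArg _ (funext fun ts => ?_)
    simp only [Function.comp, ih]

theorem sampMachine_pass_grow (b : ℕ) (l : List (Sym2 (Fin n))) (d : Fin n → ℕ)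
    (c : GraphletClass k → ℕ) {r : ℕ} (hr : r ≠ 0) (j : ℕ) {Ss : List (Finset (Fin n))}
    (hS : ∀ S ∈ Ss, S.card < k) :
    (sampMachine n k b).pass l (sampState d c r (j + 1) Ss) =
      (drawList (growLaw d l) Ss).map (sampState d c r j) := by
  rw [← drawList_congr fun S h => trialScan_map_grown (hS S h) l, ← drawList_map,
    ← drawList_comp (trialScan d k l) freshTrial, PMF.map_comp, Machine.pass, sampMachine_scan,
    PMF.bind_map, PMF.map]
  refine congrArg _ (funext fun ts => ?_)
  simp [sampMachine, sampState, hr]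

theorem sampMachine_pass_record (b : ℕ) (l : List (Sym2 (Fin n))) (d : Fin n → ℕ)
    (c : GraphletClass k → ℕ) (r : ℕ) (Ss : List (Finset (Fin n))) :
    (sampMachine n k b).pass l (sampState d c (r + 1) 0 Ss) =
      (drawList (fun S => (trialScan d k l (freshTrial S)).bind (trialOutcome d k)) Ss).bind
        fun os => (rootsLaw d k b).map (sampState d (addOutcomes c os) r (k - 1)) := by
  rw [← drawList_bind (fun S => trialScan d k l (freshTrial S)),
    ← drawList_comp (trialScan d k l) freshTrial, PMF.bind_bind, Machine.pass, sampMachine_scan,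
    PMF.bind_map]
  refine congrArg _ (funext fun ts => ?_)
  simp [sampMachine, sampState]

/-- The trials of bounded size. -/
def trialStates (n k : ℕ) : Set (Trial n) :=
  {τ | (τ.1.1.card ≤ k ∧ τ.1.2 ⊆ τ.1.1.sym2) ∧ ∀ t ∈ τ.2.1, t < k * n}

/-- The skip counter is below k·n ≤ n², so it and its absent value, coded as 0 after a shift by one,
fit into two words; the vertex takes one more word with `n` for "none". -/
theorem trialStates_fits (h : k ≤ n) :
    Fits (trialStates n k) ((k * wordSize n + k * k) + (2 * wordSize n + wordSize n)) := by
  refine ((Fits.inducedEdges n k).prod ((Fits.nat (2 * wordSize n)).prod (Fits.le n))).comap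
    (fun τ => (τ.1, (τ.2.1.elim 0 Nat.succ, τ.2.2.elim n Fin.val))) ?_ ?_
  · rintro ⟨p, t, u⟩ ⟨h1, h2⟩
    refine ⟨h1, ?_, ?_⟩
    · cases t with
      | none => exact Nat.two_pow_pos _
      | some t =>
        have h3 : t < k * n := h2 t rfl
        have h4 : n < 2 ^ wordSize n := lt_two_pow_wordSize le_rfl
        have h5 : k * n ≤ n * n := Nat.mul_le_mul_right _ h
        have h6 : n * n < 2 ^ (2 * wordSize n) := by
          rw [two_mul, pow_add]; exact Nat.mul_lt_mul'' h4 h4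
        change t + 1 < _
        omega
    · cases u with
      | none => exact le_refl n
      | some u => exact u.2.le
  · rintro ⟨p, t, u⟩ - ⟨p', t', u'⟩ - h
    simp only [Prod.mk.injEq] at h ⊢
    obtain ⟨rfl, h1, h2⟩ := h
    refine ⟨rfl, ?_, ?_⟩
    · cases t <;> cases t' <;> simp_all
    · cases u with
      | none =>
        cases u' with
        | none => rfl
        | some b => exact absurd h2.symm b.2.ne
      | some a =>
        cases u' with
        | none => exact absurd h2 a.2.ne
        | some b => exact congrArg some (Fin.ext h2)

/-- The states of bounded size. -/
def sampStates (n k b Q : ℕ) : Set (SampState n k) :=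
  {x | (∀ v, x.deg v ≤ n) ∧ (∀ i, x.cnt i ≤ (Q - x.rounds) * b) ∧ x.rounds ≤ Q ∧ x.stage < k ∧
    x.trials.length = b ∧ ∀ τ ∈ x.trials, τ ∈ trialStates n k}

theorem sampStates_fits {b Q w : ℕ} (h : k ≤ n) (hb : 0 < b) (hQ : Q * b < 2 ^ w) :
    Fits (sampStates n k b Q) (n * wordSize n + (Fintype.card (GraphletClass k) * w + (w +
      (wordSize n + b * ((k * wordSize n + k * k) + (2 * wordSize n + wordSize n)))))) := by
  refine ((Fits.fun_le n).prod ((Fits.pi (ι := GraphletClass k) (Fits.nat w)).prod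
    ((Fits.nat w).prod ((Fits.le n).prod ((trialStates_fits h).list b))))).comap
    (fun x => (x.deg, x.cnt, x.rounds, x.stage, x.trials)) ?_ ?_
  · rintro ⟨d, c, r, j, ts⟩ ⟨h1, h2, h3, h4, h5⟩
    simp only at h1 h2 h3 h4 h5
    refine ⟨h1, fun i => lt_of_le_of_lt ((h2 i).trans ?_) hQ, lt_of_le_of_lt (h3.trans ?_) hQ,
      h4.le.trans h, h5⟩
    · exact Nat.mul_le_mul_right _ (Nat.sub_le _ _)
    · exact Nat.le_mul_of_pos_right _ hb
  · rintro ⟨d, c, r, j, ts⟩ - ⟨d', c', r', j', ts'⟩ - h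
    simpa using h

theorem freshTrial_mem {S : Finset (Fin n)} (h : S.card ≤ k) : freshTrial S ∈ trialStates n k :=
  ⟨⟨h, by simp [freshTrial]⟩, by simp [freshTrial]⟩

theorem advance_fst_le {d : Fin n → ℕ} {S : Finset (Fin n)} {w : Option ℕ × Option (Fin n)} {m : ℕ}
    (h : ∀ t ∈ w.1, t < m) (e : Sym2 (Fin n)) : ∀ t ∈ (advance d S w e).1, t < m := by
  obtain ⟨_ | _ | t, u⟩ := w <;> cases ho : outerEnd d S e <;>
    simp only [advance, ho, Option.elim_none, Option.elim_some] <;> intro s hs <;>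
    simp only [Option.mem_def, reduceCtorEq, Option.some.injEq] at hs
  all_goals have := h _ rfl; omega

theorem trialStep_mem {d : Fin n → ℕ} (hd : ∀ v, d v ≤ n) {τ : Trial n}
    (hτ : τ ∈ trialStates n k) (e : Sym2 (Fin n)) : (trialStep d k τ e).support ⊆ trialStates n k := by
  intro y hy
  unfold trialStep at hy
  split_ifs at hy with h1 h2
  · rw [PMF.support_pure, Set.mem_singleton_iff] at hy
    subst hy
    exact ⟨⟨hτ.1.1, recordEdge_subset hτ.1.2 e⟩, hτ.2⟩
  · rw [PMF.mem_support_map_iff] at hy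
    obtain ⟨t, ht, rfl⟩ := hy
    refine ⟨hτ.1, advance_fst_le ?_ e⟩
    intro s hs
    obtain rfl : t = s := Option.some_inj.1 hs
    have h3 := lt_of_mem_support_uniformBelow h2.2 ht
    have h4 : τ.1.1.sup d ≤ n := Finset.sup_le fun v _ => hd v
    exact h3.trans_le (Nat.mul_le_mul hτ.1.1 h4)
  · rw [PMF.support_pure, Set.mem_singleton_iff] at hy
    subst hy
    exact ⟨hτ.1, advance_fst_le hτ.2 e⟩

theorem length_of_mem_support_rootsLaw {d : Fin n → ℕ} {b : ℕ} {Ss : List (Finset (Fin n))}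
    (h : Ss ∈ (rootsLaw d k b).support) : Ss.length = b := by
  simpa using length_of_mem_support_drawList h

theorem mem_support_rootsLaw {d : Fin n → ℕ} {b : ℕ} {Ss : List (Finset (Fin n))}
    (h : Ss ∈ (rootsLaw d k b).support) : ∀ S ∈ Ss, S ∈ (rootLaw d k).support := by
  intro S hS
  obtain ⟨_, _, h'⟩ := exists_of_mem_support_drawList h S hS
  exact h'

theorem sampState_mem {d : Fin n → ℕ} (hd : ∀ v, d v ≤ n) (hk : 2 ≤ k) {b Q r : ℕ}
    {c : GraphletClass k → ℕ} (hc : ∀ i, c i ≤ (Q - r) * b) (hr : r ≤ Q)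
    {Ss : List (Finset (Fin n))} (h : Ss ∈ (rootsLaw d k b).support) :
    sampState d c r (k - 1) Ss ∈ sampStates n k b Q := by
  refine ⟨hd, hc, hr, by simp only [sampState]; omega,
    by simpa [sampState] using length_of_mem_support_rootsLaw h, ?_⟩
  intro τ hτ
  obtain ⟨S, hS, rfl⟩ := List.mem_map.1 hτ
  refine freshTrial_mem ?_
  rcases mem_support_rootLaw hk (mem_support_rootsLaw h S hS) with rfl | ⟨v, rfl, -⟩
  · simp
  · rw [Finset.card_singleton]; omega

theorem sampMachine_closed (hk : 2 ≤ k) (b Q : ℕ) :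
    (sampMachine n k b).Closed (sampStates n k b Q) := by
  refine ⟨?_, ?_⟩
  · rintro x ⟨h1, h2, h3, h4, h5, h6⟩ e y hy
    simp only [sampMachine, PMF.mem_support_map_iff] at hy
    obtain ⟨ts, hts, rfl⟩ := hy
    refine ⟨h1, h2, h3, h4, (length_of_mem_support_drawList hts).trans h5, fun τ hτ => ?_⟩
    obtain ⟨σ, hσ, hτσ⟩ := exists_of_mem_support_drawList hts τ hτ
    exact trialStep_mem h1 (h6 σ hσ) e hτσ
  · rintro x hx y hy
    obtain ⟨h1, h2, h3, h4, h5, h6⟩ := hx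
    simp only [sampMachine] at hy
    split_ifs at hy with hr hj
    · rw [PMF.support_pure, Set.mem_singleton_iff] at hy
      subst hy
      exact ⟨h1, h2, h3, h4, h5, h6⟩
    · simp only [PMF.mem_support_bind_iff, PMF.mem_support_map_iff] at hy
      obtain ⟨os, hos, Ss, hSs, rfl⟩ := hy
      refine sampState_mem h1 hk (fun i => ?_) (by omega) hSs
      have hlen := length_of_mem_support_drawList hos
      have : os.count (some i) ≤ b := List.count_le_length.trans (by omega)
      calc addOutcomes x.cnt os i ≤ (Q - x.rounds) * b + b := add_le_add (h2 i) this
        _ = (Q - x.rounds + 1) * b := by ring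
        _ = _ := by congr 1; omega
    · rw [PMF.support_pure, Set.mem_singleton_iff] at hy
      subst hy
      refine ⟨h1, h2, h3, by simp only [sampState]; omega, by simpa [sampState] using h5, ?_⟩
      intro τ hτ
      simp only [sampState, List.map_map, List.mem_map, Function.comp] at hτ
      obtain ⟨σ, hσ, rfl⟩ := hτ
      refine freshTrial_mem ?_
      unfold grown
      split_ifs with hc
      · cases σ.2.2 with
        | none => simp
        | some v => exact (Finset.card_insert_le _ _).trans hc
      · simp

/-! ### The invariant and the potential of the sampling machine -/

variable {G : SimpleGraph (Fin n)}

/-- Between two passes, the trials that have not failed consist of the right number of vertices in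
large components. -/
def SampInv (G : SimpleGraph (Fin n)) (k b : ℕ) (x : SampState n k) : Prop :=
  ∃ c r j Ss, x = sampState (profile G k) c r j Ss ∧ j < k ∧ Ss.length = b ∧
    ∀ S ∈ Ss, S = ∅ ∨ (S.card + j = k ∧ ∀ v ∈ S, Alive G k v)

theorem sampInv_of_roots (hk : 2 ≤ k) {b : ℕ} (c : GraphletClass k → ℕ) (r : ℕ)
    {Ss : List (Finset (Fin n))} (h : Ss ∈ (rootsLaw (profile G k) k b).support) :
    SampInv G k b (sampState (profile G k) c r (k - 1) Ss) := by
  refine ⟨c, r, k - 1, Ss, rfl, by omega, length_of_mem_support_rootsLaw h, fun S hS => ?_⟩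
  rcases mem_support_rootLaw hk (mem_support_rootsLaw h S hS) with rfl | ⟨v, rfl, hv⟩
  · exact Or.inl rfl
  · refine Or.inr ⟨by rw [Finset.card_singleton]; omega, fun w hw => ?_⟩
    rw [Finset.mem_singleton] at hw
    exact hw ▸ alive_of_profile_pos hv

/-- A growth step either fails or adds a neighbour, which lies in the same component and so is again
alive. Hence the profile is the true degree on every surviving set, as the analysis of the next step
requires. -/
theorem sampInv_pass (hk : 2 ≤ k) {b : ℕ} (x : SampState n k) (hx : SampInv G k b x)
    (h0 : (sampMachine n k b).left x ≠ 0) (l : List (Sym2 (Fin n))) (hl : IsEdgeStream G l)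
    (y : SampState n k) (hy : y ∈ ((sampMachine n k b).pass l x).support) :
    SampInv G k b y ∧ (sampMachine n k b).left y + 1 = (sampMachine n k b).left x := by
  obtain ⟨c, r, j, Ss, rfl, hj, hlen, hSs⟩ := hx
  have hr : r ≠ 0 := by
    rintro rfl
    simp [sampMachine, sampState] at h0
  cases j with
  | succ j =>
    have hcard : ∀ S ∈ Ss, S.card < k := by
      intro S hS
      rcases hSs S hS with rfl | ⟨h1, -⟩
      · rw [Finset.card_empty]; omega
      · omega
    rw [sampMachine_pass_grow b l _ c hr j hcard, PMF.mem_support_map_iff] at hy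
    obtain ⟨Ts, hTs, rfl⟩ := hy
    refine ⟨⟨c, r, j, Ts, rfl, by omega, (length_of_mem_support_drawList hTs).trans hlen,
      fun T hT => ?_⟩, by simp [sampMachine, sampState, hr, add_assoc]⟩
    obtain ⟨S, hS, hTS⟩ := exists_of_mem_support_drawList hTs T hT
    rcases mem_support_growLaw hl hTS with rfl | ⟨v, hv, ⟨a, ha, hav⟩, rfl⟩
    · exact Or.inl rfl
    · rcases hSs S hS with rfl | ⟨h1, h2⟩
      · simp at ha
      · refine Or.inr ⟨by rw [Finset.card_insert_of_notMem hv]; omega, fun w hw => ?_⟩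
        rcases Finset.mem_insert.1 hw with rfl | hw
        · exact (h2 a ha).of_reachable hav.reachable
        · exact h2 w hw
  | zero =>
    obtain ⟨r, rfl⟩ := Nat.exists_eq_succ_of_ne_zero hr
    rw [Nat.succ_eq_add_one, sampMachine_pass_record] at hy
    simp only [PMF.mem_support_bind_iff, PMF.mem_support_map_iff] at hy
    obtain ⟨os, hos, Ts, hTs, rfl⟩ := hy
    refine ⟨sampInv_of_roots hk _ r hTs, ?_⟩
    simp only [sampMachine, sampState]
    rcases Nat.eq_zero_or_pos r with rfl | hr'
    · simp
    · obtain ⟨r, rfl⟩ := Nat.exists_eq_succ_of_ne_zero hr'.ne'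
      simp only [Nat.succ_eq_add_one, Nat.add_eq_zero_iff, one_ne_zero, and_false, if_false,
        Nat.add_sub_cancel]
      have : (r + 1) * k = r * k + k := by ring
      omega

/-- The expected gain of a trial with `j` growth passes left. -/
def trialGain (G : SimpleGraph (Fin n)) (k : ℕ) (y : Option (GraphletClass k) → ℝ) (j : ℕ) :
    Finset (Fin n) → ℝ :=
  (growthStep G (profile G k))^[j] (outcomeGain G (profile G k) k y)

/-- The expected gain of a complete trial. -/
def totalGain (G : SimpleGraph (Fin n)) (k : ℕ) (y : Option (GraphletClass k) → ℝ) : ℝ :=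
  (∑ i, graphletCount G i * (y (some i) - 1)) /
    (rootWeight (profile G k) k * (k - 1).factorial)

theorem trialGain_empty (hk : 0 < k) (y : Option (GraphletClass k) → ℝ) (j : ℕ) :
    trialGain G k y j ∅ = 0 := by
  cases j with
  | zero => simp [trialGain, outcomeGain, empty_notMem_graphlets hk]
  | succ j => simp [trialGain, Function.iterate_succ_apply', growthStep]

theorem degree_le_sup_profile {S : Finset (Fin n)} (hS : ∀ v ∈ S, Alive G k v) :
    ∀ a ∈ S, G.degree a ≤ S.sup (profile G k) := fun a ha =>
  (hS a ha).profile_eq ▸ Finset.le_sup (f := profile G k) ha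

theorem alive_insert {S : Finset (Fin n)} (hS : ∀ v ∈ S, Alive G k v) {u : Fin n}
    (hu : ∃ a ∈ S, G.Adj a u) : ∀ v ∈ insert u S, Alive G k v := by
  obtain ⟨a, ha, hau⟩ := hu
  intro v hv
  rcases Finset.mem_insert.1 hv with rfl | hv
  · exact (hS a ha).of_reachable hau.reachable
  · exact hS v hv

theorem neg_one_le_trialGain {y : Option (GraphletClass k) → ℝ} (hy : ∀ o, 0 ≤ y o) (j : ℕ) :
    ∀ S : Finset (Fin n), (∀ v ∈ S, Alive G k v) → -1 ≤ trialGain G k y j S := by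
  induction j with
  | zero => exact fun S _ => neg_one_le_outcomeGain hy S
  | succ j ih =>
    intro S hS
    rw [trialGain, Function.iterate_succ_apply']
    exact neg_one_le_growthStep (degree_le_sup_profile hS) fun u hu => ih _ (alive_insert hS hu)

/-- The acceptance probability 1/`growthCount` cancels the number of histories: every graphlet
contributes with the same weight 1/(Z·(k-1)!). -/
theorem sum_root_mul_trialGain (hk : 2 ≤ k) (y : Option (GraphletClass k) → ℝ) :
    (∑ v, (profile G k v : ℝ) ^ (k - 1) * trialGain G k y (k - 1) {v}) /
      rootWeight (profile G k) k = totalGain G k y := by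
  have hg : ∀ S : Finset (Fin n), growthCount G (profile G k) (k - 1) S *
      outcomeGain G (profile G k) k y S / ((k - 1).factorial : ℝ) =
      if S ∈ graphlets G k then (y (classOf k G S) - 1) / ((k - 1).factorial : ℝ) else 0 := by
    intro S
    unfold outcomeGain
    split_ifs with h
    · have hN : 0 < growthCount G (profile G k) (k - 1) S := by
        refine growthCount_pos (by rwa [Nat.sub_add_cancel (by omega)]) fun v hv => ?_
        have ha := alive_of_mem_graphlet h hv
        rw [ha.profile_eq]
        exact ha.degree_pos hk
      have hN' : (growthCount G (profile G k) (k - 1) S : ℝ) ≠ 0 := by exact_mod_cast hN.ne'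
      field_simp
    · simp
  unfold trialGain
  rw [sum_root_mul_iterate G _ _ (by omega), Finset.sum_congr rfl fun S _ => hg S,
    ← Finset.sum_filter, Finset.filter_mem_eq_inter, Finset.univ_inter, ← Finset.sum_div,
    sum_graphlets G fun o => y o - 1, totalGain, div_div, mul_comm ((k - 1).factorial : ℝ)]

/-- The weight of a vector of counters. -/
def countWeight (y : Option (GraphletClass k) → ℝ) (c : GraphletClass k → ℕ) : ℝ≥0∞ :=
  ∏ i, ENNReal.ofReal (y (some i)) ^ c i

theorem countWeight_addOutcomes {y : Option (GraphletClass k) → ℝ} (hy1 : y none = 1)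
    (c : GraphletClass k → ℕ) (os : List (Option (GraphletClass k))) :
    countWeight y (addOutcomes c os) =
      countWeight y c * (os.map fun o => ENNReal.ofReal (y o)).prod := by
  have h : ∏ i, ENNReal.ofReal (y (some i)) ^ os.count (some i) =
      (os.map fun o => ENNReal.ofReal (y o)).prod := by
    induction os with
    | nil => simp
    | cons o os ih =>
      rw [List.map_cons, List.prod_cons, ← ih, mul_comm]
      simp only [List.count_cons, pow_add, Finset.prod_mul_distrib]
      congr 1
      cases o with
      | none => simp [hy1]
      | some j => simp [pow_ite]
  simp only [countWeight, addOutcomes, pow_add, Finset.prod_mul_distrib, h]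

/-- The potential of the sampling machine. -/
def sampPotential (G : SimpleGraph (Fin n)) (k b : ℕ) (y : Option (GraphletClass k) → ℝ)
    (x : SampState n k) : ℝ≥0∞ :=
  -- Weight collected so far, times the expected weights of the running trials, times those of the
  -- rounds not yet begun. After the last round the leftover trials are ignored.
  countWeight y x.cnt * if x.rounds = 0 then 1 else
    (x.trials.map fun τ => ENNReal.ofReal (1 + trialGain G k y x.stage τ.1.1)).prod *
      (ENNReal.ofReal (1 + totalGain G k y) ^ b) ^ (x.rounds - 1)

theorem sampPotential_sampState (b : ℕ) (y : Option (GraphletClass k) → ℝ) (d : Fin n → ℕ)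
    (c : GraphletClass k → ℕ) (r j : ℕ) (Ss : List (Finset (Fin n))) :
    sampPotential G k b y (sampState d c (r + 1) j Ss) = countWeight y c *
      ((Ss.map fun S => ENNReal.ofReal (1 + trialGain G k y j S)).prod *
        (ENNReal.ofReal (1 + totalGain G k y) ^ b) ^ r) := by
  simp only [sampPotential, sampState, Nat.add_eq_zero_iff, one_ne_zero, and_false, if_false,
    List.map_map, Nat.add_sub_cancel]
  rfl

theorem expect_rootsLaw (hk : 2 ≤ k) {y : Option (GraphletClass k) → ℝ} (hy : ∀ o, 0 ≤ y o)
    (hG : 0 < rootWeight (profile G k) k) (b : ℕ) :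
    expect (rootsLaw (profile G k) k b)
      (fun Ss => (Ss.map fun S => ENNReal.ofReal (1 + trialGain G k y (k - 1) S)).prod) =
      ENNReal.ofReal (1 + totalGain G k y) ^ b := by
  rw [rootsLaw, expect_drawList]
  simp only [List.map_replicate, List.prod_replicate]
  rw [expect_rootLaw hG (φ := fun S => 1 + trialGain G k y (k - 1) S)]
  · congr 2
    simp only [mul_add, mul_one, Finset.sum_add_distrib]
    rw [add_div, sum_root_mul_trialGain hk]
    congr 1
    have hG' : (rootWeight (profile G k) k : ℝ) ≠ 0 := by exact_mod_cast hG.ne'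
    rw [div_eq_one_iff_eq hG', rootWeight]
    push_cast
    rfl
  · intro v hv
    have hv' : 0 < profile G k v := by
      by_contra h
      simp [Nat.eq_zero_of_not_pos h, show k - 1 ≠ 0 by omega] at hv
    have := neg_one_le_trialGain (G := G) hy (k - 1) {v} fun w hw => by
      rw [Finset.mem_singleton] at hw
      exact hw ▸ alive_of_profile_pos hv'
    linarith

theorem expect_sampPotential_roots (hk : 2 ≤ k) {y : Option (GraphletClass k) → ℝ}
    (hy : ∀ o, 0 ≤ y o) (hG : 0 < rootWeight (profile G k) k) (b : ℕ) (d : Fin n → ℕ)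
    (c : GraphletClass k → ℕ) (r : ℕ) :
    expect (rootsLaw (profile G k) k b)
      (fun Ss => sampPotential G k b y (sampState d c r (k - 1) Ss)) =
      countWeight y c * (ENNReal.ofReal (1 + totalGain G k y) ^ b) ^ r := by
  cases r with
  | zero => simp [sampPotential, sampState, expect_const]
  | succ r =>
    simp only [sampPotential_sampState]
    rw [expect_const_mul, expect_mul_const, expect_rootsLaw hk hy hG, pow_succ']

/-- A martingale: a growth pass replaces each factor by its conditional expectation, a recording
pass moves the weights of the outcomes into the counters, and the fresh roots restore the factor of
one future round. -/
theorem expect_pass_sampPotential (hk : 2 ≤ k) {b : ℕ} {y : Option (GraphletClass k) → ℝ}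
    (hy : ∀ o, 0 ≤ y o) (hy1 : y none = 1) (hG : 0 < rootWeight (profile G k) k)
    (x : SampState n k) (hx : SampInv G k b x) (h0 : (sampMachine n k b).left x ≠ 0)
    (l : List (Sym2 (Fin n))) (hl : IsEdgeStream G l) :
    expect ((sampMachine n k b).pass l x) (sampPotential G k b y) = sampPotential G k b y x := by
  obtain ⟨c, r, j, Ss, rfl, hj, hlen, hSs⟩ := hx
  have hr : r ≠ 0 := by
    rintro rfl
    simp [sampMachine, sampState] at h0
  obtain ⟨r, rfl⟩ := Nat.exists_eq_succ_of_ne_zero hr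
  rw [Nat.succ_eq_add_one, sampPotential_sampState]
  cases j with
  | succ j =>
    have hcard : ∀ S ∈ Ss, S.card < k := by
      intro S hS
      rcases hSs S hS with rfl | ⟨h1, -⟩
      · rw [Finset.card_empty]; omega
      · omega
    rw [sampMachine_pass_grow b l _ c hr j hcard, expect_map]
    simp only [Nat.succ_eq_add_one, sampPotential_sampState]
    rw [expect_const_mul, expect_mul_const, expect_drawList]
    congr 3
    refine List.map_congr_left fun S hS => ?_
    have halive : ∀ v ∈ S, Alive G k v := by
      rcases hSs S hS with rfl | ⟨-, h⟩
      · simp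
      · exact h
    rw [expect_growLaw hl (degree_le_sup_profile halive) (trialGain_empty (by omega) y j)
      fun u hu => neg_one_le_trialGain hy j _ (alive_insert halive hu)]
    simp only [trialGain, Function.iterate_succ_apply']
  | zero =>
    rw [sampMachine_pass_record, expect_bind]
    simp only [expect_map, expect_sampPotential_roots hk hy hG, countWeight_addOutcomes hy1,
      mul_assoc]
    rw [expect_const_mul, expect_mul_const, expect_drawList]
    congr 3
    refine List.map_congr_left fun S hS => ?_
    rw [expect_trialOutcome (by omega) hl hy hy1]
    · rfl
    · intro v hv
      rw [hv.profile_eq]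
      exact hv.degree_pos hk
    · rcases hSs S hS with h | ⟨h, -⟩
      · exact Or.inl h
      · exact Or.inr (by omega)

end machine

/-! ### Concentration -/

section concentration

variable {n k : ℕ} {G : SimpleGraph (Fin n)}

theorem expect_add {X : Type*} (p : PMF X) (f g : X → ℝ≥0∞) :
    expect p (fun x => f x + g x) = expect p f + expect p g := by
  simp only [expect, mul_add]
  exact ENNReal.tsum_add

theorem expect_sum {X ι : Type*} (p : PMF X) (s : Finset ι) (f : ι → X → ℝ≥0∞) :
    expect p (fun x => ∑ i ∈ s, f i x) = ∑ i ∈ s, expect p (f i) := by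
  induction s using Finset.induction_on with
  | empty => simp [expect]
  | insert a s ha ih => simp only [Finset.sum_insert ha, expect_add, ih]

/-- The exponent of the weight that detects a deviation of the frequency of the class `i` from
`μ` by more than `α` in the direction `ε`. -/
def tiltExponent (α μ ε : ℝ) (i j : GraphletClass k) : ℝ :=
  -- The factor α/8 bounds the exponent by α/4, so its square is at most α²/16, while its mean under
  -- the graphlet distribution is -α²/8 when μ is the frequency of `i`.
  α / 8 * (ε * ((if j = i then 1 else 0) - μ) - α)

/-- The corresponding weight of an outcome. -/
def tilt (α μ ε : ℝ) (i : GraphletClass k) (o : Option (GraphletClass k)) : ℝ :=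
  o.elim 1 fun j => Real.exp (tiltExponent α μ ε i j)

theorem tilt_nonneg (α μ ε : ℝ) (i : GraphletClass k) (o : Option (GraphletClass k)) :
    0 ≤ tilt α μ ε i o := by
  cases o with
  | none => exact zero_le_one
  | some j => exact (Real.exp_pos _).le

/-- Used twice: for the observed counters the right side is nonnegative exactly in the bad event for
one sign ε, up to equality; for the true counts with μ their frequency the first term vanishes and a
negative drift remains. -/
theorem sum_mul_tiltExponent (α μ ε : ℝ) (i : GraphletClass k) (c : GraphletClass k → ℕ) :
    ∑ j, (c j : ℝ) * tiltExponent α μ ε i j =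
      α / 8 * (ε * (c i - μ * ∑ j, (c j : ℝ)) - α * ∑ j, (c j : ℝ)) := by
  have : ∀ j, (c j : ℝ) * tiltExponent α μ ε i j =
      α / 8 * ε * (if j = i then (c j : ℝ) else 0) - α / 8 * (ε * μ + α) * c j := by
    intro j
    unfold tiltExponent
    split_ifs <;> ring
  simp only [this, Finset.sum_sub_distrib, ← Finset.mul_sum, Finset.sum_ite_eq', Finset.mem_univ,
    if_true]
  ring

theorem countWeight_tilt (α μ ε : ℝ) (i : GraphletClass k) (c : GraphletClass k → ℕ) :
    countWeight (tilt α μ ε i) c =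
      ENNReal.ofReal (Real.exp (∑ j, (c j : ℝ) * tiltExponent α μ ε i j)) := by
  rw [Real.exp_sum, ENNReal.ofReal_prod_of_nonneg fun _ _ => (Real.exp_pos _).le]
  refine Finset.prod_congr rfl fun j _ => ?_
  rw [Real.exp_nat_mul, ENNReal.ofReal_pow (Real.exp_pos _).le]
  rfl

theorem one_le_countWeight_of_bad [Nonempty (GraphletClass k)] {α μ : ℝ} (hα : 0 < α)
    {i : GraphletClass k} {c : GraphletClass k → ℕ} (h : α < |estimate c i - μ|) :
    1 ≤ countWeight (tilt α μ 1 i) c + countWeight (tilt α μ (-1) i) c := by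
  have key : ∀ ε : ℝ, 0 ≤ ε * (c i - μ * ∑ j, (c j : ℝ)) - α * ∑ j, (c j : ℝ) →
      1 ≤ countWeight (tilt α μ ε i) c := by
    intro ε hε
    rw [countWeight_tilt, sum_mul_tiltExponent, ENNReal.one_le_ofReal, Real.one_le_exp_iff]
    positivity
  -- With no accepted sample the weight equals 1, so the same moment bound also pays for the event
  -- that no trial succeeds.
  by_cases h0 : ∑ j, c j = 0
  · have hc : ∀ j, c j = 0 := fun j => (Finset.sum_eq_zero_iff.1 h0) j (Finset.mem_univ j)
    exact (key 1 (by simp [hc])).trans le_self_add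
  · have hpos : (0 : ℝ) < ∑ j, (c j : ℝ) := by exact_mod_cast Nat.pos_of_ne_zero h0
    simp only [estimate, if_neg h0, Nat.cast_sum] at h
    rcases lt_abs.1 h with h1 | h1
    · refine (key 1 ?_).trans le_self_add
      rw [lt_sub_iff_add_lt, lt_div_iff₀ hpos] at h1
      linarith
    · refine (key (-1) ?_).trans le_add_self
      rw [neg_sub, lt_sub_comm, div_lt_iff₀ hpos] at h1
      linarith

/-- Use exp x ≤ 1 + x + x²: the linear terms average to -α²/8 and the squares add at most α²/16. -/
theorem sum_graphletCount_mul_tilt_le {α ε : ℝ} (hα : 0 < α) (hα1 : α < 1) (hε : |ε| = 1)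
    (hG : 0 < numGraphlets k G) (i : GraphletClass k) :
    ∑ j, (graphletCount G j : ℝ) * (tilt α (graphletDist G i) ε i (some j) - 1) ≤
      -(numGraphlets k G * (α ^ 2 / 16)) := by
  have hL : (0 : ℝ) < numGraphlets k G := by exact_mod_cast hG
  have hsum : ∑ j : GraphletClass k, (graphletCount G j : ℝ) = numGraphlets k G := by
    rw [numGraphlets]; push_cast; rfl
  have hi : (graphletCount G i : ℝ) ≤ numGraphlets k G := by
    rw [← hsum]
    exact Finset.single_le_sum (f := fun j => (graphletCount G j : ℝ)) (fun _ _ => by positivity)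
      (Finset.mem_univ i)
  have hμ0 : 0 ≤ graphletDist G i := by unfold graphletDist; positivity
  have hμ1 : graphletDist G i ≤ 1 := (div_le_one hL).2 hi
  have hx : ∀ j, |tiltExponent α (graphletDist G i) ε i j| ≤ α / 4 := by
    intro j
    unfold tiltExponent
    rw [abs_mul, abs_of_pos (by positivity : 0 < α / 8)]
    have h1 : |ε * ((if j = i then 1 else 0) - graphletDist G i) - α| ≤ 2 := by
      refine (abs_sub _ _).trans ?_
      rw [abs_mul, hε, one_mul, abs_of_pos hα]
      have : |(if j = i then 1 else 0) - graphletDist G i| ≤ 1 := by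
        rw [abs_le]
        split_ifs <;> constructor <;> linarith
      linarith
    nlinarith
  calc _ ≤ ∑ j, (graphletCount G j : ℝ) *
        (tiltExponent α (graphletDist G i) ε i j + α ^ 2 / 16) := by
        refine Finset.sum_le_sum fun j _ => mul_le_mul_of_nonneg_left ?_ (by positivity)
        have h1 := Real.abs_exp_sub_one_sub_id_le ((hx j).trans (by linarith))
        have h2 := (abs_le.1 h1).2
        have h3 : tiltExponent α (graphletDist G i) ε i j ^ 2 ≤ (α / 4) ^ 2 :=
          sq_le_sq.2 ((hx j).trans (le_abs_self _))
        simp only [tilt, Option.elim_some]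
        nlinarith
    _ = _ := by
        simp only [mul_add, Finset.sum_add_distrib, ← Finset.sum_mul]
        rw [sum_mul_tiltExponent, hsum, graphletDist, div_mul_cancel₀ _ hL.ne', sub_self]
        ring

/-- The success probability L/(Z·(k-1)!) is at least k^(-4k), so the drift per trial is that of an
accepted sample diluted by at most this factor. -/
theorem totalGain_tilt_le {α ε : ℝ} (hk : 2 ≤ k) (hα : 0 < α) (hα1 : α < 1) (hε : |ε| = 1)
    (hG : 0 < numGraphlets k G) (i : GraphletClass k) :
    totalGain G k (tilt α (graphletDist G i) ε i) ≤ -(α ^ 2 / (16 * (k : ℝ) ^ (4 * k))) := by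
  have hZ : 0 < rootWeight (profile G k) k := rootWeight_profile_pos hk
    (Finset.card_pos.1 (by rwa [← numGraphlets_eq]))
  have hden : rootWeight (profile G k) k * (k - 1).factorial ≤ k ^ (4 * k) * numGraphlets k G := by
    calc _ ≤ k ^ (2 * k) * (k * numGraphlets k G) * k ^ k := by
          refine Nat.mul_le_mul ?_ ?_
          · rw [numGraphlets_eq]; exact rootWeight_profile_le hk
          · exact (Nat.factorial_le (Nat.sub_le _ _)).trans (Nat.factorial_le_pow k)
      _ = k ^ (3 * k + 1) * numGraphlets k G := by ring
      _ ≤ _ := Nat.mul_le_mul_right _ (Nat.pow_le_pow_right (by omega) (by omega))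
  have hden' : (rootWeight (profile G k) k : ℝ) * (k - 1).factorial ≤
      (k : ℝ) ^ (4 * k) * numGraphlets k G := by exact_mod_cast hden
  have hpos : (0 : ℝ) < rootWeight (profile G k) k * (k - 1).factorial := by
    have : (0 : ℝ) < rootWeight (profile G k) k := by exact_mod_cast hZ
    positivity
  have hk' : (0 : ℝ) < (k : ℝ) ^ (4 * k) := by
    have : (0 : ℝ) < k := by exact_mod_cast (by omega : 0 < k)
    positivity
  rw [totalGain, div_le_iff₀ hpos]
  refine (sum_graphletCount_mul_tilt_le hα hα1 hε hG i).trans ?_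
  rw [neg_mul, neg_le_neg_iff, div_mul_eq_mul_div, div_le_iff₀ (by positivity)]
  nlinarith [sq_nonneg α]

theorem totalGain_pow_le {α δ ε : ℝ} {T : ℕ} (hk : 2 ≤ k) (hα : 0 < α) (hα1 : α < 1)
    (hε : |ε| = 1) (hδ : 0 < δ) (hG : 0 < numGraphlets k G) (i : GraphletClass k)
    (hT : Real.log (2 * Fintype.card (GraphletClass k) / δ) * (16 * (k : ℝ) ^ (4 * k)) ≤
      α ^ 2 * T) :
    ENNReal.ofReal (1 + totalGain G k (tilt α (graphletDist G i) ε i)) ^ T ≤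
      ENNReal.ofReal (δ / (2 * Fintype.card (GraphletClass k))) := by
  have hm : (0 : ℝ) < Fintype.card (GraphletClass k) := by
    have := Fintype.card_pos_iff.2 ⟨i⟩
    exact_mod_cast this
  have hk' : (0 : ℝ) < (k : ℝ) ^ (4 * k) := by
    have : (0 : ℝ) < k := by exact_mod_cast (by omega : 0 < k)
    positivity
  have h1 : 1 + totalGain G k (tilt α (graphletDist G i) ε i) ≤
      Real.exp (-(α ^ 2 / (16 * (k : ℝ) ^ (4 * k)))) := by
    have h2 := totalGain_tilt_le hk hα hα1 hε hG i
    have h3 := Real.add_one_le_exp (-(α ^ 2 / (16 * (k : ℝ) ^ (4 * k))))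
    linarith
  calc _ ≤ ENNReal.ofReal (Real.exp (-(α ^ 2 / (16 * (k : ℝ) ^ (4 * k))))) ^ T := by
        gcongr
    _ = ENNReal.ofReal (Real.exp (-(α ^ 2 * T / (16 * (k : ℝ) ^ (4 * k))))) := by
        rw [← ENNReal.ofReal_pow (Real.exp_pos _).le, ← Real.exp_nat_mul]
        congr 2
        ring
    _ ≤ _ := by
        refine ENNReal.ofReal_le_ofReal ?_
        rw [← Real.le_log_iff_exp_le (by positivity), ← neg_le_neg_iff, neg_neg, ← Real.log_inv,
          inv_div, le_div_iff₀ (by positivity)]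
        exact hT

end concentration

/-! ### The sampler -/

section sampler

variable {n k : ℕ}

/-- `Q` rounds of `b` trials. The potential transfers the one-trial drift to the final counters
raised to the power Q·b; Markov's inequality bounds each tilted event by δ/(2m), and there are 2m of
them. -/
theorem hasSampler_of_trials {M b Q w : ℕ} {α δ B : ℝ} (hk : 2 ≤ k) (hkn : k ≤ n) (hb : 0 < b)
    (hQ : 0 < Q) (hw : Q * b < 2 ^ w) (hα : 0 < α) (hα1 : α < 1) (hδ : 0 < δ)
    (hT : Real.log (2 * Fintype.card (GraphletClass k) / δ) * (16 * (k : ℝ) ^ (4 * k)) ≤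
      α ^ 2 * (Q * b : ℕ)) (hB : ((Q * k : ℕ) : ℝ) ≤ B)
    (hM : n * wordSize n + (Fintype.card (GraphletClass k) * w + (w +
      (wordSize n + b * ((k * wordSize n + k * k) + (2 * wordSize n + wordSize n))))) ≤
        M * wordSize n)
    {write : (Fin n → ℕ) → Memory} {read : Memory → Fin n → ℕ}
    (hread : ∀ d, (∀ v, d v ≤ n) → read (write d) = d)
    (hwrite : ∀ d, (write d).length ≤ M * wordSize n) :
    HasSampler n k M α δ B write := by
  have hne := nonempty_graphletClass (k := k) (by omega)
  have : Nonempty (SampState n k) := ⟨sampState 0 0 0 0 []⟩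
  obtain ⟨enc, dec, hdec, hlen⟩ := (sampStates_fits hkn hb hw).exists_coding
  set start : Memory → PMF (SampState n k) := fun m =>
    (rootsLaw (read m) k b).map (sampState (read m) 0 Q (k - 1)) with hstart
  set A := (sampMachine n k b).toPhase enc dec start with hA
  refine ⟨A, fun m => estimate (dec m).cnt, Q * k, fun N hN G order horder => ?_⟩
  have hprof := hread _ (profile_le G k)
  have hstart' : A.start (write (profile G k)) =
      (rootsLaw (profile G k) k b).map fun Ss => enc (sampState (profile G k) 0 Q (k - 1) Ss) := by
    simp only [hA, Machine.toPhase, hstart, hprof, PMF.map_comp, Function.comp_def]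
  have hok : ∀ Ss ∈ (rootsLaw (profile G k) k b).support,
      sampState (profile G k) 0 Q (k - 1) Ss ∈ sampStates n k b Q := fun Ss hSs =>
    sampState_mem (profile_le G k) hk (fun i => Nat.zero_le _) le_rfl hSs
  have hleft : ∀ Ss : List (Finset (Fin n)), (sampMachine n k b).left
      (sampState (profile G k) 0 Q (k - 1) Ss) = Q * k := by
    intro Ss
    obtain ⟨Q, rfl⟩ := Nat.exists_eq_succ_of_ne_zero hQ.ne'
    simp only [sampMachine, sampState, Nat.succ_ne_zero, if_false, Nat.succ_eq_add_one,
      Nat.add_sub_cancel]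
    rw [add_one_mul]
    omega
  have hsupp : ∀ t ∈ (A.run order N (write (profile G k))).support,
      ∃ y ∈ sampStates n k b Q, (sampMachine n k b).left y = 0 ∧ t.mem = enc y ∧
        t.passes = Q * k ∧ t.peak ≤ M * wordSize n := by
    intro t ht
    simp only [Phase.run, hstart', PMF.mem_support_bind_iff, PMF.mem_support_map_iff] at ht
    obtain ⟨m, ⟨Ss, hSs, rfl⟩, ht⟩ := ht
    obtain ⟨y, hy, -, hly, h1, h2, h3⟩ := Machine.runFrom_support (G := G) (P := SampInv G k b)
      hdec hlen (sampMachine_closed hk b Q) horder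
      (fun x _ hx h0 l hl y hy => sampInv_pass hk x hx h0 l hl y hy) N _ _ (hok Ss hSs)
      (sampInv_of_roots hk 0 Q hSs) rfl (by rw [hleft]; exact hN) t ht
    refine ⟨y, hy, hly, h1, by rw [h2, hleft, zero_add], h3.trans ?_⟩
    simp only [hlen]
    exact max_le (max_le (hwrite _) hM) hM
  have hexp : 0 < numGraphlets k G → ∀ y : Option (GraphletClass k) → ℝ, (∀ o, 0 ≤ y o) →
      y none = 1 → expect (A.run order N (write (profile G k)))
        (fun t => countWeight y (dec t.mem).cnt) ≤
          ENNReal.ofReal (1 + totalGain G k y) ^ (Q * b) := by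
    intro hG y hy hy1
    have hZ : 0 < rootWeight (profile G k) k := rootWeight_profile_pos hk
      (Finset.card_pos.1 (by rwa [← numGraphlets_eq]))
    -- At halting no round is left, so the potential has become the weight of the counters.
    have h1 : ∀ t ∈ (A.run order N (write (profile G k))).support,
        countWeight y (dec t.mem).cnt = sampPotential G k b y (dec t.mem) := by
      intro t ht
      obtain ⟨x, hx, hlx, h1, -⟩ := hsupp t ht
      have h2 : x.rounds = 0 := by
        by_contra h2
        simp [sampMachine, h2] at hlx
      rw [h1, hdec x hx, sampPotential, if_pos h2, mul_one]
    rw [expect_congr _ h1, Phase.run, hstart', expect_bind, expect_map]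
    calc _ ≤ expect (rootsLaw (profile G k) k b)
          (fun Ss => sampPotential G k b y (sampState (profile G k) 0 Q (k - 1) Ss)) := by
          refine expect_mono _ fun Ss hSs => ?_
          exact Machine.expect_runFrom_le (G := G) (P := SampInv G k b) hdec hlen
            (sampMachine_closed hk b Q) horder
            (fun x _ hx h0 l hl y hy => sampInv_pass hk x hx h0 l hl y hy)
            (fun x _ hx h0 l hl => (expect_pass_sampPotential hk hy hy1 hZ x hx h0 l hl).le) N _ _
            (hok Ss hSs) (sampInv_of_roots hk 0 Q hSs) rfl
      _ = _ := by
          rw [expect_sampPotential_roots hk hy hZ, ← pow_mul, mul_comm b]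
          simp [countWeight]
  refine ⟨fun t ht => ?_, fun hG => ?_⟩
  · obtain ⟨y, hy, hly, h1, h2, h3⟩ := hsupp t ht
    refine ⟨?_, estimate_mem_stdSimplex _, by rw [h2]; exact hB, h3⟩
    simp only [hA, Machine.toPhase, h1, hdec _ hy, hly]
    rfl
  · rw [ENNReal.ofReal_sub _ hδ.le, ENNReal.ofReal_one]
    refine one_sub_le_toOuterMeasure _ (t := {t | ∃ i, α < |estimate (dec t.mem).cnt i -
      graphletDist G i|}) (fun t _ ht => by simpa using ht) ?_
    refine (toOuterMeasure_le_expect _ _ (fun t => ∑ i : GraphletClass k,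
      (countWeight (tilt α (graphletDist G i) 1 i) (dec t.mem).cnt +
        countWeight (tilt α (graphletDist G i) (-1) i) (dec t.mem).cnt)) ?_).trans ?_
    · rintro t - ⟨i, hi⟩
      exact (one_le_countWeight_of_bad hα hi).trans
        (Finset.single_le_sum (f := fun i => countWeight (tilt α (graphletDist G i) 1 i)
          (dec t.mem).cnt + countWeight (tilt α (graphletDist G i) (-1) i) (dec t.mem).cnt)
          (fun _ _ => zero_le) (Finset.mem_univ i))
    · rw [expect_sum]
      have hm : (0 : ℝ) < Fintype.card (GraphletClass k) := by
        exact_mod_cast Fintype.card_pos_iff.2 hne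
      have hone : ∀ (i : GraphletClass k) (ε : ℝ), |ε| = 1 →
          expect (A.run order N (write (profile G k)))
            (fun t => countWeight (tilt α (graphletDist G i) ε i) (dec t.mem).cnt) ≤
            ENNReal.ofReal (δ / (2 * Fintype.card (GraphletClass k))) := fun i ε hε =>
        (hexp hG _ (tilt_nonneg α _ ε i) rfl).trans
          (totalGain_pow_le hk hα hα1 hε hδ hG i hT)
      calc _ ≤ ∑ _i : GraphletClass k, (ENNReal.ofReal (δ / (2 * Fintype.card (GraphletClass k))) +
            ENNReal.ofReal (δ / (2 * Fintype.card (GraphletClass k)))) := by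
            refine Finset.sum_le_sum fun i _ => ?_
            rw [expect_add]
            exact add_le_add (hone i 1 (by simp)) (hone i (-1) (by simp))
        _ = ENNReal.ofReal δ := by
            rw [← ENNReal.ofReal_add (by positivity) (by positivity), Finset.sum_const,
              Finset.card_univ, nsmul_eq_mul, ← ENNReal.ofReal_natCast, ← ENNReal.ofReal_mul
              (by positivity)]
            congr 1
            field_simp
            ring
        _ ≤ _ := le_rfl

end sampler

/-! ### Choice of the parameters -/

section parameters

variable {n k M : ℕ} {α δ : ℝ}

/-- The number of passes granted to the sampling phase, for the constant `256`. -/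
def passBudget (k M : ℕ) (α δ : ℝ) : ℝ :=
  (256 : ℕ) * (k + (k : ℝ) ^ (256 * k) / (α ^ 4 * M) * Real.log (2 / δ))

theorem log_two_le_log_two_div (hδ : δ ∈ Set.Ioo (0 : ℝ) 1) : Real.log 2 ≤ Real.log (2 / δ) := by
  apply Real.log_le_log (by norm_num)
  rw [le_div_iff₀ hδ.1]
  nlinarith [hδ.1, hδ.2]

theorem passBudget_eq (k M : ℕ) (α δ : ℝ) :
    passBudget k M α δ =
      256 * k + 256 * ((k : ℝ) ^ (256 * k) * (Real.log (2 / δ) / α ^ 4 / M)) := by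
  simp only [passBudget, div_eq_mul_inv, mul_inv]
  push_cast
  ring

theorem le_two_mul_card_graphletClass (hk : 3 ≤ k) : k ≤ 2 * Fintype.card (GraphletClass k) := by
  have := le_card_graphletClass k
  omega

theorem hasSampler_of_square_le (hn : 1 ≤ n) (hk : 3 ≤ k) (hα : α ∈ Set.Ioo (0 : ℝ) 1)
    (hδ : δ ∈ Set.Ioo (0 : ℝ) 1) (hM : 256 * (n + k * Fintype.card (GraphletClass k)) ≤ M)
    (hsq : 4 * n ^ 2 ≤ M) (write : (Fin n → ℕ) → Memory)
    (hwrite : ∀ d, (write d).length ≤ M * wordSize n) :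
    HasSampler n k M α δ (passBudget k M α δ) write := by
  have hw := wordSize_pos n
  have hm := le_two_mul_card_graphletClass hk
  refine hasSampler_of_cover (κ := n) (Q := 1) (by omega) hα.1.le hδ.1.le
    (fun _ => Finset.univ) (fun _ => by simp) (Nat.one_le_pow _ _ hn)
    (fun S _ => ⟨0, one_pos, Finset.subset_univ S⟩) ?_ ?_ write hwrite
  · rw [passBudget_eq]
    have h1 : 0 ≤ Real.log (2 / δ) := (Real.log_nonneg (by norm_num)).trans (log_two_le_log_two_div hδ)
    have h2 : (0 : ℝ) ≤ (k : ℝ) ^ (256 * k) * (Real.log (2 / δ) / α ^ 4 / M) := by positivity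
    have h3 : (3 : ℝ) ≤ k := by exact_mod_cast hk
    push_cast
    linarith
  · generalize Fintype.card (GraphletClass k) = m at *
    generalize wordSize n = w at *
    have h1 : k ≤ k * m := Nat.le_mul_of_pos_right _ (by omega)
    calc k * w + (m * (k * w) + (n * w + n * n))
        ≤ k * w + (m * (k * w) + (n * w + n * n * w)) := by
          have := Nat.le_mul_of_pos_right (n * n) hw
          omega
      _ = (k + (k * m + (n + n ^ 2))) * w := by ring
      _ ≤ M * w := by gcongr; omega

theorem exists_enum_powersetCard (n k : ℕ) : ∃ ws : ℕ → Finset (Fin n),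
    (∀ j, (ws j).card ≤ k) ∧ ∀ S : Finset (Fin n), S.card = k → ∃ j < n.choose k, S ⊆ ws j := by
  set l := (Finset.powersetCard k (Finset.univ : Finset (Fin n))).toList with hl
  have hlen : l.length = n.choose k := by simp [hl]
  refine ⟨fun j => l.getD j ∅, fun j => ?_, fun S hS => ?_⟩
  · by_cases hj : j < l.length
    · have hmem : ∀ T ∈ l, T.card = k := fun T hT =>
        (Finset.mem_powersetCard.1 (Finset.mem_toList.1 hT)).2
      simp only [List.getD_eq_getElem _ _ hj]
      exact (hmem _ (List.getElem_mem hj)).le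
    · simp only [List.getD_eq_default _ _ (not_lt.1 hj)]
      simp
  · have : S ∈ l := by simp [hl, Finset.mem_powersetCard, hS]
    obtain ⟨j, hj, rfl⟩ := List.getElem_of_mem this
    exact ⟨j, hlen ▸ hj, by simp only [List.getD_eq_getElem _ _ hj]; exact subset_rfl⟩

/-- One pass per k-set needs at most n^k passes. Since M < 4n², the assumption gives n^k ≤
4·log(2/δ)/(α⁴M), so this is within the budget. -/
theorem hasSampler_of_pow_le (hn : 1 ≤ n) (hk : 3 ≤ k) (hα : α ∈ Set.Ioo (0 : ℝ) 1)
    (hδ : δ ∈ Set.Ioo (0 : ℝ) 1) (hM : 256 * (n + k * Fintype.card (GraphletClass k)) ≤ M)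
    (hsq : M < 4 * n ^ 2) (hlog : (n : ℝ) ^ (k + 2) ≤ Real.log (2 / δ) / α ^ 4)
    (write : (Fin n → ℕ) → Memory) (hwrite : ∀ d, (write d).length ≤ M * wordSize n) :
    HasSampler n k M α δ (passBudget k M α δ) write := by
  have hw := wordSize_pos n
  have hm := le_two_mul_card_graphletClass hk
  obtain ⟨ws, hws, hcov⟩ := exists_enum_powersetCard n k
  refine hasSampler_of_cover (κ := k) (Q := n.choose k) (by omega) hα.1.le hδ.1.le
    ws hws (Nat.choose_le_pow n k) hcov ?_ ?_ write hwrite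
  · rw [passBudget_eq]
    have hM0 : (0 : ℝ) < M := by exact_mod_cast (by omega : 0 < M)
    have h1 : ((n.choose k : ℕ) : ℝ) ≤ (n : ℝ) ^ k := by exact_mod_cast Nat.choose_le_pow n k
    have h2 : (M : ℝ) ≤ 4 * (n : ℝ) ^ 2 := by exact_mod_cast hsq.le
    have h3 : (n : ℝ) ^ k ≤ 4 * (Real.log (2 / δ) / α ^ 4 / M) := by
      rw [← mul_div_assoc, le_div_iff₀ hM0]
      calc (n : ℝ) ^ k * M ≤ (n : ℝ) ^ k * (4 * (n : ℝ) ^ 2) := by gcongr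
        _ = 4 * (n : ℝ) ^ (k + 2) := by ring
        _ ≤ _ := by gcongr
    have h4 : (1 : ℝ) ≤ (k : ℝ) ^ (256 * k) :=
      one_le_pow₀ (by exact_mod_cast (by omega : 1 ≤ k))
    have h5 : 0 ≤ Real.log (2 / δ) / α ^ 4 / M := by
      have : (0 : ℝ) ≤ (n : ℝ) ^ k := by positivity
      linarith
    have h6 := le_mul_of_one_le_left h5 h4
    have h7 : (0 : ℝ) ≤ k := by positivity
    linarith
  · generalize Fintype.card (GraphletClass k) = m at *
    generalize wordSize n = w at *
    have h1 : k ≤ k * m := Nat.le_mul_of_pos_right _ (by omega)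
    have h2 : k * k ≤ 2 * (k * m) := by nlinarith
    calc k * w + (m * (k * w) + (k * w + k * k))
        ≤ k * w + (m * (k * w) + (k * w + k * k * w)) := by
          have := Nat.le_mul_of_pos_right (k * k) hw
          omega
      _ = (k + (k * m + (k + k * k))) * w := by ring
      _ ≤ M * w := by gcongr; omega

/-- There are at most 2^(k²) classes and log 2 ≤ log(2/δ), so the union bound costs only the factor
k²+1. -/
theorem log_card_graphletClass_le (hk : 0 < k) (hδ : δ ∈ Set.Ioo (0 : ℝ) 1) :
    Real.log (2 * Fintype.card (GraphletClass k) / δ) ≤ (k * k + 1) * Real.log (2 / δ) := by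
  have := nonempty_graphletClass hk
  have hm : (0 : ℝ) < Fintype.card (GraphletClass k) := by exact_mod_cast Fintype.card_pos
  have h1 : Real.log (Fintype.card (GraphletClass k)) ≤ (k * k) * Real.log 2 := by
    have h : (Fintype.card (GraphletClass k) : ℝ) ≤ 2 ^ (k * k) := by
      exact_mod_cast card_graphletClass_le k
    have := Real.log_le_log hm h
    rw [Real.log_pow] at this
    exact_mod_cast this
  have h2 := log_two_le_log_two_div hδ
  have h3 : 2 * (Fintype.card (GraphletClass k) : ℝ) / δ
      = Fintype.card (GraphletClass k) * (2 / δ) := by ring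
  rw [h3, Real.log_mul hm.ne' (div_pos two_pos hδ.1).ne']
  have h4 : ((k : ℝ) * k) * Real.log 2 ≤ (k * k) * Real.log (2 / δ) := by gcongr
  linarith

theorem trial_constant_le (hk : 3 ≤ k) :
    ((k : ℝ) * k + 1) * (16 * (k : ℝ) ^ (4 * k)) ≤ (k : ℝ) ^ (8 * k) := by
  have h3 : (3 : ℝ) ≤ k := by exact_mod_cast hk
  have h1 : (k : ℝ) * k + 1 ≤ (k : ℝ) ^ 3 := by nlinarith [sq_nonneg (k : ℝ)]
  have h2 : (16 : ℝ) ≤ (k : ℝ) ^ 3 :=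
    (by norm_num : (16 : ℝ) ≤ 3 ^ 3).trans (pow_le_pow_left₀ (by norm_num) h3 3)
  calc ((k : ℝ) * k + 1) * (16 * (k : ℝ) ^ (4 * k))
      ≤ (k : ℝ) ^ 3 * ((k : ℝ) ^ 3 * (k : ℝ) ^ (4 * k)) := by gcongr
    _ = (k : ℝ) ^ (4 * k + 6) := by ring
    _ ≤ _ := pow_le_pow_right₀ (by linarith) (by omega)

theorem hasSampler_of_lt_pow (hn : 1 ≤ n) (hk : 3 ≤ k) (hα : α ∈ Set.Ioo (0 : ℝ) 1)
    (hδ : δ ∈ Set.Ioo (0 : ℝ) 1) (hM : 256 * (n + k * Fintype.card (GraphletClass k)) ≤ M)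
    (hsq : M < 4 * n ^ 2) (hlog : Real.log (2 / δ) / α ^ 4 < (n : ℝ) ^ (k + 2))
    {write : (Fin n → ℕ) → Memory} {read : Memory → Fin n → ℕ}
    (hread : ∀ d, (∀ v, d v ≤ n) → read (write d) = d)
    (hwrite : ∀ d, (write d).length ≤ M * wordSize n) :
    HasSampler n k M α δ (passBudget k M α δ) write := by
  have hw := wordSize_pos n
  have hm := le_two_mul_card_graphletClass hk
  have hkn : k ≤ n := by
    -- If n < k, then n ≤ k-1 ≤ m, so n² ≤ k·m and the memory bound would force 4n² ≤ M.
    by_contra! h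
    have h1 : n ≤ Fintype.card (GraphletClass k) := (by omega : n ≤ k - 1).trans
      (le_card_graphletClass k)
    have h2 : n * n ≤ k * Fintype.card (GraphletClass k) := Nat.mul_le_mul h.le h1
    nlinarith
  have hkk : 128 * (k * k) ≤ M := by nlinarith
  have hkpos : 0 < 64 * (k * k) := by positivity
  -- A trial takes at most 3k² words, so `b` trials use only a small fraction of `M`. Also 128k² ≤ M
  -- makes b ≥ 1, and rounding down loses at most a factor 2.
  obtain ⟨b, hb⟩ : ∃ b, b = M / (64 * (k * k)) := ⟨_, rfl⟩
  have hb1 : b * (64 * (k * k)) ≤ M := hb ▸ Nat.div_mul_le_self _ _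
  have hb0 : 1 ≤ b := by
    rw [hb, Nat.one_le_div_iff hkpos]; omega
  have hb2 : M ≤ 128 * (k * k) * b := by
    have : M < 64 * (k * k) * (b + 1) := by
      rw [hb]; exact Nat.lt_mul_div_succ M hkpos
    nlinarith
  have hlog0 : 0 < Real.log (2 / δ) :=
    (Real.log_pos (by norm_num)).trans_le (log_two_le_log_two_div hδ)
  have hα4 : (0 : ℝ) < α ^ 4 := pow_pos hα.1 4
  have hk0 : (0 : ℝ) < k := by exact_mod_cast (by omega : 0 < k)
  have hk1 : (1 : ℝ) ≤ k := by exact_mod_cast (by omega : 1 ≤ k)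
  have hbR : (0 : ℝ) < b := by exact_mod_cast hb0
  have hMR : (0 : ℝ) < M := by exact_mod_cast (by omega : 0 < M)
  obtain ⟨L, hL⟩ : ∃ L, L = Real.log (2 / δ) / α ^ 4 := ⟨_, rfl⟩
  have hL0 : 0 < L := hL ▸ div_pos hlog0 hα4
  -- `X` is a sufficient number of trials: k^(8k) covers k^(4k), the factor 16 and the union bound
  -- k²+1. `Q` rounds of `b` trials reach it.
  obtain ⟨X, hX⟩ : ∃ X, X = (k : ℝ) ^ (8 * k) * L := ⟨_, rfl⟩
  have hX0 : 0 < X := by rw [hX]; positivity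
  obtain ⟨Q, hQ⟩ : ∃ Q, Q = ⌈X / b⌉₊ := ⟨_, rfl⟩
  have hQ0 : 0 < Q := hQ ▸ Nat.ceil_pos.2 (div_pos hX0 hbR)
  have hQ1 : X ≤ Q * b := by
    rw [← div_le_iff₀ hbR, hQ]; exact Nat.le_ceil _
  have hQ2 : (Q : ℝ) ≤ X / b + 1 := hQ ▸ (Nat.ceil_lt_add_one (div_pos hX0 hbR).le).le
  rw [← hL] at hlog
  -- Since L < n^(k+2), the total number of trials is at most n^(10k), so a counter fits into 10k
  -- words.
  refine hasSampler_of_trials (b := b) (Q := Q) (w := (10 * k) * wordSize n)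
    (by omega) hkn hb0 hQ0 ?_ hα.1 hα.2 hδ.1 ?_ ?_ ?_ hread hwrite
  · refine lt_of_le_of_lt ?_ (pow_lt_two_pow n (by omega : 0 < 10 * k))
    have hn3 : (3 : ℝ) ≤ n := by exact_mod_cast hk.trans hkn
    have hbn : (b : ℝ) ≤ 4 * (n : ℝ) ^ 2 := by
      have : b ≤ 4 * n ^ 2 := by nlinarith
      exact_mod_cast this
    have h1 : X ≤ (n : ℝ) ^ (9 * k + 2) := by
      calc X ≤ (n : ℝ) ^ (8 * k) * (n : ℝ) ^ (k + 2) := by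
            rw [hX]; gcongr
        _ = _ := by ring
    have h2 : 4 * (n : ℝ) ^ 2 ≤ 2 * (n : ℝ) ^ (9 * k + 2) := by
      calc 4 * (n : ℝ) ^ 2 ≤ 2 * (n : ℝ) ^ 3 := by nlinarith [sq_nonneg (n : ℝ)]
        _ ≤ _ := by gcongr <;> linarith
    have h3 : 3 * (n : ℝ) ^ (9 * k + 2) ≤ (n : ℝ) ^ (10 * k) := by
      calc 3 * (n : ℝ) ^ (9 * k + 2) ≤ n * (n : ℝ) ^ (9 * k + 2) := by gcongr
        _ = (n : ℝ) ^ (9 * k + 3) := by ring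
        _ ≤ _ := pow_le_pow_right₀ (by linarith) (by omega)
    have h4 : (Q : ℝ) * b ≤ X + b := by
      calc (Q : ℝ) * b ≤ (X / b + 1) * b := by gcongr
        _ = X + b := by field_simp
    have h5 : (Q : ℝ) * b ≤ (n : ℝ) ^ (10 * k) := by linarith
    exact_mod_cast h5
  · have h1 := log_card_graphletClass_le (by omega : 0 < k) hδ
    have h2 := trial_constant_le hk
    -- The concentration bound needs only α² in the denominator; the budget allows α⁴.
    have h3 : Real.log (2 / δ) ≤ α ^ 2 * L := by
      rw [hL, ← mul_div_assoc, le_div_iff₀ hα4]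
      have : α ^ 4 ≤ α ^ 2 := pow_le_pow_of_le_one hα.1.le hα.2.le (by norm_num)
      nlinarith
    push_cast
    calc Real.log (2 * Fintype.card (GraphletClass k) / δ) * (16 * (k : ℝ) ^ (4 * k))
        ≤ (k * k + 1) * Real.log (2 / δ) * (16 * (k : ℝ) ^ (4 * k)) := by gcongr
      _ = ((k * k + 1) * (16 * (k : ℝ) ^ (4 * k))) * Real.log (2 / δ) := by ring
      _ ≤ (k : ℝ) ^ (8 * k) * (α ^ 2 * L) := by gcongr
      _ = α ^ 2 * X := by rw [hX]; ring
      _ ≤ α ^ 2 * (Q * b) := by gcongr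
  · rw [passBudget_eq, ← hL]
    have h1 : (1 : ℝ) / b ≤ 128 * (k * k) / M := by
      rw [div_le_div_iff₀ hbR hMR, one_mul]; exact_mod_cast hb2
    push_cast
    have h2 : (k : ℝ) ^ (8 * k + 3) ≤ (k : ℝ) ^ (256 * k) := pow_le_pow_right₀ hk1 (by omega)
    have h3 : 0 ≤ (k : ℝ) ^ (256 * k) * (L / M) := by positivity
    calc (Q : ℝ) * k ≤ (X / b + 1) * k := by gcongr
      _ = k + X * k * (1 / b) := by ring
      _ ≤ k + X * k * (128 * (k * k) / M) := by gcongr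
      _ = k + 128 * ((k : ℝ) ^ (8 * k + 3) * (L / M)) := by rw [hX]; ring
      _ ≤ k + 128 * ((k : ℝ) ^ (256 * k) * (L / M)) := by gcongr
      _ ≤ _ := by linarith
  · generalize Fintype.card (GraphletClass k) = m at *
    generalize wordSize n = w at *
    have h1 : k ≤ k * m := Nat.le_mul_of_pos_right _ (by omega)
    have h2 : k * w + k * k + (2 * w + w) ≤ 3 * (k * k) * w := by
      have e1 : k * w ≤ k * k * w := by gcongr; exact Nat.le_mul_self k
      have e2 := Nat.le_mul_of_pos_right (k * k) hw
      have e3 : 3 * w ≤ k * k * w := by gcongr; nlinarith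
      linarith
    have h3 : n + (10 * (k * m) + (10 * k + (1 + 3 * (b * (k * k))))) ≤ M := by
      have : b * (64 * (k * k)) = 64 * (b * (k * k)) := by ring
      omega
    calc n * w + (m * (10 * k * w) + (10 * k * w + (w + b * (k * w + k * k + (2 * w + w)))))
        ≤ n * w + (m * (10 * k * w) + (10 * k * w + (w + b * (3 * (k * k) * w)))) := by gcongr
      _ = (n + (10 * (k * m) + (10 * k + (1 + 3 * (b * (k * k)))))) * w := by ring
      _ ≤ M * w := by gcongr

theorem exists_hasSampler (hn : 1 ≤ n) (hk : 3 ≤ k) (hα : α ∈ Set.Ioo (0 : ℝ) 1)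
    (hδ : δ ∈ Set.Ioo (0 : ℝ) 1) (hM : 256 * (n + k * Fintype.card (GraphletClass k)) ≤ M)
    {write : (Fin n → ℕ) → Memory} {read : Memory → Fin n → ℕ}
    (hread : ∀ d, (∀ v, d v ≤ n) → read (write d) = d)
    (hwrite : ∀ d, (write d).length ≤ M * wordSize n) :
    HasSampler n k M α δ (passBudget k M α δ) write := by
  by_cases hsq : 4 * n ^ 2 ≤ M
  · exact hasSampler_of_square_le hn hk hα hδ hM hsq write hwrite
  · rcases le_or_gt ((n : ℝ) ^ (k + 2)) (Real.log (2 / δ) / α ^ 4) with h | h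
    · exact hasSampler_of_pow_le hn hk hα hδ hM (not_le.1 hsq) h write hwrite
    · exact hasSampler_of_lt_pow hn hk hα hδ hM (not_le.1 hsq) h hread hwrite

theorem one_le_log_add_two (hn : 1 ≤ n) : 1 ≤ Real.log (n + 2) := by
  have h1 : (1 : ℝ) ≤ n := by exact_mod_cast hn
  rw [Real.le_log_iff_exp_le (by positivity)]
  have := Real.exp_one_lt_d9
  linarith

theorem wordSize_le_log (hn : 1 ≤ n) : (wordSize n : ℝ) ≤ 3 * Real.log (n + 2) := by
  have h1 : (1 : ℝ) ≤ n := by exact_mod_cast hn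
  have h2 : ((2 : ℝ)) ^ Nat.log 2 n ≤ n + 2 := by
    have : 2 ^ Nat.log 2 n ≤ n := Nat.pow_log_le_self 2 (by omega)
    have : ((2 : ℝ)) ^ Nat.log 2 n ≤ n := by exact_mod_cast this
    linarith
  have h3 := Real.log_le_log (by positivity) h2
  rw [Real.log_pow] at h3
  have h4 := one_le_log_add_two hn
  have h5 := Real.log_two_gt_d9
  have h6 : (Nat.log 2 n : ℝ) * (1 / 2) ≤ Nat.log 2 n * Real.log 2 := by gcongr; linarith
  simp only [wordSize]
  push_cast
  linarith

theorem preprocessing_bits_le {c : ℝ} (hn : 1 ≤ n) (hc : 0 < c) {x : ℕ}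
    (hx : x ≤ 3 * (n * wordSize n) + 1) :
    (x : ℝ) ≤ (256 : ℕ) * (n : ℝ) ^ (1 + c) * Real.log (n + 2) ^ 256 := by
  have h1 : (1 : ℝ) ≤ n := by exact_mod_cast hn
  have hl := one_le_log_add_two hn
  have h2 : x ≤ 4 * (n * wordSize n) := by
    have : 0 < n * wordSize n := Nat.mul_pos hn (wordSize_pos n)
    omega
  have h3 : (n : ℝ) ≤ (n : ℝ) ^ (1 + c) := by
    simpa using Real.rpow_le_rpow_of_exponent_le h1 (by linarith : (1 : ℝ) ≤ 1 + c)
  have h4 : Real.log (n + 2) ≤ Real.log (n + 2) ^ 256 := le_self_pow₀ hl (by norm_num)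
  calc (x : ℝ) ≤ 4 * (n * wordSize n) := by exact_mod_cast h2
    _ ≤ 4 * ((n : ℝ) ^ (1 + c) * (3 * Real.log (n + 2) ^ 256)) := by
        gcongr
        exact (wordSize_le_log hn).trans (by linarith)
    _ = 12 * ((n : ℝ) ^ (1 + c) * Real.log (n + 2) ^ 256) := by ring
    _ ≤ 256 * ((n : ℝ) ^ (1 + c) * Real.log (n + 2) ^ 256) := by gcongr; norm_num
    _ = _ := by push_cast; ring

end parameters

/-! ### The two phases together -/

section main

variable {n k M : ℕ} {c α δ : ℝ}

/-- The guarantees of a two-phase algorithm for given parameters, with the constant `C`. -/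
def Meets (C M : ℕ) (c α δ : ℝ) (A : TwoPhaseAlg n k) : Prop :=
  ∃ N : ℕ, ∀ (G : SimpleGraph (Fin n)) (order₁ : Config → List (Sym2 (Fin n)))
    (order₂ : Config → Config → List (Sym2 (Fin n))),
    (∀ s, IsEdgeStream G (order₁ s)) → (∀ s t, IsEdgeStream G (order₂ s t)) →
    (∀ s ∈ (A.run order₁ order₂ N).support,
      A.preprocessing.halt s.1.mem = true ∧ A.sampling.halt s.2.mem = true ∧
      A.output s.2.mem ∈ stdSimplex ℝ (GraphletClass k)) ∧
    ENNReal.ofReal (1 - 1 / (n : ℝ)) ≤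
      (A.run order₁ order₂ N).toOuterMeasure
        {s | (s.1.passes : ℝ) ≤ C * (1 + 1 / c) ∧
          (s.1.peak : ℝ) ≤ C * (n : ℝ) ^ (1 + c) * Real.log (n + 2) ^ C} ∧
    (∀ s ∈ (A.run order₁ order₂ N).support,
      (s.2.passes : ℝ) ≤ C * (k + (k : ℝ) ^ (C * k) / (α ^ 4 * M) * Real.log (2 / δ)) ∧
      s.2.peak ≤ M * wordSize n) ∧
    (0 < numGraphlets k G →
      ENNReal.ofReal (1 - δ) ≤
        (A.run order₁ order₂ N).toOuterMeasure
          {s | ∀ i : GraphletClass k, |A.output s.2.mem i - graphletDist G i| ≤ α})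

theorem exists_meets (hn : 1 ≤ n) (hk : 3 ≤ k) (hc : 0 < c) (hα : α ∈ Set.Ioo (0 : ℝ) 1)
    (hδ : δ ∈ Set.Ioo (0 : ℝ) 1) (hM : 256 * (n + k * Fintype.card (GraphletClass k)) ≤ M) :
    ∃ A : TwoPhaseAlg n k, Meets 256 M c α δ A := by
  obtain ⟨P, write, read, hread, hlen, hP⟩ := exists_preprocessing n k
  have hwrite : ∀ d, (write d).length ≤ M * wordSize n := fun d => by
    rw [hlen]
    have h1 : 0 < n * wordSize n := Nat.mul_pos hn (wordSize_pos n)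
    calc 3 * (n * wordSize n) + 1 ≤ 4 * n * wordSize n := by linarith
      _ ≤ M * wordSize n := by gcongr; omega
  obtain ⟨S, out, N₀, hS⟩ := exists_hasSampler hn hk hα hδ hM hread hwrite
  refine ⟨⟨P, S, out⟩, max 1 N₀, fun G order₁ order₂ h₁ h₂ => ?_⟩
  have hpre := hP G order₁ h₁ (max 1 N₀) (le_max_left _ _)
  have hsam := fun s => hS (max 1 N₀) (le_max_right _ _) G (order₂ s) (h₂ s)
  have hsupp : ∀ s ∈ (TwoPhaseAlg.run ⟨P, S, out⟩ order₁ order₂ (max 1 N₀)).support,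
      s.1 ∈ (P.run order₁ (max 1 N₀) []).support ∧
      s.2 ∈ (S.run (order₂ s.1) (max 1 N₀) (write (profile G k))).support := by
    intro s hs
    simp only [TwoPhaseAlg.run, PMF.mem_support_bind_iff, PMF.mem_support_map_iff] at hs
    obtain ⟨s₁, hs₁, s₂, hs₂, rfl⟩ := hs
    rw [(hpre s₁ hs₁).2.1] at hs₂
    exact ⟨hs₁, hs₂⟩
  refine ⟨fun s hs => ?_, ?_, fun s hs => ?_, fun hG => ?_⟩
  · obtain ⟨a, b⟩ := hsupp s hs
    exact ⟨(hpre _ a).1, ((hsam s.1).1 _ b).1, ((hsam s.1).1 _ b).2.1⟩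
  · rw [toOuterMeasure_eq_one]
    · rw [ENNReal.ofReal_le_one]
      have : (0 : ℝ) ≤ 1 / n := by positivity
      linarith
    · intro s hs
      obtain ⟨-, -, h3, h4⟩ := hpre _ (hsupp s hs).1
      refine ⟨?_, preprocessing_bits_le hn hc h4⟩
      rw [h3]
      have : 0 ≤ 1 / c := by positivity
      push_cast
      linarith
  · obtain ⟨-, -, h3, h4⟩ := (hsam s.1).1 _ (hsupp s hs).2
    exact ⟨h3, h4⟩
  · rw [TwoPhaseAlg.run, expect_toOuterMeasure_bind]
    refine le_expect _ fun s hs => ?_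
    rw [(hpre s hs).2.1, PMF.toOuterMeasure_map_apply]
    exact (hsam s).2 hG

theorem exists_two_phase_algorithms :
    ∃ alg : (n k M : ℕ) → (c α δ : ℝ) → TwoPhaseAlg n k,
      ∀ (n k M : ℕ) (c α δ : ℝ), 1 ≤ n → 3 ≤ k → 0 < c → α ∈ Set.Ioo (0 : ℝ) 1 →
        δ ∈ Set.Ioo (0 : ℝ) 1 → 256 * (n + k * Fintype.card (GraphletClass k)) ≤ M →
        Meets 256 M c α δ (alg n k M c α δ) := by
  -- Parameters outside the admissible range receive an arbitrary algorithm, so that `alg` is total.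
  have idle : ∀ n k, Nonempty (TwoPhaseAlg n k) := fun n k =>
    ⟨⟨PMF.pure, fun _ => true, fun m _ => PMF.pure m, PMF.pure⟩,
      ⟨PMF.pure, fun _ => true, fun m _ => PMF.pure m, PMF.pure⟩, fun _ _ => 0⟩
  have h : ∀ (n k M : ℕ) (c α δ : ℝ), ∃ A : TwoPhaseAlg n k,
      1 ≤ n → 3 ≤ k → 0 < c → α ∈ Set.Ioo (0 : ℝ) 1 →
        δ ∈ Set.Ioo (0 : ℝ) 1 → 256 * (n + k * Fintype.card (GraphletClass k)) ≤ M →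
        Meets 256 M c α δ A := by
    intro n k M c α δ
    by_cases hp : 1 ≤ n ∧ 3 ≤ k ∧ 0 < c ∧ α ∈ Set.Ioo (0 : ℝ) 1 ∧
        δ ∈ Set.Ioo (0 : ℝ) 1 ∧ 256 * (n + k * Fintype.card (GraphletClass k)) ≤ M
    · obtain ⟨h1, h2, h3, h4, h5, h6⟩ := hp
      obtain ⟨A, hA⟩ := exists_meets h1 h2 h3 h4 h5 h6
      exact ⟨A, fun _ _ _ _ _ _ => hA⟩
    · exact ⟨(idle n k).some, fun h1 h2 h3 h4 h5 h6 => absurd ⟨h1, h2, h3, h4, h5, h6⟩ hp⟩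
  choose alg halg using h
  exact ⟨alg, halg⟩

end main

end GraphletStream

end

open GraphletStream in
theorem theorem1 :
    ∃ (C : ℕ) (alg : (n k M : ℕ) → (c α δ : ℝ) → TwoPhaseAlg n k),
      ∀ (n k M : ℕ) (c α δ : ℝ), 1 ≤ n → 3 ≤ k → 0 < c → α ∈ Set.Ioo (0 : ℝ) 1 →
        δ ∈ Set.Ioo (0 : ℝ) 1 → C * (n + k * Fintype.card (GraphletClass k)) ≤ M →
      ∃ N : ℕ, ∀ (G : SimpleGraph (Fin n)) (order₁ : Config → List (Sym2 (Fin n)))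
        (order₂ : Config → Config → List (Sym2 (Fin n))),
        (∀ s, IsEdgeStream G (order₁ s)) → (∀ s t, IsEdgeStream G (order₂ s t)) →
        -- the algorithm always terminates and returns a probability distribution
        (∀ s ∈ ((alg n k M c α δ).run order₁ order₂ N).support,
          (alg n k M c α δ).preprocessing.halt s.1.mem = true ∧
          (alg n k M c α δ).sampling.halt s.2.mem = true ∧
          (alg n k M c α δ).output s.2.mem ∈ stdSimplex ℝ (GraphletClass k)) ∧
        -- passes and bits of the preprocessing phase
        ENNReal.ofReal (1 - 1 / (n : ℝ)) ≤
          ((alg n k M c α δ).run order₁ order₂ N).toOuterMeasure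
            {s | (s.1.passes : ℝ) ≤ C * (1 + 1 / c) ∧
              (s.1.peak : ℝ) ≤ C * (n : ℝ) ^ (1 + c) * Real.log (n + 2) ^ C} ∧
        -- passes and bits of the sampling phase
        (∀ s ∈ ((alg n k M c α δ).run order₁ order₂ N).support,
          (s.2.passes : ℝ) ≤
            C * (k + (k : ℝ) ^ (C * k) / (α ^ 4 * M) * Real.log (2 / δ)) ∧
          s.2.peak ≤ M * wordSize n) ∧
        -- accuracy
        (0 < numGraphlets k G →
          ENNReal.ofReal (1 - δ) ≤
            ((alg n k M c α δ).run order₁ order₂ N).toOuterMeasure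
              {s | ∀ i : GraphletClass k,
                |(alg n k M c α δ).output s.2.mem i - graphletDist G i| ≤ α}) := by
  obtain ⟨alg, h⟩ := exists_two_phase_algorithms
  exact ⟨256, alg, h⟩
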